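/- **Setting.** Let $G=\langle a,b,c,d\mid abABcdCD=1\rangle$ (capital letters denote inverses) be the fundamental group of the closed orientable surface of genus $2$, acting on $\mathbb H^2$ by deck transformations with fundamental domain a regular octagon $F$ with vertex angles $\pi/4$. The translates of $F$ tessellate $\mathbb H^2$; the union of their sides is the net $N$, a union of complete geodesics. The Cayley graph $\Gamma$ of $G$ is embedded dually to $N$: its vertices are the centers of the octagons of $N$, and its (geodesic, labelled) edges join the centers of adjacent octagons. The complementary octagons of $\Gamma$ are dual to the vertices of $N$. "Wedge at a vertex $p$ of $N$" means a closed sector of angle $\pi/4$ at $p$ between two consecutive geodesics of $N$ through $p$. All regions below are regarded as subsets of $\mathbb H^2\cup\partial\mathbb H^2$: closed regions contain their ideal boundary points, open regions do not. **Steps.** A *step* consists of one, two or three directed edges of $\Gamma$ and a region, and has one of the following types. - $A$: one edge, leaving an octagon $V$ of $N$ across a side $s$; the region is the open set beyond $s$ and not beyond the two sides of $V$ adjacent to $s$. It has two boundary rays, starting at the two ends of $s$. - $A'^L$ / $A'^R$: one edge; the region is that of type $A$ with the wedge along its left / right boundary ray removed (with apex at the left / right end of $s$). $A''^L$ / $A''^R$: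 the next wedge at the same apex is removed too. - $B$, $C$, $C'$, $D$: fix a vertex $q$ of $N$, an octagon $V$ of $N$ at $q$ and the wedge $W$ at $q$ opposite to $V$. The two paths in $\Gamma$ around $q$ from the center of $V$ to the center of the opposite octagon have four edges each; the $1$st, $2$nd, $3$rd, $4$th edges of both paths form the two edges of a step $B$, $C$, $C'$, $D$. The region of $B$, $C$, $C'$ is $W$. The region of $D$ is the interior of $W$ with two closed wedges $W_L,W_R$ removed: let $V'$ be the octagon of $N$ in $W$ at $q$, and let $r_L$ ($r_R$) be the vertex of $V'$ adjacent to $q$ on the left (right) boundary ray of $W$; $W_L$ ($W_R$) is the wedge at $r_L$ ($r_R$) inside $W$ along that boundary ray. - $E^L$ / $E^R$: three edges, namely the two edges of the step $D$ above together with one more, so that the left / right edge of $D$ and the new edge are the two edges of a step $B$ at $r_L$ / $r_R$ with region $W_L$ / $W_R$; this wedge is the region of the step. **Markov chain.** A *state* is a type together with the labels of its edges ($88$ states). One step follows another if its edges start where the edges of the other end, and its region is one of the pieces into which the region of the other is divided as follows. A region of type $A$, $A'$, $A''$ or $D$, minus the octagon of $N$ containing the final vertex, is divided by the geodesics extending the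 sides of that octagon into the regions of the steps of type $A$, $A'$, $A''$, $B$ that start there (the extreme left and right pieces adjacent to removed or outer wedges being of type $A'^L$, $A'^R$, resp. $A''^L$ after $A'^L$ and $A''^R$ after $A'^R$, while on the narrowed side of an $A''$ the extreme piece is of type $A$); $B$ is followed by $C$, and $C$ by $C'$, with the same region; $C'$ is followed by $D$, $E^L$ or $E^R$; and $E^L$, $E^R$ are followed by $C$ with the same region. An element of the Markov chain is a bi-infinite sequence of states in which each state can be followed by the next, i.e. has an image in the universal cover followed by an image of the next. **Snakes.** An *Infinite Snake* is an image in the universal cover of an element of the Markov chain: a bi-infinite sequence of steps $(S_i)_{i\in\mathbb Z}$, each following the previous one. Two Infinite Snakes are the same if they agree up to a shift of the index. Its *forward* (*backward*) *limit point* is the point of $\partial\mathbb H^2$ to which the edges of $S_i$ converge as $i\to+\infty$ ($i\to-\infty$). Its *inverse* is the Infinite Snake whose $i$-th step has the edges of $S_{-i}$ traversed in the opposite direction. A *Proper Infinite Snake* is an Infinite Snake such that all of its regions contain one of its limit points and all regions of its inverse contain the other limit point. **Theorem.** Let $f\neq b$ be points of $\partial\mathbb H^2$ that are not the two endpoints of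 a geodesic of $N$. If $S$ and $S'$ are Proper Infinite Snakes, both with forward limit point $f$ and backward limit point $b$, then $S$ and $S'$ are the same: there is $k\in\mathbb Z$ such that for all $i\in\mathbb Z$ the steps $S'_i$ and $S_{i+k}$ coincide (same type, same edges, same region). -/

import Mathlib

open Filter Topology

noncomputable section

namespace Snakes

/-! ### The hyperbolic plane

We use the Beltrami-Klein model: the hyperbolic plane is the open unit disc of `ℂ`, its boundary
at infinity is the unit circle `Circle`, and geodesics are straight chords. The point `z` of the
closed disc has homogeneous coordinates `(re z, im z, 1)`, and isometries are given by `3 × 3`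
Lorentz matrices acting on homogeneous coordinates. -/

/-- Vectors of homogeneous coordinates. -/
abbrev Vec := Fin 3 → ℝ

/-- The Lorentz form. -/
def lor (u v : Vec) : ℝ := u 0 * v 0 + u 1 * v 1 - u 2 * v 2

/-- Homogeneous coordinates of a point of the closed unit disc. -/
def lift (z : ℂ) : Vec := ![z.re, z.im, 1]

/-- The point of the Klein disc with given homogeneous coordinates. -/
def toKlein (v : Vec) : ℂ := ⟨v 0 / v 2, v 1 / v 2⟩

/-- Hyperbolic cosine of the inradius of the regular octagon with vertex angles `π / 4`. -/
def cR : ℝ := 1 + √2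

/-- Hyperbolic sine of the inradius of the regular octagon with vertex angles `π / 4`. -/
def sR : ℝ := √(2 + 2 * √2)

theorem sR_sq : sR ^ 2 = cR ^ 2 - 1 := by
  have h2 : √2 ^ 2 = (2 : ℝ) := Real.sq_sqrt (by norm_num)
  have h : sR ^ 2 = 2 + 2 * √2 := Real.sq_sqrt (by positivity)
  rw [h, cR]
  linear_combination -h2

/-- Counterclockwise rotation by `k π / 4` about the centre of the disc. -/
def rot (k : ℤ) : Matrix (Fin 3) (Fin 3) ℝ :=
  !![Real.cos (k * (Real.pi / 4)), -Real.sin (k * (Real.pi / 4)), 0;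
     Real.sin (k * (Real.pi / 4)), Real.cos (k * (Real.pi / 4)), 0;
     0, 0, 1]

/-- The rotation by `π` about the point `(sR, 0, cR)` of the hyperboloid, which is the midpoint of
side `0` of the octagon. -/
def halfTurn : Matrix (Fin 3) (Fin 3) ℝ :=
  !![-1 - 2 * sR ^ 2, 0, 2 * sR * cR;
     0, -1, 0;
     -(2 * sR * cR), 0, 2 * cR ^ 2 - 1]

theorem rot_mul (k l : ℤ) : rot k * rot l = rot (k + l) := by
  have e : ((k + l : ℤ) : ℝ) * (Real.pi / 4) = k * (Real.pi / 4) + l * (Real.pi / 4) := by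
    push_cast; ring
  simp only [rot, e, Real.cos_add, Real.sin_add]
  ext i j
  fin_cases i <;> fin_cases j <;> simp [Matrix.mul_apply, Fin.sum_univ_three] <;> ring

theorem rot_zero : rot 0 = 1 := by
  ext i j
  fin_cases i <;> fin_cases j <;> simp [rot]

theorem halfTurn_mul_self : halfTurn * halfTurn = 1 := by
  have h := sR_sq
  ext i j
  fin_cases i <;> fin_cases j <;> simp [halfTurn, Matrix.mul_apply, Fin.sum_univ_three]
  · linear_combination (4 * sR ^ 2) * h
  · linear_combination (-4 * sR * cR) * h
  · linear_combination (4 * sR * cR) * h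
  · linear_combination (-4 * cR ^ 2) * h

/-! ### The surface group of genus two

`F` is the regular octagon with vertex angles `π / 4` centred at the centre of the disc; its side
number `k` is the image of side `0` under `rot k`. The sides are labelled by the generators
`a, b, c, d` and their inverses `A, B, C, D`, in the cyclic order in which the corresponding edges
leave a vertex of the Cayley graph of `⟨a, b, c, d | a b A B c d C D⟩`. -/

/-- The generators and their inverses (capital letters). -/
inductive Letter
  | a | b | c | d | A | B | C | D

namespace Letter

/-- The inverse letter. -/
def inv : Letter → Letter
  | a => A | b => B | c => C | d => D | A => a | B => b | C => c | D => d

/-- The number of the side of `F` that is crossed by the edge labelled with the letter. Reading the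
relator `a b A B c d C D` counterclockwise around an octagon of the Cayley graph, the edges leave
each vertex in the counterclockwise order `b, A, B, a, d, C, D, c`. -/
def pos : Letter → ℤ
  | b => 0 | A => 1 | B => 2 | a => 3 | d => 4 | C => 5 | D => 6 | c => 7

theorem inv_inv (x : Letter) : x.inv.inv = x := by cases x <;> rfl

end Letter

/-- The side pairing of `F` belonging to a letter `x`: the orientation preserving isometry that maps
`F` to the octagon adjacent along side `x`, and side `x.inv` of `F` to side `x` of `F`. -/
def pairing (x : Letter) : Matrix (Fin 3) (Fin 3) ℝ :=
  rot x.pos * halfTurn * rot (-x.inv.pos)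

theorem pairing_mul_inv (x : Letter) : pairing x * pairing x.inv = 1 := by
  have h1 : rot (-x.inv.pos) * rot x.inv.pos = 1 := by rw [rot_mul, neg_add_cancel, rot_zero]
  have h2 : rot x.pos * rot (-x.pos) = 1 := by rw [rot_mul, add_neg_cancel, rot_zero]
  calc pairing x * pairing x.inv
      = rot x.pos * (halfTurn * ((rot (-x.inv.pos) * rot x.inv.pos) * halfTurn)) * rot (-x.pos) := by
        simp only [pairing, Letter.inv_inv, Matrix.mul_assoc]
    _ = 1 := by rw [h1, Matrix.one_mul, halfTurn_mul_self, Matrix.mul_one, h2]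

/-- The side pairing as an invertible matrix. -/
def pairingUnit (x : Letter) : (Matrix (Fin 3) (Fin 3) ℝ)ˣ where
  val := pairing x
  inv := pairing x.inv
  val_inv := pairing_mul_inv x
  inv_val := by simpa only [Letter.inv_inv] using pairing_mul_inv x.inv

/-- The group of deck transformations: it is generated by the side pairings of `F`. -/
def deckGroup : Subgroup (Matrix (Fin 3) (Fin 3) ℝ)ˣ :=
  Subgroup.closure (Set.range pairingUnit)

/-! ### Directed edges of the Cayley graph, and the net

The translates `g F` of `F` by deck transformations tessellate the plane. The Cayley graph has the
centres of the octagons as vertices, and the edge labelled `x` that leaves the centre of `g F`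
crosses side `x` of `g F`. A directed edge is recorded by its *frame*: the orientation preserving
isometry that carries the octagon `F` to the octagon where the edge starts, and side `0` of `F` to
the side that the edge crosses. -/

/-- Directed edges, recorded by their frames. -/
abbrev Edge := Matrix (Fin 3) (Fin 3) ℝ

/-- The edge labelled `x` that leaves the centre of the octagon `g F`. -/
def edgeAt (g : (Matrix (Fin 3) (Fin 3) ℝ)ˣ) (x : Letter) : Edge :=
  (g : Matrix (Fin 3) (Fin 3) ℝ) * rot x.pos

namespace Edge

/-- The edge traversed in the opposite direction. -/
def rev (e : Edge) : Edge := e * halfTurn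

/-- The edge with the same initial vertex that is `k` places further counterclockwise. -/
def spin (k : ℤ) (e : Edge) : Edge := e * rot k

/-- The edge that leaves the final vertex of `e` and is `k` places counterclockwise from the
reverse of `e`. So `k = 1` is the right-most turn and `k = 7` (or `k = -1`) the left-most one. -/
def next (k : ℤ) (e : Edge) : Edge := spin k (rev e)

/-- Right-most turn: the next edge around the octagon of the Cayley graph to the right of `e`. -/
def right (e : Edge) : Edge := next 1 e

/-- Left-most turn: the next edge around the octagon of the Cayley graph to the left of `e`. -/
def left (e : Edge) : Edge := next (-1) e

/-- The initial vertex, as a point of the disc. -/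
def source (e : Edge) : ℂ := toKlein (e.mulVec ![0, 0, 1])

/-- The final vertex, as a point of the disc. -/
def target (e : Edge) : ℂ := source (rev e)

/-- The linear form whose zero set is the geodesic of the net that `e` crosses. It is positive on
the side into which `e` crosses and negative on the side where `e` starts. -/
def height (e : Edge) (z : ℂ) : ℝ := lor (e.mulVec ![cR, 0, sR]) (lift z)

/-- The geodesic that contains the side crossed by `e`, together with its two endpoints on the
boundary circle. -/
def geodesic (e : Edge) : Set ℂ := {z | ‖z‖ ≤ 1 ∧ height e z = 0}

end Edge

/-- The geodesics of the net `N` formed by the sides of the octagons `g F` (each with its two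
endpoints at infinity). -/
def netGeodesics : Set (Set ℂ) :=
  {ℓ | ∃ g ∈ deckGroup, ∃ x : Letter, ℓ = (edgeAt g x).geodesic}

/-! ### Steps: edges and regions

A step consists of one, two or three directed edges and a region. -/

/-- The kinds of steps: the cases `A`, `A'` and `A''` (left and right), `B`, `C`, `C'`, `D`, and `E`
(left and right). -/
inductive Kind
  | A | ApL | ApR | AppL | AppR | B | C | Cp | D | EL | ER

/-- A step in the universal cover: its kind and a base edge.
For `A`, `A'` and `A''` the base is the edge of the step.
For `B`, `C`, `C'` and `D` the base is the left one of the two edges at which the two branches of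
the snake start to run around the current octagon of the Cayley graph (the right one is
`base.spin (-1)`).
For `E` it is the left one of the two edges that start running around the next octagon. -/
structure Step where
  kind : Kind
  base : Edge

namespace Step

open Edge

/-- The edges of a step, from left to right. -/
def edges : Step → List Edge
  | ⟨.A, e⟩ => [e]
  | ⟨.ApL, e⟩ => [e]
  | ⟨.ApR, e⟩ => [e]
  | ⟨.AppL, e⟩ => [e]
  | ⟨.AppR, e⟩ => [e]
  | ⟨.B, e⟩ => [e, e.spin (-1)]
  | ⟨.C, e⟩ => [e.right, (e.spin (-1)).left]
  | ⟨.Cp, e⟩ => [e.right.right, (e.spin (-1)).left.left]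
  | ⟨.D, e⟩ => [e.right.right.right, (e.spin (-1)).left.left.left]
  | ⟨.EL, e⟩ => [e, e.spin (-1), (e.spin (-1)).right.rev]
  | ⟨.ER, e⟩ => [e.left.rev, e, e.spin (-1)]

/-- The closed wedge opposite to the initial octagon of `e` at the right endpoint of the side that
`e` crosses. It is bounded by two rays. -/
def wedge (e : Edge) : Set ℂ := {z | ‖z‖ ≤ 1 ∧ 0 ≤ e.height z ∧ 0 ≤ (e.spin (-1)).height z}

/-- The region of a step, as a subset of the closed disc; boundary points at infinity are included.

`A`: the open region beyond the side crossed by `e`, but not beyond the two adjacent sides.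
`A'`, `A''`: the same region with one or two wedges (with apex at the left, respectively right,
endpoint of the crossed side) removed.
`B`, `C`, `C'`, `E`: the closed wedge.
`D`: the open wedge without the two closed wedges of the two possible steps `E`. -/
def region : Step → Set ℂ
  | ⟨.A, e⟩ => {z | ‖z‖ ≤ 1 ∧ 0 < e.height z ∧
      (e.spin 1).height z < 0 ∧ (e.spin (-1)).height z < 0}
  | ⟨.ApL, e⟩ => {z | ‖z‖ ≤ 1 ∧ 0 < e.height z ∧
      e.left.left.height z < 0 ∧ (e.spin (-1)).height z < 0}
  | ⟨.ApR, e⟩ => {z | ‖z‖ ≤ 1 ∧ 0 < e.height z ∧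
      (e.spin 1).height z < 0 ∧ e.right.right.height z < 0}
  | ⟨.AppL, e⟩ => {z | ‖z‖ ≤ 1 ∧ 0 < e.height z ∧
      e.left.height z < 0 ∧ (e.spin (-1)).height z < 0}
  | ⟨.AppR, e⟩ => {z | ‖z‖ ≤ 1 ∧ 0 < e.height z ∧
      (e.spin 1).height z < 0 ∧ e.right.height z < 0}
  | ⟨.B, e⟩ => wedge e
  | ⟨.C, e⟩ => wedge e
  | ⟨.Cp, e⟩ => wedge e
  | ⟨.D, e⟩ => {z | ‖z‖ ≤ 1 ∧ 0 < e.height z ∧ 0 < (e.spin (-1)).height z} \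
      (wedge (e.right.right.right.spin 1) ∪ wedge (e.spin (-1)).left.left.left)
  | ⟨.EL, e⟩ => wedge e
  | ⟨.ER, e⟩ => wedge e

/-- The steps that may follow a given step: their edges start where the edges of the given step
end, and their regions are the pieces into which the region of the given step is cut by the
geodesics extending the sides of the octagon just entered (the octagon itself is left out).
`e.next 1, …, e.next 7` are the edges that continue `e`, from right to left, and a step `B` with
base `e.next j` points to the corner between `e.next (j - 1)` and `e.next j`. -/
def successors : Step → List Step
  | ⟨.A, e⟩ =>
      [⟨.ApR, e.next 1⟩, ⟨.A, e.next 2⟩, ⟨.A, e.next 3⟩, ⟨.A, e.next 4⟩, ⟨.A, e.next 5⟩,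
       ⟨.A, e.next 6⟩, ⟨.ApL, e.next 7⟩,
       ⟨.B, e.next 2⟩, ⟨.B, e.next 3⟩, ⟨.B, e.next 4⟩, ⟨.B, e.next 5⟩, ⟨.B, e.next 6⟩,
       ⟨.B, e.next 7⟩]
  | ⟨.ApL, e⟩ =>
      [⟨.ApR, e.next 1⟩, ⟨.A, e.next 2⟩, ⟨.A, e.next 3⟩, ⟨.A, e.next 4⟩, ⟨.A, e.next 5⟩,
       ⟨.A, e.next 6⟩, ⟨.AppL, e.next 7⟩,
       ⟨.B, e.next 2⟩, ⟨.B, e.next 3⟩, ⟨.B, e.next 4⟩, ⟨.B, e.next 5⟩, ⟨.B, e.next 6⟩,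
       ⟨.B, e.next 7⟩]
  | ⟨.ApR, e⟩ =>
      [⟨.AppR, e.next 1⟩, ⟨.A, e.next 2⟩, ⟨.A, e.next 3⟩, ⟨.A, e.next 4⟩, ⟨.A, e.next 5⟩,
       ⟨.A, e.next 6⟩, ⟨.ApL, e.next 7⟩,
       ⟨.B, e.next 2⟩, ⟨.B, e.next 3⟩, ⟨.B, e.next 4⟩, ⟨.B, e.next 5⟩, ⟨.B, e.next 6⟩,
       ⟨.B, e.next 7⟩]
  | ⟨.AppL, e⟩ =>
      [⟨.ApR, e.next 1⟩, ⟨.A, e.next 2⟩, ⟨.A, e.next 3⟩, ⟨.A, e.next 4⟩, ⟨.A, e.next 5⟩,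
       ⟨.A, e.next 6⟩,
       ⟨.B, e.next 2⟩, ⟨.B, e.next 3⟩, ⟨.B, e.next 4⟩, ⟨.B, e.next 5⟩, ⟨.B, e.next 6⟩]
  | ⟨.AppR, e⟩ =>
      [⟨.A, e.next 2⟩, ⟨.A, e.next 3⟩, ⟨.A, e.next 4⟩, ⟨.A, e.next 5⟩,
       ⟨.A, e.next 6⟩, ⟨.ApL, e.next 7⟩,
       ⟨.B, e.next 3⟩, ⟨.B, e.next 4⟩, ⟨.B, e.next 5⟩, ⟨.B, e.next 6⟩, ⟨.B, e.next 7⟩]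
  | ⟨.B, e⟩ => [⟨.C, e⟩]
  | ⟨.C, e⟩ => [⟨.Cp, e⟩]
  | ⟨.Cp, e⟩ =>
      [⟨.D, e⟩, ⟨.EL, e.right.right.right.spin 1⟩, ⟨.ER, (e.spin (-1)).left.left.left⟩]
  | ⟨.D, e⟩ =>
      let l := e.right.right.right
      [⟨.ApR, l.next 2⟩, ⟨.A, l.next 3⟩, ⟨.A, l.next 4⟩, ⟨.A, l.next 5⟩, ⟨.A, l.next 6⟩,
       ⟨.ApL, l.next 7⟩,
       ⟨.B, l.next 3⟩, ⟨.B, l.next 4⟩, ⟨.B, l.next 5⟩, ⟨.B, l.next 6⟩, ⟨.B, l.next 7⟩]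
  | ⟨.EL, e⟩ => [⟨.C, e⟩]
  | ⟨.ER, e⟩ => [⟨.C, e⟩]

/-- The union of the edges of a step, as geodesic segments in the disc. -/
def support (s : Step) : Set ℂ := ⋃ e ∈ s.edges, segment ℝ (source e) (target e)

end Step

/-! ### The Markov chain and Infinite Snakes -/

/-- The `88` Markov states: a kind, with the label of the left-most edge of the step. (The kind and
this label determine the labels of the other edges of the step.) -/
structure State where
  kind : Kind
  label : Letter

/-- The step `s` is an image of the state `J` in the universal cover. -/
def IsImage (J : State) (s : Step) : Prop :=
  s.kind = J.kind ∧ ∃ g ∈ deckGroup, s.edges.head? = some (edgeAt g J.label)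

/-- The transition matrix: `J` can be followed by `K` if images of `J` and `K` can be chosen such
that the second one is a successor of the first one. -/
def Transition (J K : State) : Prop :=
  ∃ s t : Step, IsImage J s ∧ IsImage K t ∧ t ∈ s.successors

/-- The elements of the Markov chain. -/
def IsChain (J : ℤ → State) : Prop := ∀ i, Transition (J i) (J (i + 1))

/-- An Infinite Snake is an image in the universal cover of an element of the Markov chain. -/
def IsInfiniteSnake (S : ℤ → Step) : Prop :=
  ∃ J : ℤ → State, IsChain J ∧ (∀ i, IsImage (J i) (S i)) ∧ ∀ i, S (i + 1) ∈ (S i).successors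

/-- `T` is the inverse of `S`: the same edges, traversed in the opposite direction. -/
def IsInverse (T S : ℤ → Step) : Prop :=
  ∀ i, ∀ e : Edge, e ∈ (T i).edges ↔ ∃ e' ∈ (S (-i)).edges, e = Edge.rev e'

/-- The boundary point `f` is the forward limit point of `S`. -/
def IsForwardLimit (S : ℤ → Step) (f : Circle) : Prop :=
  ∀ U ∈ 𝓝 (f : ℂ), ∀ᶠ i in atTop, (S i).support ⊆ U

/-- The boundary point `b` is the backward limit point of `S`. -/
def IsBackwardLimit (S : ℤ → Step) (b : Circle) : Prop :=
  ∀ U ∈ 𝓝 (b : ℂ), ∀ᶠ i in atBot, (S i).support ⊆ U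

/-- The limit points of `S`. -/
def IsLimitPoint (S : ℤ → Step) (p : Circle) : Prop :=
  IsForwardLimit S p ∨ IsBackwardLimit S p

/-- A Proper Infinite Snake is an Infinite Snake such that all of its regions contain one of its
limit points and the regions of its inverse all contain the other limit point. -/
def IsProperInfiniteSnake (S : ℤ → Step) : Prop :=
  IsInfiniteSnake S ∧
    ∃ p q : Circle, p ≠ q ∧ IsLimitPoint S p ∧ IsLimitPoint S q ∧
      (∀ i, (p : ℂ) ∈ (S i).region) ∧
      ∃ T : ℤ → Step, IsInfiniteSnake T ∧ IsInverse T S ∧ ∀ i, (q : ℂ) ∈ (T i).region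

end Snakes

end

open Filter Topology

noncomputable section

namespace Snakes

/-! The two snakes are compared along geodesics of the net. For a proper snake the regions contain
`f` and those of the inverse contain `b` (`IsProperInfiniteSnake.exists_isDuo`), so every edge
crosses its geodesic from the closed side of `b` to that of `f`. Conversely, a snake crosses every
net geodesic that strictly separates `b` from `f`, and an edge can only cross the geodesic of its
own side (`IsNetFrame.mulVec_normal_eq`). On such a geodesic both snakes therefore have an edge, and
the two edges differ by a translation by an integral number of sides (`IsNetFrame.exists_shift`).

This integer has to vanish. A single edge yields sign conditions on `f` and `b` at both ends of the
crossed side (`Crossing`); a passage around a corner puts `f` and `b` into opposite wedges (`Full`).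
Positions far apart on one geodesic contradict each other because half planes beyond non-adjacent
sides of an octagon are disjoint, even at infinity (`IsNetFrame.not_far`). Close positions are
separated by the wedges removed in `A'` and `A''` (`Crossing.eq_zero_of_shift`,
`Crossing.false_of_full`). Adjacent wedges at one vertex could both carry a corner passage only if
`f` and `b` lay on one net geodesic, which is excluded (`Full.eq_of_shift`). So the snakes share a
step, up to the number of removed wedges (`IsDuo.exists_sim`).

The agreement spreads. Forward, the regions of the possible successors have no common point at
infinity, so `f` selects the next step (`Sim.succ`). Backward, the same argument for the inverse
snakes gives the edges, and edges determine the predecessor (`Sim.pred`). Finally the two preceding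
steps determine the number of removed wedges (`Sim.eq_of_pred`).

The tessellation enters through two facts only: an edge crosses no net geodesic but its own, and
translations along a net geodesic that preserve the lattice have multiples of the side length. Both
are arithmetic. Normal vectors have coordinates governed by `ℚ(√2)`, and the conjugate of the
Lorentz form under `√2 ↦ -√2` is definite; this bounds the conjugate coordinates and leaves finitely
many candidates. -/

/-! ### Explicit matrices: turns about a vertex and translations along a side. -/

theorem sqrt_two_mul_self : (√2 : ℝ) * √2 = 2 := Real.mul_self_sqrt (by norm_num)

theorem sR_mul_self : sR * sR = 2 + 2 * √2 := by
  have := Real.mul_self_sqrt (show (0 : ℝ) ≤ 2 + 2 * √2 by positivity)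
  exact this

theorem sR_pos : 0 < sR := Real.sqrt_pos.2 (by positivity)

theorem rot_one : rot 1 = !![√2 / 2, -(√2 / 2), 0; √2 / 2, √2 / 2, 0; 0, 0, 1] := by
  simp [rot]

theorem rot_eight : rot 8 = 1 := by
  have h : ((8 : ℤ) : ℝ) * (Real.pi / 4) = 2 * Real.pi := by push_cast; ring
  ext i j
  fin_cases i <;> fin_cases j <;> simp only [rot, h] <;> simp

theorem rot_add_eight (k : ℤ) : rot (k + 8) = rot k := by
  rw [← rot_mul, rot_eight, mul_one]

theorem rot_eight_mul (k : ℤ) : rot (8 * k) = 1 := by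
  induction k using Int.induction_on with
  | zero => simp [rot_zero]
  | succ n ih => rw [show (8 * ((n : ℤ) + 1)) = 8 * n + 8 by ring, rot_add_eight, ih]
  | pred n ih =>
    rw [← rot_add_eight, show (8 * (-(n : ℤ) - 1) + 8) = 8 * (-n) by ring, ih]

theorem rot_emod (k : ℤ) : rot (k % 8) = rot k := by
  conv_rhs => rw [← Int.emod_add_mul_ediv k 8, ← rot_mul, rot_eight_mul, mul_one]

theorem rot_neg_one : rot (-1) = !![√2 / 2, √2 / 2, 0; -(√2 / 2), √2 / 2, 0; 0, 0, 1] := by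
  simp [rot]

theorem halfTurn_eq : halfTurn = !![-5 - 4 * √2, 0, 2 * sR * (1 + √2); 0, -1, 0;
    -(2 * sR * (1 + √2)), 0, 5 + 4 * √2] := by
  have h2 := sqrt_two_mul_self
  have hr := sR_mul_self
  ext i j
  fin_cases i <;> fin_cases j <;> simp [halfTurn, cR] <;> grind

/-- Right-most turns: `e.right = e * ringTurn`. -/
def ringTurn : Matrix (Fin 3) (Fin 3) ℝ := halfTurn * rot 1

theorem ringTurn_eq : ringTurn =
    !![-4 - 5 / 2 * √2, 4 + 5 / 2 * √2, 2 * sR + 2 * √2 * sR; -(√2 / 2), -(√2 / 2), 0;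
      -2 * sR - √2 * sR, 2 * sR + √2 * sR, 5 + 4 * √2] := by
  have h2 := sqrt_two_mul_self
  rw [ringTurn, halfTurn_eq, rot_one]
  ext i j
  fin_cases i <;> fin_cases j <;> simp [Matrix.mul_apply, Fin.sum_univ_three] <;> grind

theorem ringTurn_sq : ringTurn ^ 2 =
    !![-14 - 10 * √2, 9 + 6 * √2, 8 * sR + 5 * √2 * sR;
      3 + 2 * √2, -2 - 2 * √2, -2 * sR - √2 * sR;
      -6 * sR - 5 * √2 * sR, 4 * sR + 3 * √2 * sR, 17 + 12 * √2] := by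
  have h2 := sqrt_two_mul_self
  have hr := sR_mul_self
  rw [sq, ringTurn_eq]
  ext i j
  fin_cases i <;> fin_cases j <;> simp [Matrix.mul_apply, Fin.sum_univ_three] <;> grind

theorem ringTurn_pow_four : ringTurn ^ 4 =
    !![-29 - 20 * √2, 12 + 8 * √2, 14 * sR + 10 * √2 * sR;
      12 + 8 * √2, -5 - 4 * √2, -6 * sR - 4 * √2 * sR;
      -14 * sR - 10 * √2 * sR, 6 * sR + 4 * √2 * sR, 33 + 24 * √2] := by
  have h2 := sqrt_two_mul_self
  have hr := sR_mul_self
  have h : ringTurn ^ 4 = ringTurn ^ 2 * ringTurn ^ 2 := by rw [← pow_add]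
  rw [h, ringTurn_sq]
  ext i j
  fin_cases i <;> fin_cases j <;> simp [Matrix.mul_apply, Fin.sum_univ_three] <;> grind

/-- Eight octagons meet at each vertex of the net: `ringTurn` is a rotation by `π / 4` about the
right end of side `0`. -/
theorem ringTurn_pow_eight : ringTurn ^ 8 = 1 := by
  have h2 := sqrt_two_mul_self
  have hr := sR_mul_self
  rw [show (8 : ℕ) = 4 + 4 from rfl, pow_add, ringTurn_pow_four]
  ext i j
  fin_cases i <;> fin_cases j <;> simp [Matrix.mul_apply, Fin.sum_univ_three] <;> grind

/-- The translation along the geodesic through side `0` of the octagon by hyperbolic distance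
`t`. -/
def boost (t : ℝ) : Matrix (Fin 3) (Fin 3) ℝ :=
  !![cR ^ 2 - sR ^ 2 * Real.cosh t, sR * Real.sinh t, -(cR * sR) + sR * cR * Real.cosh t;
     -(sR * Real.sinh t), Real.cosh t, cR * Real.sinh t;
     sR * cR - cR * sR * Real.cosh t, cR * Real.sinh t, -sR ^ 2 + cR ^ 2 * Real.cosh t]

theorem boost_zero : boost 0 = 1 := by
  have h := sR_sq
  ext i j
  fin_cases i <;> fin_cases j <;> simp [boost] <;> linarith

theorem boost_mul (s t : ℝ) : boost s * boost t = boost (s + t) := by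
  have h := sR_sq
  ext i j
  fin_cases i <;> fin_cases j <;>
    simp [boost, Matrix.mul_apply, Fin.sum_univ_three, Real.cosh_add, Real.sinh_add] <;> grind

/-- A half turn about a point of the axis reverses translations along it. -/
theorem halfTurn_mul_boost (t : ℝ) : halfTurn * boost t = boost (-t) * halfTurn := by
  have h := sR_sq
  ext i j
  fin_cases i <;> fin_cases j <;>
    simp [boost, halfTurn, Matrix.mul_apply, Fin.sum_univ_three] <;> grind

/-- The length of a side of the octagon. -/
def sideLen : ℝ := 2 * Real.arsinh sR

/-- Centre, vertex and midpoint of a side form a right triangle with two angles `π / 8`, so half a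
side is as long as the inradius. -/
theorem cosh_arsinh_sR : Real.cosh (Real.arsinh sR) = cR := by
  rw [Real.cosh_arsinh, sR_sq]
  rw [show 1 + (cR ^ 2 - 1) = cR ^ 2 by ring]
  exact Real.sqrt_sq (by unfold cR; positivity)

theorem sideLen_pos : 0 < sideLen := by
  have := Real.arsinh_pos_iff.2 sR_pos
  unfold sideLen; linarith

/-- The product of the half turns about a vertex and about the midpoint of a side at it, half a side
apart, is a translation by a full side. -/
theorem boost_neg_sideLen : ringTurn ^ 4 * halfTurn = boost (-sideLen) := by
  have h2 := sqrt_two_mul_self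
  have hr := sR_mul_self
  have hc : Real.cosh sideLen = 5 + 4 * √2 := by
    rw [sideLen, Real.cosh_two_mul, cosh_arsinh_sR, Real.sinh_arsinh, cR]; grind
  have hs : Real.sinh sideLen = 2 * sR * (1 + √2) := by
    rw [sideLen, Real.sinh_two_mul, cosh_arsinh_sR, Real.sinh_arsinh, cR]
  rw [ringTurn_pow_four, halfTurn_eq]
  ext i j
  fin_cases i <;> fin_cases j <;>
    simp [boost, Matrix.mul_apply, Fin.sum_univ_three, hc, hs, cR] <;> grind

/-! ### The lattice of normal vectors -/

/-- The normal vector of side `0` of the octagon. -/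
def normal : Vec := ![cR, 0, sR]

/-- An arithmetic condition satisfied by the normal vectors of all geodesics of the net, in terms of
integral coordinates. -/
structure IsNormalCoords (v : Vec) (a b c d p q : ℤ) : Prop where
  zero : v 0 = (1 + √2) * (b + a * (√2 / 2))
  one : v 1 = (1 + √2) * (d + c * (√2 / 2))
  two : v 2 = sR * (p + q * √2)
  odd : p % 2 = 1
  parity : (a - c) % 2 = 0
  rat : 2 * b ^ 2 + 2 * d ^ 2 + a ^ 2 + c ^ 2 = 6 - 4 * p ^ 2 - 8 * q ^ 2 + 16 * p * q
  irr : a * b + c * d = -2 + 2 * p ^ 2 + 4 * q ^ 2 - 4 * p * q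

/-- The vectors satisfying the arithmetic condition. -/
def NormalLattice : Set Vec := {v | ∃ a b c d p q : ℤ, IsNormalCoords v a b c d p q}

theorem normal_mem : normal ∈ NormalLattice :=
  ⟨0, 1, 0, 0, 1, 0, by constructor <;> simp [normal, cR]⟩

theorem rot_one_mulVec_mem {v : Vec} (hv : v ∈ NormalLattice) :
    (rot 1).mulVec v ∈ NormalLattice := by
  obtain ⟨a, b, c, d, p, q, h⟩ := hv
  have h2 := sqrt_two_mul_self
  -- A rotation by `π / 4` halves `a - c`; the parity condition keeps the new coordinates integral.
  obtain ⟨m, hm⟩ : ∃ m, a = c + 2 * m := ⟨(a - c) / 2, by have := h.parity; omega⟩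
  refine ⟨b - d, m, b + d, c + m, p, q, ?_, ?_, ?_, h.odd, by omega, ?_, ?_⟩
  · simp [rot_one, Matrix.mulVec, dotProduct, Fin.sum_univ_three, h.zero, h.one, hm]; grind
  · simp [rot_one, Matrix.mulVec, dotProduct, Fin.sum_univ_three, h.zero, h.one, hm]; grind
  · simp [rot_one, Matrix.mulVec, dotProduct, Fin.sum_univ_three, h.two]
  · rw [← h.rat, hm]; ring
  · rw [← h.irr, hm]; ring

theorem halfTurn_mulVec_mem {v : Vec} (hv : v ∈ NormalLattice) :
    halfTurn.mulVec v ∈ NormalLattice := by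
  obtain ⟨a, b, c, d, p, q, h⟩ := hv
  have h2 := sqrt_two_mul_self
  have hr := sR_mul_self
  have ho := h.odd
  have hp := h.parity
  have e1 := h.rat
  have e2 := h.irr
  refine ⟨-5 * a - 8 * b + 8 * (p + q), -5 * b - 4 * a + 4 * p + 8 * q, -c, -d,
    5 * p + 8 * q - 6 * b - 4 * a, 4 * p + 5 * q - 4 * b - 3 * a, ?_, ?_, ?_, by omega,
    by omega, ?_, ?_⟩
  · simp [halfTurn_eq, Matrix.mulVec, dotProduct, Fin.sum_univ_three, h.zero, h.two]; grind
  · simp [halfTurn_eq, Matrix.mulVec, dotProduct, Fin.sum_univ_three, h.one]; grind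
  · simp [halfTurn_eq, Matrix.mulVec, dotProduct, Fin.sum_univ_three, h.zero, h.two]; grind
  · grind
  · grind

theorem rot_mulVec_mem (k : ℤ) {v : Vec} (hv : v ∈ NormalLattice) :
    (rot k).mulVec v ∈ NormalLattice := by
  have key : ∀ n : ℕ, (rot n).mulVec v ∈ NormalLattice := by
    intro n
    induction n with
    | zero => simpa [rot_zero] using hv
    | succ n ih =>
      have := rot_one_mulVec_mem ih
      rwa [Matrix.mulVec_mulVec, rot_mul, add_comm] at this
  rw [← rot_emod]
  have := key (k % 8).toNat
  rwa [Int.toNat_of_nonneg (by omega)] at this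

/-! ### Isometries preserving the lattice -/

theorem lor_comm (u v : Vec) : lor u v = lor v u := by unfold lor; ring
theorem lor_add_left (u v w : Vec) : lor (u + v) w = lor u w + lor v w := by
  simp only [lor, Pi.add_apply]; ring
theorem lor_smul_left (c : ℝ) (u w : Vec) : lor (c • u) w = c * lor u w := by
  simp only [lor, Pi.smul_apply, smul_eq_mul]; ring

/-- Nonzero vectors of the closed future cone. -/
def Future (v : Vec) : Prop := 0 < v 2 ∧ v 0 ^ 2 + v 1 ^ 2 ≤ v 2 ^ 2

/-- The orientation preserving isometries that preserve the lattice. -/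
structure IsGood (M : Matrix (Fin 3) (Fin 3) ℝ) : Prop where
  lattice : ∀ v ∈ NormalLattice, M.mulVec v ∈ NormalLattice
  lor_eq : ∀ u v, lor (M.mulVec u) (M.mulVec v) = lor u v
  future : ∀ v, Future v → Future (M.mulVec v)
  det_eq : M.det = 1

theorem isGood_one : IsGood 1 := ⟨by simp, by simp, by simp, by simp⟩

theorem IsGood.mul {M N : Matrix (Fin 3) (Fin 3) ℝ} (hM : IsGood M) (hN : IsGood N) :
    IsGood (M * N) where
  lattice v hv := by rw [← Matrix.mulVec_mulVec]; exact hM.lattice _ (hN.lattice _ hv)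
  lor_eq u v := by rw [← Matrix.mulVec_mulVec, ← Matrix.mulVec_mulVec, hM.lor_eq, hN.lor_eq]
  future v hv := by rw [← Matrix.mulVec_mulVec]; exact hM.future _ (hN.future _ hv)
  det_eq := by rw [Matrix.det_mul, hM.det_eq, hN.det_eq, one_mul]

theorem lor_self_nonpos_iff (v : Vec) : v 0 ^ 2 + v 1 ^ 2 ≤ v 2 ^ 2 ↔ lor v v ≤ 0 := by
  unfold lor; constructor <;> intro h <;> nlinarith

theorem isGood_rot (k : ℤ) : IsGood (rot k) := by
  have hcs := Real.sin_sq_add_cos_sq (k * (Real.pi / 4))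
  have hl : ∀ u v, lor ((rot k).mulVec u) ((rot k).mulVec v) = lor u v := by
    intro u v
    simp only [lor, rot, Matrix.mulVec, dotProduct, Fin.sum_univ_three]
    simp
    linear_combination (u 0 * v 0 + u 1 * v 1) * hcs
  refine ⟨fun v hv => rot_mulVec_mem k hv, hl, ?_, ?_⟩
  · rintro v ⟨h1, h2⟩
    refine ⟨?_, ?_⟩
    · simpa [rot, Matrix.mulVec, dotProduct, Fin.sum_univ_three] using h1
    · rw [lor_self_nonpos_iff, hl, ← lor_self_nonpos_iff]; exact h2
  · simp [rot, Matrix.det_fin_three]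
    linear_combination hcs

theorem abs_le_of_future {v : Vec} (h : Future v) : |v 0| ≤ v 2 :=
  abs_le_of_sq_le_sq (by have := h.2; nlinarith [sq_nonneg (v 1)]) h.1.le

theorem isGood_halfTurn : IsGood halfTurn := by
  have h := sR_sq
  have hl : ∀ u v, lor (halfTurn.mulVec u) (halfTurn.mulVec v) = lor u v := by
    intro u v
    simp only [lor, halfTurn, Matrix.mulVec, dotProduct, Fin.sum_univ_three]
    simp
    grind
  refine ⟨fun v hv => halfTurn_mulVec_mem hv, hl, ?_, ?_⟩
  · rintro v hv
    refine ⟨?_, ?_⟩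
    · have h0 := abs_le.1 (abs_le_of_future hv)
      simp [halfTurn, Matrix.mulVec, dotProduct, Fin.sum_univ_three]
      have hs := sR_pos
      have hc : 0 < cR := by unfold cR; positivity
      -- This gives `2 * sR * cR < cR ^ 2 + sR ^ 2 = 2 * cR ^ 2 - 1`, so in the last row of
      -- `halfTurn` the coefficient of `v 2` dominates that of `v 0`.
      have hne : 0 < (cR - sR) ^ 2 := by
        refine sq_pos_of_ne_zero fun h' => ?_
        have : sR = cR := by linarith
        rw [this] at h
        linarith
      nlinarith [mul_pos hne hv.1, mul_nonneg (mul_pos hs hc).le (sub_nonneg.2 h0.2)]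
    · rw [lor_self_nonpos_iff, hl, ← lor_self_nonpos_iff]; exact hv.2
  · simp [halfTurn, Matrix.det_fin_three]
    grind

theorem isGood_pairing (x : Letter) : IsGood (pairing x) :=
  ((isGood_rot _).mul isGood_halfTurn).mul (isGood_rot _)

theorem isGood_of_mem_deckGroup {g : (Matrix (Fin 3) (Fin 3) ℝ)ˣ} (hg : g ∈ deckGroup) :
    IsGood g ∧ IsGood (g⁻¹ : (Matrix (Fin 3) (Fin 3) ℝ)ˣ) := by
  induction hg using Subgroup.closure_induction with
  | mem x hx =>
    obtain ⟨y, rfl⟩ := hx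
    exact ⟨isGood_pairing y, isGood_pairing y.inv⟩
  | one => simpa using isGood_one
  | mul x y _ _ hx hy =>
    refine ⟨by simpa using hx.1.mul hy.1, by simpa using hy.2.mul hx.2⟩
  | inv x _ hx => exact ⟨hx.2, by simpa using hx.1⟩

/-! ### Frames of edges of the net. -/

/-- The frames of the directed edges of the Cayley graph. -/
def IsNetFrame (e : Edge) : Prop :=
  ∃ g ∈ deckGroup, ∃ k : ℤ, e = (g : Matrix (Fin 3) (Fin 3) ℝ) * rot k

theorem isNetFrame_edgeAt {g : (Matrix (Fin 3) (Fin 3) ℝ)ˣ} (hg : g ∈ deckGroup) (x : Letter) :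
    IsNetFrame (edgeAt g x) := ⟨g, hg, x.pos, rfl⟩

theorem exists_pos_eq (k : ℤ) : ∃ x : Letter, x.pos = k % 8 := by
  have h1 : 0 ≤ k % 8 := by omega
  have h2 : k % 8 < 8 := by omega
  generalize k % 8 = m at *
  interval_cases m
  exacts [⟨.b, rfl⟩, ⟨.A, rfl⟩, ⟨.B, rfl⟩, ⟨.a, rfl⟩, ⟨.d, rfl⟩, ⟨.C, rfl⟩, ⟨.D, rfl⟩, ⟨.c, rfl⟩]

theorem IsNetFrame.exists_edgeAt {e : Edge} (he : IsNetFrame e) :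
    ∃ g ∈ deckGroup, ∃ x, e = edgeAt g x := by
  obtain ⟨g, hg, k, rfl⟩ := he
  obtain ⟨x, hx⟩ := exists_pos_eq k
  exact ⟨g, hg, x, by rw [edgeAt, hx, rot_emod]⟩

theorem IsNetFrame.mul_rot {e : Edge} (he : IsNetFrame e) (k : ℤ) : IsNetFrame (e * rot k) := by
  obtain ⟨g, hg, l, rfl⟩ := he
  exact ⟨g, hg, l + k, by rw [mul_assoc, rot_mul]⟩

/-- The reverse of the edge labelled `x` at `g F` is the edge labelled `x.inv` at the neighbour `g *
pairing x`. -/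
theorem IsNetFrame.mul_halfTurn {e : Edge} (he : IsNetFrame e) : IsNetFrame (e * halfTurn) := by
  obtain ⟨g, hg, x, rfl⟩ := he.exists_edgeAt
  refine ⟨g * pairingUnit x, mul_mem hg (Subgroup.subset_closure ⟨x, rfl⟩), x.inv.pos, ?_⟩
  simp only [edgeAt, pairingUnit, Units.val_mul, pairing, mul_assoc, rot_mul]
  simp [rot_zero]

theorem IsNetFrame.exists_inv {e : Edge} (he : IsNetFrame e) :
    IsGood e ∧ ∃ e' : Edge, IsGood e' ∧ e * e' = 1 ∧ e' * e = 1 := by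
  obtain ⟨g, hg, k, rfl⟩ := he
  obtain ⟨h1, h2⟩ := isGood_of_mem_deckGroup hg
  refine ⟨h1.mul (isGood_rot k), rot (-k) * (g⁻¹ : (Matrix (Fin 3) (Fin 3) ℝ)ˣ),
    (isGood_rot _).mul h2, ?_, ?_⟩
  · rw [mul_assoc, ← mul_assoc (rot k), rot_mul]; simp [rot_zero]
  · rw [mul_assoc, ← mul_assoc (Units.val g⁻¹)]; simp [rot_mul, rot_zero]

theorem IsNetFrame.isGood {e : Edge} (he : IsNetFrame e) : IsGood e := he.exists_inv.1

theorem IsNetFrame.mul_left_cancel {e : Edge} (he : IsNetFrame e) {M N : Edge}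
    (h : e * M = e * N) : M = N := by
  obtain ⟨-, e', -, -, h'⟩ := he.exists_inv
  calc M = e' * e * M := by rw [h', one_mul]
    _ = e' * e * N := by rw [mul_assoc, h, ← mul_assoc]
    _ = N := by rw [h', one_mul]

/-! ### Arithmetic of `ℤ[√2]`: an edge crosses only its own geodesic. -/

theorem sqrt_two_gt : (1.414 : ℝ) < √2 := Real.lt_sqrt_of_sq_lt (by norm_num)
theorem sqrt_two_lt : √2 < (1.415 : ℝ) := (Real.sqrt_lt' (by norm_num)).2 (by norm_num)

theorem eq_zero_of_add_mul_sqrt_two {m n : ℤ} (h : (m : ℝ) + n * √2 = 0) : m = 0 ∧ n = 0 := by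
  have hn : n = 0 := by
    by_contra hn
    have h' : (n : ℝ) ≠ 0 := by exact_mod_cast hn
    refine irrational_sqrt_two ⟨-m / n, ?_⟩
    push_cast
    rw [div_eq_iff h']
    linarith
  subst hn
  simpa using h

/-- `rat` and `irr` are the two components over `ℚ(√2)` of `lor v v = 1`. Conjugation makes the form
definite, so `(p - q√2) ^ 2` is at most `(3 + 2√2) / (2 + 2√2)`, which is below `1.1 ^ 2`. -/
theorem IsNormalCoords.conj_sq_lt {v : Vec} {a b c d p q : ℤ} (h : IsNormalCoords v a b c d p q) :
    (p - q * √2 : ℝ) ^ 2 < 1.21 := by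
  have h2 := sqrt_two_mul_self
  have e1 : (2 * b ^ 2 + 2 * d ^ 2 + a ^ 2 + c ^ 2 : ℝ) =
    6 - 4 * p ^ 2 - 8 * q ^ 2 + 16 * p * q := by exact_mod_cast h.rat
  have e2 : (a * b + c * d : ℝ) = -2 + 2 * p ^ 2 + 4 * q ^ 2 - 4 * p * q := by
    exact_mod_cast h.irr
  have key : (2 + 2 * √2) * (p - q * √2 : ℝ) ^ 2 ≤ 3 + 2 * √2 := by
    have e3 : 3 + 2 * √2 - (2 + 2 * √2) * (p - q * √2 : ℝ) ^ 2 =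
        (b - a * (√2 / 2)) ^ 2 + (d - c * (√2 / 2)) ^ 2 := by grind
    nlinarith [sq_nonneg (b - a * (√2 / 2) : ℝ), sq_nonneg (d - c * (√2 / 2) : ℝ)]
  have := sqrt_two_gt
  have := sqrt_two_lt
  nlinarith [sq_nonneg (p - q * √2 : ℝ)]

/-- Sum and difference of `p + q√2` and its conjugate isolate `p` and `q`. -/
theorem IsNormalCoords.bounds {v : Vec} {a b c d p q : ℤ} (h : IsNormalCoords v a b c d p q)
    {l u : ℝ} (hl : l ≤ p + q * √2) (hu : p + q * √2 ≤ u) :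
    l - 1.1 < 2 * p ∧ 2 * p < u + 1.1 ∧ l - 1.1 < 2 * √2 * q ∧ 2 * √2 * q < u + 1.1 := by
  have h' := abs_lt_of_sq_lt_sq (show (p - q * √2 : ℝ) ^ 2 < 1.1 ^ 2 by
    have := h.conj_sq_lt; norm_num at this ⊢; exact this) (by norm_num)
  rw [abs_lt] at h'
  refine ⟨?_, ?_, ?_, ?_⟩ <;> nlinarith

theorem conj_cases {p q : ℤ} (hp : p = 1 ∨ p = 3) (hq : 0 ≤ q) (hq' : q ≤ 3)
    (h : (p - q * √2 : ℝ) ^ 2 < 1.21) : (p = 1 ∧ (q = 0 ∨ q = 1)) ∨ (p = 3 ∧ q = 2) := by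
  have h2 := sqrt_two_mul_self
  have g1 := sqrt_two_gt
  have g2 := sqrt_two_lt
  have e : (p - q * √2 : ℝ) ^ 2 = p ^ 2 + 2 * q ^ 2 - 2 * p * q * √2 := by grind
  rw [e] at h
  obtain rfl | rfl := hp <;> interval_cases q <;>
    first
    | (norm_num; done)
    | (exfalso; norm_num at h; done)
    | (exfalso; norm_num at h; linarith)

theorem normalCoords_cases_one {a b c d : ℤ} (h : 2 * b ^ 2 + 2 * d ^ 2 + a ^ 2 + c ^ 2 = 2)
    (h' : a * b + c * d = 0) : (a = 0 ∧ b = 1 ∧ c = 0 ∧ d = 0) ∨ (a ≤ 1 ∧ b ≤ 0) := by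
  have hs : ∀ n : ℤ, n ^ 2 ≤ 2 → n ∈ Finset.Icc (-1 : ℤ) 1 := fun n hn =>
    Finset.mem_Icc.2 ⟨by nlinarith, by nlinarith⟩
  have key : ∀ a ∈ Finset.Icc (-1 : ℤ) 1, ∀ b ∈ Finset.Icc (-1 : ℤ) 1,
      ∀ c ∈ Finset.Icc (-1 : ℤ) 1, ∀ d ∈ Finset.Icc (-1 : ℤ) 1,
      2 * b ^ 2 + 2 * d ^ 2 + a ^ 2 + c ^ 2 = 2 → a * b + c * d = 0 →
      (a = 0 ∧ b = 1 ∧ c = 0 ∧ d = 0) ∨ (a ≤ 1 ∧ b ≤ 0) := by decide +kernel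
  have := sq_nonneg a
  have := sq_nonneg b
  have := sq_nonneg c
  have := sq_nonneg d
  exact key a (hs a (by linarith)) b (hs b (by linarith)) c (hs c (by linarith)) d
    (hs d (by linarith)) h h'

theorem normalCoords_cases_two {a b c d : ℤ} (h : 2 * b ^ 2 + 2 * d ^ 2 + a ^ 2 + c ^ 2 = 10)
    (h' : a * b + c * d = 0) : (a = 0 ∧ b ≤ 2) ∨ (b = 0 ∧ a ≤ 3) := by
  have hs : ∀ n : ℤ, n ^ 2 ≤ 10 → n ∈ Finset.Icc (-3 : ℤ) 3 := fun n hn =>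
    Finset.mem_Icc.2 ⟨by nlinarith, by nlinarith⟩
  have key : ∀ a ∈ Finset.Icc (-3 : ℤ) 3, ∀ b ∈ Finset.Icc (-3 : ℤ) 3,
      ∀ c ∈ Finset.Icc (-3 : ℤ) 3, ∀ d ∈ Finset.Icc (-3 : ℤ) 3,
      2 * b ^ 2 + 2 * d ^ 2 + a ^ 2 + c ^ 2 = 10 → a * b + c * d = 0 →
      (a = 0 ∧ b ≤ 2) ∨ (b = 0 ∧ a ≤ 3) := by decide +kernel
  have := sq_nonneg a
  have := sq_nonneg b
  have := sq_nonneg c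
  have := sq_nonneg d
  exact key a (hs a (by linarith)) b (hs b (by linarith)) c (hs c (by linarith)) d
    (hs d (by linarith)) h h'

/-- Geometrically: the segment from the centre of `F` to the centre of its neighbour across side `0`
passes through no net geodesic except that of side `0`. The hypotheses force the first coordinate of
`v` to be large compared with the last, which bounds the last coordinate and leaves a finite check.
-/
theorem eq_normal_of_lor {v : Vec} (hv : v ∈ NormalLattice) (h0 : lor v ![0, 0, 1] ≤ 0)
    (h1 : 0 < lor v (halfTurn.mulVec ![0, 0, 1])) : v = normal := by
  obtain ⟨a, b, c, d, p, q, h⟩ := hv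
  have h2 := sqrt_two_mul_self
  have g1 := sqrt_two_gt
  have g2 := sqrt_two_lt
  have hs := sR_pos
  have e1 : (2 * b ^ 2 + 2 * d ^ 2 + a ^ 2 + c ^ 2 : ℝ) =
    6 - 4 * p ^ 2 - 8 * q ^ 2 + 16 * p * q := by exact_mod_cast h.rat
  have e2 : (a * b + c * d : ℝ) = -2 + 2 * p ^ 2 + 4 * q ^ 2 - 4 * p * q := by
    exact_mod_cast h.irr
  have ht : (0 : ℝ) ≤ p + q * √2 := by
    simp only [lor, h.two] at h0
    simp at h0
    exact nonneg_of_mul_nonneg_right h0 hs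
  have hu : (5 + 4 * √2) * (p + q * √2 : ℝ) < (6 + 4 * √2) * (b + a * (√2 / 2)) := by
    simp [lor, halfTurn_eq, Matrix.mulVec, dotProduct, Fin.sum_univ_three, h.zero, h.two] at h1
    have e : (1 + √2) * (b + a * (√2 / 2)) * (2 * sR * (1 + √2))
      = sR * ((6 + 4 * √2) * (b + a * (√2 / 2))) := by grind
    have e' : sR * (p + q * √2) * (5 + 4 * √2) = sR * ((5 + 4 * √2) * (p + q * √2)) := by ring
    rw [e, e'] at h1
    exact lt_of_mul_lt_mul_left h1 hs.le
  have hu2 : (b + a * (√2 / 2) : ℝ) ^ 2 ≤ 3 - 2 * √2 + (2 * √2 - 2) * (p + q * √2) ^ 2 := by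
    have e3 : 3 - 2 * √2 + (2 * √2 - 2) * (p + q * √2 : ℝ) ^ 2 - (b + a * (√2 / 2)) ^ 2
      = (d + c * (√2 / 2)) ^ 2 := by grind
    nlinarith [sq_nonneg (d + c * (√2 / 2) : ℝ)]
  set t : ℝ := p + q * √2 with ht_def
  set u : ℝ := b + a * (√2 / 2) with hu_def
  -- `0.914` is just below `(5 + 4√2) / (6 + 4√2)`, while `0.914 ^ 2` still exceeds the leading
  -- coefficient `2√2 - 2` of `hu2`; this bounds `t`.
  have hu3 : 0.914 * t ≤ u := by nlinarith
  have ht5 : t ≤ 5 := by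
    by_contra hlt
    push Not at hlt
    have : (0.914 * t) ^ 2 ≤ u ^ 2 := pow_le_pow_left₀ (by positivity) hu3 2
    nlinarith
  obtain ⟨b1, b2, b3, b4⟩ := h.bounds ht ht5
  have hp1 : (-1 : ℤ) < p := by
    have : (-1 : ℝ) < p := by linarith
    exact_mod_cast this
  have hp2 : p < 4 := by
    have : (p : ℝ) < 4 := by linarith
    exact_mod_cast this
  have hq1 : (-1 : ℤ) < q := by
    have : (-1 : ℝ) < q := by nlinarith
    exact_mod_cast this
  have hq2 : q < 3 := by
    have : (q : ℝ) < 3 := by nlinarith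
    exact_mod_cast this
  have hc := h.conj_sq_lt
  have ho := h.odd
  have r1 := h.rat
  have r2 := h.irr
  have h00 := h.zero
  have h01 := h.one
  have h02 := h.two
  have hpq : p = 1 ∧ (q = 0 ∨ q = 1) := by
    rcases conj_cases (by omega) (by omega) (by omega) hc with h' | ⟨rfl, rfl⟩
    · exact h'
    · exfalso
      norm_num [ht_def] at ht5
      linarith
  obtain ⟨rfl, rfl | rfl⟩ := hpq
  · norm_num at r1 r2
    rcases normalCoords_cases_one r1 r2 with ⟨rfl, rfl, rfl, rfl⟩ | ⟨ha, hb⟩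
    · ext i
      fin_cases i
      · simpa [normal, cR] using h00
      · simpa [normal, cR] using h01
      · simpa [normal, cR] using h02
    · have ha' : (a : ℝ) * (√2 / 2) ≤ 1 * (√2 / 2) :=
        mul_le_mul_of_nonneg_right (by exact_mod_cast ha) (by positivity)
      have hb' : (b : ℝ) ≤ 0 := by exact_mod_cast hb
      norm_num [ht_def] at hu3
      linarith
  · norm_num at r1 r2
    norm_num [ht_def] at hu3
    rcases normalCoords_cases_two r1 r2 with ⟨rfl, hb⟩ | ⟨rfl, ha⟩
    · have hb' : (b : ℝ) ≤ 2 := by exact_mod_cast hb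
      norm_num [hu_def] at hu3
      linarith
    · have ha' : (a : ℝ) * (√2 / 2) ≤ 3 * (√2 / 2) :=
        mul_le_mul_of_nonneg_right (by exact_mod_cast ha) (by positivity)
      norm_num [hu_def] at hu3
      linarith

/-! ### The stabilizer of a geodesic -/

/-- `normal`, `(sR, 0, cR)` and `(0, 1, 0)` form a Lorentz orthonormal basis. Since `M` fixes the
first vector, it acts on the plane of the other two, preserving time direction and orientation: a
hyperbolic rotation. -/
theorem IsGood.exists_boost {M : Matrix (Fin 3) (Fin 3) ℝ} (hM : IsGood M)
    (h : M.mulVec normal = normal) : ∃ t, M = boost t := by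
  have hc : 0 < cR := by unfold cR; positivity
  have hsq := sR_sq
  have hcol : ∀ i, M i 0 * cR + M i 2 * sR = normal i := fun i => by
    have := congrFun h i
    simpa [Matrix.mulVec, dotProduct, Fin.sum_univ_three, normal] using this
  have hf := (hM.future ![sR, 0, cR] ⟨hc, by simp; linarith⟩).1
  have l0 := hM.lor_eq ![1, 0, 0] ![0, 1, 0]
  have l1 := hM.lor_eq ![1, 0, 0] ![1, 0, 0]
  have l2 := hM.lor_eq ![1, 0, 0] ![0, 0, 1]
  have l3 := hM.lor_eq ![0, 1, 0] ![0, 1, 0]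
  have l4 := hM.lor_eq ![0, 1, 0] ![0, 0, 1]
  have l5 := hM.lor_eq ![0, 0, 1] ![0, 0, 1]
  have hd := hM.det_eq
  have c0 := hcol 0
  have c1 := hcol 1
  have c2 := hcol 2
  rw [Matrix.det_fin_three] at hd
  simp [Matrix.mulVec, dotProduct, Fin.sum_univ_three, lor, normal] at hf l0 l1 l2 l3 l4 l5 c0 c1 c2
  -- `m` is the image of the midpoint `(sR, 0, cR)` of side `0`; `y` below is the image of `(0, 1,
  -- 0)`.
  obtain ⟨m0, hm0⟩ : ∃ x, x = M 0 0 * sR + M 0 2 * cR := ⟨_, rfl⟩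
  obtain ⟨m1, hm1⟩ : ∃ x, x = M 1 0 * sR + M 1 2 * cR := ⟨_, rfl⟩
  obtain ⟨m2, hm2⟩ : ∃ x, x = M 2 0 * sR + M 2 2 * cR := ⟨_, rfl⟩
  rw [← hm2] at hf
  have e00 : M 0 0 = cR ^ 2 - sR * m0 := by rw [hm0]; grind
  have e02 : M 0 2 = cR * m0 - sR * cR := by rw [hm0]; grind
  have e10 : M 1 0 = - sR * m1 := by rw [hm1]; grind
  have e12 : M 1 2 = cR * m1 := by rw [hm1]; grind
  have e20 : M 2 0 = cR * sR - sR * m2 := by rw [hm2]; grind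
  have e22 : M 2 2 = cR * m2 - sR ^ 2 := by rw [hm2]; grind
  obtain ⟨y0, hy0⟩ : ∃ x, x = M 0 1 := ⟨_, rfl⟩
  obtain ⟨y1, hy1⟩ : ∃ x, x = M 1 1 := ⟨_, rfl⟩
  obtain ⟨y2, hy2⟩ : ∃ x, x = M 2 1 := ⟨_, rfl⟩
  rw [e00, e02, e10, e12, e20, e22, ← hy0, ← hy1, ← hy2] at hd
  simp only [e00, e02, e10, e12, e20, e22, ← hy0, ← hy1, ← hy2] at l0 l1 l2 l3 l4 l5
  clear c0 c1 c2 hcol hm0 hm1 hm2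
  have k1 : cR * m0 = sR * m2 := by grind
  have k2 : m0 ^ 2 + m1 ^ 2 - m2 ^ 2 = -1 := by grind
  have k3 : cR * y0 = sR * y2 := by grind
  have k4 : m0 * y0 + m1 * y1 - m2 * y2 = 0 := by grind
  have k5 : y0 ^ 2 + y1 ^ 2 - y2 ^ 2 = 1 := by grind
  obtain ⟨c, hc'⟩ : ∃ c, c = cR * m2 - sR * m0 := ⟨_, rfl⟩
  obtain ⟨s, hs'⟩ : ∃ s, s = cR * y2 - sR * y0 := ⟨_, rfl⟩
  have a0 : m0 = sR * c := by grind
  have a2 : m2 = cR * c := by grind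
  have b0 : y0 = sR * s := by grind
  have b2 : y2 = cR * s := by grind
  clear hc' hs'
  subst a0 a2 b0 b2
  have q1 : c ^ 2 = 1 + m1 ^ 2 := by grind
  have q2 : c * s = m1 * y1 := by grind
  have q3 : c * y1 - m1 * s = 1 := by grind
  have q4 : y1 = c := by grind
  have q5 : s = m1 := by grind
  have hcpos : 0 < c := pos_of_mul_pos_right hf hc.le
  have hcosh : Real.cosh (Real.arsinh m1) = c := by
    rw [Real.cosh_arsinh, ← q1, Real.sqrt_sq hcpos.le]
  refine ⟨Real.arsinh m1, ?_⟩
  ext i j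
  fin_cases i <;> fin_cases j <;> simp [boost, hcosh, Real.sinh_arsinh] <;> grind

theorem isGood_boost_sideLen (n : ℤ) : IsGood (boost (n * sideLen)) := by
  have hr : IsGood ringTurn := isGood_halfTurn.mul (isGood_rot 1)
  have h4 : IsGood (ringTurn ^ 4) := by
    rw [show ringTurn ^ 4 = ringTurn * ringTurn * (ringTurn * ringTurn) by noncomm_ring]
    exact (hr.mul hr).mul (hr.mul hr)
  have h1 : IsGood (boost (-sideLen)) := by
    rw [← boost_neg_sideLen]; exact h4.mul isGood_halfTurn
  have h2 : IsGood (boost sideLen) := by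
    have : boost sideLen = halfTurn * boost (-sideLen) * halfTurn := by
      rw [halfTurn_mul_boost, mul_assoc, halfTurn_mul_self, neg_neg, mul_one]
    rw [this]
    exact (isGood_halfTurn.mul h1).mul isGood_halfTurn
  induction n using Int.induction_on with
  | zero => simpa [boost_zero] using isGood_one
  | succ n ih =>
    have := ih.mul h2
    rw [boost_mul] at this
    convert this using 2
    push_cast; ring
  | pred n ih =>
    have := ih.mul h1
    rw [boost_mul] at this
    convert this using 2
    push_cast; ring

/-- The first solution belongs to the identity, the second to a translation by a full side. The only
other candidate that satisfies `rat` is `p = 3`, `q = 2`, and it violates `irr`. -/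
theorem boost_coords_cases {v : Vec} {a b c d p q : ℤ} (hp1 : -3 < p) (hp2 : p < 5)
    (hq1 : -2 < q) (hq2 : q < 4) (hv : IsNormalCoords v a b c d p q) (ha : a = 4 * p - 4 * q - 3)
    (hb : b = 4 * q - 2 * p + 2) : (p = 1 ∧ q = 0) ∨ (p = -1 ∧ q = -1) := by
  have ho := hv.odd
  have r1 := hv.rat
  have r2 := hv.irr
  have := sq_nonneg c
  have := sq_nonneg d
  subst ha hb
  have hp : p = -1 ∨ p = 1 ∨ p = 3 := by omega
  obtain rfl | rfl | rfl := hp <;> interval_cases q <;> norm_num at r1 r2 ⊢ <;> try linarith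
  have hd : d = 0 := by nlinarith
  subst hd
  omega

/-- The test vector is the normal of the side next to side `0`. Its image stays in the lattice,
keeps the product `-√2 / 2` with `normal`, and has bounded last coordinate when `t` is at most half
a side. -/
theorem eq_zero_of_isGood_boost {t : ℝ} (h : IsGood (boost t)) (ht : |t| ≤ Real.arsinh sR) :
    t = 0 := by
  have h2 := sqrt_two_mul_self
  have hr := sR_mul_self
  have g1 := sqrt_two_gt
  have g2 := sqrt_two_lt
  have hs := sR_pos
  have hs1 : Real.sinh t ≤ sR := by
    rw [← Real.sinh_arsinh sR]
    exact Real.sinh_le_sinh.2 ((le_abs_self t).trans ht)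
  have hs2 : -sR ≤ Real.sinh t := by
    rw [neg_le, ← Real.sinh_neg, ← Real.sinh_arsinh sR]
    exact Real.sinh_le_sinh.2 ((neg_le_abs t).trans ht)
  have hc1 := Real.one_le_cosh t
  have hc2 : Real.cosh t ≤ 1 + √2 := by
    have := cosh_arsinh_sR
    rw [cR] at this
    rw [← this, Real.cosh_le_cosh]
    exact ht.trans (le_abs_self _)
  have hcs := Real.cosh_sq t
  have hmem := h.lattice _ (rot_one_mulVec_mem normal_mem)
  have hl := h.lor_eq ((rot 1).mulVec normal) normal
  have hn : (boost t).mulVec normal = normal := by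
    have := sR_sq
    ext i
    fin_cases i <;> simp [boost, normal, Matrix.mulVec, dotProduct, Fin.sum_univ_three] <;> grind
  rw [hn] at hl
  obtain ⟨a, b, c, d, p, q, hv⟩ := hmem
  have hv0 := hv.zero
  have hv2 := hv.two
  have hlv : (1 + √2) * ((boost t).mulVec ((rot 1).mulVec normal) 0)
      - sR * ((boost t).mulVec ((rot 1).mulVec normal) 2) = -(√2 / 2) := by
    have : lor ((boost t).mulVec ((rot 1).mulVec normal)) normal =
      (1 + √2) * ((boost t).mulVec ((rot 1).mulVec normal) 0)
      - sR * ((boost t).mulVec ((rot 1).mulVec normal) 2) := by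
      simp only [lor, normal, cR]; simp; ring
    rw [← this, hl]
    simp [lor, normal, cR, rot_one, Matrix.mulVec, dotProduct, Fin.sum_univ_three]
    grind
  have hval : sR * (p + q * √2) = sR * (-(√2 / 2) + (1 + √2 / 2) * Real.cosh t) +
      (2 + 3 / 2 * √2) * Real.sinh t := by
    rw [← hv2]
    simp [boost, normal, cR, rot_one, Matrix.mulVec, dotProduct, Fin.sum_univ_three]
    grind
  rw [hv0, hv2] at hlv
  -- Comparing rational and irrational parts of `hlv` expresses `a` and `b` by `p` and `q`.
  obtain ⟨z1, z2⟩ := eq_zero_of_add_mul_sqrt_two (m := 2 * (3 * b + 2 * a - 2 * p - 4 * q))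
    (n := 4 * b + 3 * a - 4 * p - 4 * q + 1) (by push_cast; grind)
  have ha : a = 4 * p - 4 * q - 3 := by omega
  have hb : b = 4 * q - 2 * p + 2 := by omega
  have hup : (p + q * √2 : ℝ) ≤ 7.54 := by
    refine le_of_mul_le_mul_left ?_ hs
    rw [hval]
    have k1 : sR * ((1 + √2 / 2) * Real.cosh t) ≤ sR * ((1 + √2 / 2) * (1 + √2)) := by gcongr
    have k2 : (2 + 3 / 2 * √2) * Real.sinh t ≤ (2 + 3 / 2 * √2) * sR := by gcongr
    nlinarith
  have hlow : (-3.13 : ℝ) ≤ p + q * √2 := by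
    refine le_of_mul_le_mul_left ?_ hs
    rw [hval]
    have k1 : sR * ((1 + √2 / 2) * 1) ≤ sR * ((1 + √2 / 2) * Real.cosh t) := by gcongr
    have k2 : (2 + 3 / 2 * √2) * (-sR) ≤ (2 + 3 / 2 * √2) * Real.sinh t := by gcongr
    nlinarith
  obtain ⟨b1, b2, b3, b4⟩ := hv.bounds hlow hup
  have hp1 : -3 < p := by
    have : (-3 : ℝ) < p := by linarith
    exact_mod_cast this
  have hp2 : p < 5 := by
    have : (p : ℝ) < 5 := by linarith
    exact_mod_cast this
  have hq1 : -2 < q := by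
    have : (-2 : ℝ) < q := by nlinarith
    exact_mod_cast this
  have hq2 : q < 4 := by
    have : (q : ℝ) < 4 := by nlinarith
    exact_mod_cast this
  have hpq := boost_coords_cases hp1 hp2 hq1 hq2 hv ha hb
  clear b1 b2 b3 b4 hp1 hp2 hq1 hq2 hv0 hv2 hlv hl hn hlow hup hv z1 z2
  -- The first candidate forces `cosh t = 1`. The second forces `cosh t = 5 + 4√2`, a full side,
  -- which is too long.
  rcases hpq with ⟨rfl, rfl⟩ | ⟨rfl, rfl⟩
  · have e1 : (2 + 3 / 2 * √2) * Real.sinh t = sR * ((1 + √2 / 2) * (1 - Real.cosh t)) := by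
      push_cast at hval; linear_combination -hval
    have e2 : ((2 + 3 / 2 * √2) * Real.sinh t) ^ 2 =
        (sR * ((1 + √2 / 2) * (1 - Real.cosh t))) ^ 2 := by rw [e1]
    have e3 : (Real.cosh t - 1) * ((3 / 2 + √2) * (Real.cosh t - 1) + (17 + 12 * √2)) = 0 := by
      grind
    rcases mul_eq_zero.1 e3 with e4 | e4
    · have : Real.sinh t ^ 2 = 0 := by rw [Real.sinh_sq]; rw [sub_eq_zero.1 e4]; norm_num
      exact Real.sinh_eq_zero.1 (pow_eq_zero_iff (by norm_num) |>.1 this)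
    · exfalso; nlinarith
  · exfalso
    have e1 : (2 + 3 / 2 * √2) * Real.sinh t = -(sR * ((1 + √2 / 2) * (1 + Real.cosh t))) := by
      push_cast at hval; linear_combination -hval
    have e2 : ((2 + 3 / 2 * √2) * Real.sinh t) ^ 2 =
        (-(sR * ((1 + √2 / 2) * (1 + Real.cosh t)))) ^ 2 := by rw [e1]
    have e3 : (Real.cosh t + 1) * ((3 / 2 + √2) * Real.cosh t - (31 / 2 + 11 * √2)) = 0 := by
      grind
    rcases mul_eq_zero.1 e3 with e4 | e4 <;> nlinarith

theorem IsGood.exists_boost_sideLen {M : Matrix (Fin 3) (Fin 3) ℝ} (hM : IsGood M)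
    (h : M.mulVec normal = normal) : ∃ n : ℤ, M = boost (n * sideLen) := by
  obtain ⟨t, rfl⟩ := hM.exists_boost h
  have hl := sideLen_pos
  set n := round (t / sideLen) with hn
  refine ⟨n, ?_⟩
  have h1 := hM.mul (isGood_boost_sideLen (-n))
  rw [boost_mul] at h1
  have h2 : |t + ((-n : ℤ) : ℝ) * sideLen| ≤ Real.arsinh sR := by
    have h3 := abs_sub_round (t / sideLen)
    rw [← hn] at h3
    have h4 : t + ((-n : ℤ) : ℝ) * sideLen = (t / sideLen - n) * sideLen := by
      push_cast; field_simp; ring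
    rw [h4, abs_mul, abs_of_pos hl]
    calc |t / sideLen - n| * sideLen ≤ 1 / 2 * sideLen := by gcongr
      _ = Real.arsinh sR := by unfold sideLen; ring
  have h5 := eq_zero_of_isGood_boost h1 h2
  congr 1
  push_cast at h5
  linarith

/-- If two edges cross the same geodesic in the same direction, then they differ by a translation
along that geodesic by a multiple of the side length. -/
theorem IsNetFrame.exists_boost {e e' : Edge} (he : IsNetFrame e) (he' : IsNetFrame e')
    (h : e.mulVec normal = e'.mulVec normal) : ∃ n : ℤ, e' = e * boost (n * sideLen) := by
  obtain ⟨-, i, hi, h1, h2⟩ := he.exists_inv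
  obtain ⟨n, hn⟩ := (hi.mul he'.isGood).exists_boost_sideLen (by
    rw [← Matrix.mulVec_mulVec, ← h, Matrix.mulVec_mulVec, h2, Matrix.one_mulVec])
  exact ⟨n, by rw [← hn, ← mul_assoc, h1, one_mul]⟩

/-! ### Linear relations between heights -/

theorem height_mul (e M : Edge) (z : ℂ) :
    Edge.height (e * M) z = lor (e.mulVec (M.mulVec normal)) (lift z) := by
  rw [Matrix.mulVec_mulVec]; rfl

theorem height_eq_of_mulVec_eq {e e' : Edge} (h : e.mulVec normal = e'.mulVec normal) (z : ℂ) :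
    e.height z = e'.height z := by
  change lor (e.mulVec normal) _ = lor (e'.mulVec normal) _
  rw [h]

theorem rot_mulVec_normal (k : ℤ) : (rot k).mulVec normal =
    ![cR * Real.cos (k * (Real.pi / 4)), cR * Real.sin (k * (Real.pi / 4)), sR] := by
  ext i
  fin_cases i <;> simp [rot, normal, Matrix.mulVec, dotProduct, Fin.sum_univ_three] <;> ring

theorem halfTurn_mulVec_normal : halfTurn.mulVec normal = (-1 : ℝ) • normal := by
  have := sR_sq
  ext i
  fin_cases i <;> simp [halfTurn, normal, Matrix.mulVec, dotProduct, Fin.sum_univ_three] <;> grind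

theorem boost_mulVec_normal (t : ℝ) : (boost t).mulVec normal = normal := by
  have := sR_sq
  ext i
  fin_cases i <;> simp [boost, normal, Matrix.mulVec, dotProduct, Fin.sum_univ_three] <;> grind

theorem ringTurn_mulVec_normal :
    ringTurn.mulVec normal = ![3 + 3 / 2 * √2, -1 - √2 / 2, sR + √2 * sR] := by
  have h2 := sqrt_two_mul_self
  have hr := sR_mul_self
  rw [ringTurn_eq]
  ext i
  fin_cases i <;> simp [normal, cR, Matrix.mulVec, dotProduct, Fin.sum_univ_three] <;> grind

/-- The normals of the geodesics through a vertex lie in the plane orthogonal to it, where a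
rotation `R` by `π / 4` satisfies `R ^ 2 = 2 cos (π / 4) R - 1`. -/
theorem ringTurn_sq_mulVec_normal : (ringTurn ^ 2).mulVec normal =
    √2 • ringTurn.mulVec normal + (-1 : ℝ) • normal := by
  have h2 := sqrt_two_mul_self
  have hr := sR_mul_self
  rw [ringTurn_mulVec_normal, sq, ← Matrix.mulVec_mulVec, ringTurn_mulVec_normal, ringTurn_eq]
  ext i
  fin_cases i <;> simp [normal, cR, Matrix.mulVec, dotProduct, Fin.sum_univ_three] <;> grind

theorem rot_neg_one_eq : rot (-1) = ringTurn ^ 7 * halfTurn := by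
  have h1 : ringTurn * (rot (-1) * halfTurn) = 1 := by
    rw [ringTurn, mul_assoc, ← mul_assoc (rot 1), rot_mul]
    simp [rot_zero, halfTurn_mul_self]
  have h2 : rot (-1) * halfTurn = ringTurn ^ 7 := by
    calc rot (-1) * halfTurn = ringTurn ^ 8 * (rot (-1) * halfTurn) := by
          rw [ringTurn_pow_eight, one_mul]
      _ = ringTurn ^ 7 * (ringTurn * (rot (-1) * halfTurn)) := by
          rw [← mul_assoc (ringTurn ^ 7), ← pow_succ]
      _ = ringTurn ^ 7 := by rw [h1, mul_one]
  rw [← h2, mul_assoc, halfTurn_mul_self, mul_one]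

theorem height_halfTurn (e : Edge) (z : ℂ) : Edge.height (e * halfTurn) z = -e.height z := by
  rw [height_mul, halfTurn_mulVec_normal, Matrix.mulVec_smul, lor_smul_left, neg_one_mul]
  rfl

theorem height_boost (e : Edge) (t : ℝ) (z : ℂ) : Edge.height (e * boost t) z = e.height z := by
  rw [height_mul, boost_mulVec_normal]; rfl

theorem height_ring_add_two (e : Edge) (k : ℕ) (z : ℂ) :
    Edge.height (e * ringTurn ^ (k + 2)) z =
      √2 * Edge.height (e * ringTurn ^ (k + 1)) z - Edge.height (e * ringTurn ^ k) z := by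
  have h : ∀ j, e * ringTurn ^ (k + j) = (e * ringTurn ^ k) * ringTurn ^ j := fun j => by
    rw [pow_add, mul_assoc]
  rw [h 2, h 1, height_mul, height_mul, ringTurn_sq_mulVec_normal, Matrix.mulVec_add,
    Matrix.mulVec_smul, Matrix.mulVec_smul, lor_add_left, lor_smul_left, lor_smul_left, pow_one]
  change _ + -1 * Edge.height (e * ringTurn ^ k) z = _
  ring

theorem height_ring_add_four (e : Edge) (k : ℕ) (z : ℂ) :
    Edge.height (e * ringTurn ^ (k + 4)) z = -(Edge.height (e * ringTurn ^ k) z) := by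
  have h2 := sqrt_two_mul_self
  have a := height_ring_add_two e (k + 2) z
  have b := height_ring_add_two e (k + 1) z
  have c := height_ring_add_two e k z
  simp only [add_assoc] at a b c
  norm_num at a b c
  grind

/-- The heights with respect to the geodesics through the right endpoint of a side, expressed by
the first and the fourth. -/
theorem height_ring_one (e : Edge) (z : ℂ) : Edge.height (e * ringTurn ^ 1) z =
    Edge.height (e * ringTurn ^ 3) z + √2 * e.height z := by
  have h2 := sqrt_two_mul_self
  have b := height_ring_add_two e 1 z
  have c := height_ring_add_two e 0 z
  norm_num at b c
  rw [pow_one]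
  grind

theorem height_ring_two (e : Edge) (z : ℂ) : Edge.height (e * ringTurn ^ 2) z =
    √2 * Edge.height (e * ringTurn ^ 3) z + e.height z := by
  have h2 := sqrt_two_mul_self
  have b := height_ring_add_two e 1 z
  have c := height_ring_add_two e 0 z
  norm_num at b c
  grind

/-- The next edge clockwise is the reverse of the seventh edge of the ring; the reversal and the
half turn `ringTurn ^ 4` contribute cancelling signs. -/
theorem height_rot_neg_one (e : Edge) (z : ℂ) :
    Edge.height (e * rot (-1)) z = Edge.height (e * ringTurn ^ 3) z := by
  rw [rot_neg_one_eq, ← mul_assoc, height_halfTurn, height_ring_add_four e 3, neg_neg]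

/-! ### Points at infinity -/

/-- Pulling back by the frame reduces questions about any edge to side `0` of `F` and a light-like
vector. -/
theorem IsNetFrame.exists_coords {e : Edge} (he : IsNetFrame e) (z : Circle) :
    ∃ w : Vec, 0 < w 2 ∧ w 0 ^ 2 + w 1 ^ 2 = w 2 ^ 2 ∧
      ∀ v, lor (e.mulVec v) (lift z) = lor v w := by
  obtain ⟨hg, i, hi, h1, h2⟩ := he.exists_inv
  have hz : (z : ℂ).re ^ 2 + (z : ℂ).im ^ 2 = 1 := by
    have := Circle.normSq_coe z
    rw [Complex.normSq_apply] at this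
    linarith
  have hf := hi.future (lift z) ⟨by simp [lift], by simp [lift, hz]⟩
  refine ⟨i.mulVec (lift z), hf.1, ?_, fun v => ?_⟩
  · have := hi.lor_eq (lift z) (lift z)
    have h' : lor (lift (z : ℂ)) (lift z) = 0 := by simp [lor, lift]; linarith
    rw [h'] at this
    unfold lor at this
    linarith
  · rw [← hg.lor_eq v, Matrix.mulVec_mulVec, h1, Matrix.one_mulVec]

/-- For `2 ≤ k ≤ 6` the directions of the two sides make an angle of at least `π / 2`, so the planar
part of the sum of the normals has length at most `√2 * cR`, less than the last coordinate `2 * sR`.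
-/
theorem IsNetFrame.height_add_height_rot_neg {e : Edge} (he : IsNetFrame e) (z : Circle) {k : ℤ}
    (h1 : 2 ≤ k) (h2 : k ≤ 6) : e.height z + Edge.height (e * rot k) z < 0 := by
  obtain ⟨w, hw, hn, h⟩ := he.exists_coords z
  rw [height_mul, h, rot_mulVec_normal]
  change lor (e.mulVec normal) _ + _ < 0
  rw [h]
  have k1 : (2 : ℝ) ≤ k := by exact_mod_cast h1
  have k2 : (k : ℝ) ≤ 6 := by exact_mod_cast h2
  have hpi := Real.pi_pos
  have hc : Real.cos (k * (Real.pi / 4)) ≤ 0 :=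
    Real.cos_nonpos_of_pi_div_two_le_of_le (by nlinarith) (by nlinarith)
  have hcs := Real.sin_sq_add_cos_sq (k * (Real.pi / 4))
  set c := Real.cos (k * (Real.pi / 4))
  set s := Real.sin (k * (Real.pi / 4))
  simp [lor, normal]
  have hs := sR_pos
  have hcR : 0 < cR := by unfold cR; positivity
  have a1 : (w 0 * (1 + c) + w 1 * s) ^ 2 ≤ 2 * w 2 ^ 2 := by
    have : (w 0 * (1 + c) + w 1 * s) ^ 2 + (w 0 * s - w 1 * (1 + c)) ^ 2 =
        (w 2 ^ 2) * (2 + 2 * c) := by rw [← hn]; linear_combination (w 0 ^ 2 + w 1 ^ 2) * hcs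
    nlinarith [sq_nonneg (w 0 * s - w 1 * (1 + c)), sq_nonneg (w 2)]
  have a2 : cR ^ 2 * 2 < (2 * sR) ^ 2 := by
    have g1 := sqrt_two_gt
    have h2 := sqrt_two_mul_self
    have hr := sR_mul_self
    unfold cR; nlinarith
  have a3 : cR * (w 0 * (1 + c) + w 1 * s) < 2 * sR * w 2 := by
    refine lt_of_pow_lt_pow_left₀ 2 (by positivity) ?_
    calc (cR * (w 0 * (1 + c) + w 1 * s)) ^ 2 = cR ^ 2 * (w 0 * (1 + c) + w 1 * s) ^ 2 := by ring
      _ ≤ cR ^ 2 * (2 * w 2 ^ 2) := by gcongr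
      _ = cR ^ 2 * 2 * w 2 ^ 2 := by ring
      _ < (2 * sR) ^ 2 * w 2 ^ 2 := by gcongr
      _ = _ := by ring
  nlinarith

/-- The half planes beyond two sides of an octagon that are not adjacent are disjoint, also at
infinity. -/
theorem IsNetFrame.not_far {e : Edge} (he : IsNetFrame e) (z : Circle) {j k : ℤ}
    (hj : 0 ≤ Edge.height (e * rot j) z) (hk : 0 ≤ Edge.height (e * rot k) z)
    (h1 : 2 ≤ (k - j) % 8) (h2 : (k - j) % 8 ≤ 6) : False := by
  have := (he.mul_rot j).height_add_height_rot_neg z h1 h2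
  rw [rot_emod, mul_assoc, rot_mul, add_sub_cancel] at this
  linarith

/-- Geodesics of adjacent sides meet at a vertex inside the plane and thus share no endpoint.
Numerically, a common one would give `(1 + √2) ^ 2 = 4√2`. -/
theorem IsNetFrame.interior_pos {e : Edge} (he : IsNetFrame e) (z : Circle)
    (h0 : 0 ≤ e.height z) (h3 : 0 ≤ Edge.height (e * ringTurn ^ 3) z) :
    0 < e.height z ∨ 0 < Edge.height (e * ringTurn ^ 3) z := by
  by_contra! hcon
  have e0 : e.height z = 0 := le_antisymm hcon.1 h0
  have e3 : Edge.height (e * rot (-1)) z = 0 := by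
    rw [height_rot_neg_one]; exact le_antisymm hcon.2 h3
  obtain ⟨w, hw, hn, h⟩ := he.exists_coords z
  rw [height_mul, h, rot_neg_one] at e3
  change lor (e.mulVec normal) _ = 0 at e0
  rw [h] at e0
  have h2 := sqrt_two_mul_self
  have hr := sR_mul_self
  have g1 := sqrt_two_gt
  have g2 := sqrt_two_lt
  simp [lor, normal, cR, Matrix.mulVec, dotProduct, Fin.sum_univ_three] at e0 e3
  have a1 : (1 + √2) * w 1 = (1 - √2) * ((1 + √2) * w 0) := by grind
  have a2 : (1 + √2) ^ 2 * (w 0 ^ 2 + w 1 ^ 2) = (4 - 2 * √2) * (2 + 2 * √2) * w 2 ^ 2 := by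
    grind
  rw [hn] at a2
  have : 0 < w 2 ^ 2 := by positivity
  nlinarith

/-! ### Crossing a geodesic of the net -/

theorem lift_toKlein {v : Vec} (h : 0 < v 2) : lift (toKlein v) = (1 / v 2) • v := by
  ext i
  fin_cases i <;> simp [lift, toKlein] <;> field_simp

theorem IsNetFrame.height_source {e e' : Edge} (he' : IsNetFrame e') :
    ∃ c > 0, e.height e'.source = c * lor (e.mulVec normal) (e'.mulVec ![0, 0, 1]) := by
  have h := (he'.isGood.future ![0, 0, 1] ⟨by simp, by simp⟩).1
  refine ⟨_, one_div_pos.2 h, ?_⟩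
  change lor (e.mulVec normal) (lift (toKlein _)) = _
  rw [lift_toKlein h, lor_comm, lor_smul_left, lor_comm]

/-- An edge that passes from the negative to the positive side of a geodesic of the net crosses it
perpendicularly. -/
theorem IsNetFrame.mulVec_normal_eq {e e' : Edge} (he : IsNetFrame e) (he' : IsNetFrame e')
    (h0 : e.height e'.source ≤ 0) (h1 : 0 < e.height e'.target) :
    e.mulVec normal = e'.mulVec normal := by
  obtain ⟨hg, i, hi, h1', h2'⟩ := he'.exists_inv
  obtain ⟨c, hc, hc'⟩ := he'.height_source (e := e)
  obtain ⟨d, hd, hd'⟩ := he'.mul_halfTurn.height_source (e := e)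
  rw [hc'] at h0
  change 0 < e.height (Edge.source (e' * halfTurn)) at h1
  rw [hd'] at h1
  replace h0 := nonpos_of_mul_nonpos_right h0 hc
  replace h1 := (mul_pos_iff_of_pos_left hd).1 h1
  rw [← hi.lor_eq, Matrix.mulVec_mulVec _ i e', h2', Matrix.one_mulVec] at h0
  rw [← hi.lor_eq, Matrix.mulVec_mulVec _ i (e' * halfTurn), ← mul_assoc, h2', one_mul] at h1
  have := eq_normal_of_lor (hi.lattice _ (he.isGood.lattice _ normal_mem)) h0 h1
  have h := congrArg e'.mulVec this
  rwa [Matrix.mulVec_mulVec, h1', Matrix.one_mulVec] at h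

theorem height_source_self_neg {e : Edge} (he : IsNetFrame e) : e.height e.source < 0 := by
  obtain ⟨c, hc, hc'⟩ := he.height_source (e := e)
  rw [hc', he.isGood.lor_eq]
  have := sR_pos
  have := mul_pos hc this
  simp [lor, normal]
  linarith

theorem height_target_self_pos {e : Edge} (he : IsNetFrame e) : 0 < e.height e.target := by
  have h := height_source_self_neg he.mul_halfTurn
  rw [height_halfTurn] at h
  exact neg_lt_zero.1 h

theorem continuous_height (e : Edge) : Continuous e.height := by
  unfold Edge.height lor lift
  simp
  fun_prop

theorem IsNetFrame.geodesic_mem {e : Edge} (he : IsNetFrame e) : e.geodesic ∈ netGeodesics := by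
  obtain ⟨g, hg, x, rfl⟩ := he.exists_edgeAt
  exact ⟨g, hg, x, rfl⟩

/-- Two points at infinity do not both lie on a geodesic of the net. -/
def Generic (f b : Circle) : Prop :=
  ∀ e : Edge, IsNetFrame e → e.height f = 0 → e.height b = 0 → False

theorem generic_of_not_mem {f b : Circle}
    (hN : ¬ ∃ ℓ ∈ netGeodesics, (f : ℂ) ∈ ℓ ∧ (b : ℂ) ∈ ℓ) : Generic f b :=
  fun e he hf hb => hN ⟨e.geodesic, he.geodesic_mem, ⟨(Circle.norm_coe f).le, hf⟩,
    ⟨(Circle.norm_coe b).le, hb⟩⟩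

/-! ### Moving along a geodesic -/

/-- The `n`-th edge to the right that crosses the same geodesic in the same direction. -/
def shift (e : Edge) (n : ℤ) : Edge := e * boost (-(n * sideLen))

theorem shift_zero (e : Edge) : shift e 0 = e := by simp [shift, boost_zero]

theorem shift_shift (e : Edge) (m n : ℤ) : shift (shift e m) n = shift e (m + n) := by
  rw [shift, shift, shift, mul_assoc, boost_mul]
  congr 2
  push_cast; ring

theorem shift_one (e : Edge) : shift e 1 = e * ringTurn ^ 4 * halfTurn := by
  rw [shift, mul_assoc, boost_neg_sideLen]; simp

theorem shift_mul_halfTurn (e : Edge) (n : ℤ) :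
    shift e n * halfTurn = shift (e * halfTurn) (-n) := by
  rw [shift, shift, mul_assoc, mul_assoc, halfTurn_mul_boost]
  congr 3
  push_cast; ring

theorem height_shift (e : Edge) (n : ℤ) (z : ℂ) : (shift e n).height z = e.height z :=
  height_boost _ _ _

theorem mul_ring_four (e : Edge) : e * ringTurn ^ 4 = shift e 1 * halfTurn := by
  rw [shift_one, mul_assoc, halfTurn_mul_self, mul_one]

theorem shift_mul_ring_four (e : Edge) (n : ℤ) :
    shift e n * ringTurn ^ 4 = shift (e * ringTurn ^ 4) (-n) := by
  rw [mul_ring_four, mul_ring_four, shift_shift, shift_mul_halfTurn, shift_mul_halfTurn,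
    shift_shift]
  congr 1; ring

theorem IsNetFrame.mul_ring {e : Edge} (he : IsNetFrame e) (k : ℕ) :
    IsNetFrame (e * ringTurn ^ k) := by
  induction k with
  | zero => simpa using he
  | succ n ih =>
    rw [pow_succ, ← mul_assoc, ringTurn, ← mul_assoc]
    exact ih.mul_halfTurn.mul_rot 1

theorem IsNetFrame.shift_one {e : Edge} (he : IsNetFrame e) : IsNetFrame (shift e 1) := by
  rw [Snakes.shift_one]; exact (he.mul_ring 4).mul_halfTurn

theorem IsNetFrame.shift {e : Edge} (he : IsNetFrame e) (n : ℤ) : IsNetFrame (shift e n) := by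
  induction n using Int.induction_on with
  | zero => rwa [shift_zero]
  | succ n ih => rw [← shift_shift]; exact ih.shift_one
  | pred n ih =>
    have h := (ih.mul_halfTurn.shift_one).mul_halfTurn
    rw [shift_mul_halfTurn _ 1, mul_assoc, halfTurn_mul_self, mul_one, shift_shift] at h
    rwa [sub_eq_add_neg]

theorem IsNetFrame.exists_shift {e e' : Edge} (he : IsNetFrame e) (he' : IsNetFrame e')
    (h : e.mulVec normal = e'.mulVec normal) : ∃ n : ℤ, e' = Snakes.shift e n := by
  obtain ⟨n, hn⟩ := he.exists_boost he' h
  exact ⟨-n, by rw [hn, Snakes.shift]; push_cast; congr 2; ring⟩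

theorem height_ring_pow_add (e : Edge) (j k : ℕ) (z : ℂ) :
    Edge.height (e * ringTurn ^ j * ringTurn ^ k) z = Edge.height (e * ringTurn ^ (j + k)) z := by
  rw [mul_assoc, ← pow_add]

/-- Both geodesics contain sides of the octagon where `e * ringTurn ^ 4` starts, two places apart,
so `not_far` applies. -/
theorem IsNetFrame.right_neg_of_shift {e : Edge} (he : IsNetFrame e) (z : Circle)
    (h : Edge.height (e * ringTurn ^ 3) z ≤ 0) :
    Edge.height (Snakes.shift e 1 * ringTurn ^ 1) z < 0 := by
  by_contra! hcon
  refine (he.mul_ring 4).not_far z (j := -1) (k := 1) ?_ ?_ (by norm_num) (by norm_num)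
  · rw [height_rot_neg_one, height_ring_pow_add, height_ring_add_four e 3]
    linarith
  · rwa [Snakes.shift_one, pow_one, ringTurn, mul_assoc, ← mul_assoc halfTurn, halfTurn_mul_self,
      one_mul] at hcon

theorem IsNetFrame.left_neg_of_shift {e : Edge} (he : IsNetFrame e) (z : Circle)
    (h : Edge.height (e * ringTurn ^ 1) z ≤ 0) :
    Edge.height (Snakes.shift e 1 * ringTurn ^ 3) z < 0 := by
  by_contra! hcon
  refine he.shift_one.not_far z (j := 1) (k := -1) ?_ ?_ (by norm_num) (by norm_num)
  · rw [Snakes.shift_one, mul_assoc, ← ringTurn, ← pow_one ringTurn, ← pow_mul,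
      height_ring_pow_add, add_comm, height_ring_add_four e 1]
    linarith
  · rwa [height_rot_neg_one]

/-- Induction from vertex to vertex: `right_neg_of_shift` gives the first sign at the next vertex,
and `height_ring_one` with positive height gives the second, which feeds the following step. -/
theorem IsNetFrame.far_pos {e : Edge} (he : IsNetFrame e) (z : Circle) (h0 : 0 < e.height z)
    (h3 : Edge.height (e * ringTurn ^ 3) z ≤ 0) {n : ℕ} (hn : 1 ≤ n) :
    Edge.height (Snakes.shift e n * ringTurn ^ 1) z < 0 ∧
      Edge.height (Snakes.shift e n * ringTurn ^ 3) z < 0 := by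
  have key : ∀ m : ℤ, Edge.height (Snakes.shift e m * ringTurn ^ 3) z ≤ 0 →
      Edge.height (Snakes.shift e (m + 1) * ringTurn ^ 1) z < 0 ∧
      Edge.height (Snakes.shift e (m + 1) * ringTurn ^ 3) z < 0 := by
    intro m hm
    have h1 := (he.shift m).right_neg_of_shift z hm
    rw [shift_shift] at h1
    refine ⟨h1, ?_⟩
    rw [height_ring_one, height_shift] at h1
    have : 0 < √2 * e.height z := by positivity
    linarith
  induction n, hn using Nat.le_induction with
  | base => simpa using key 0 (by rwa [shift_zero])
  | succ n hn ih => simpa using key n ih.2.le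

theorem IsNetFrame.far_neg {e : Edge} (he : IsNetFrame e) (z : Circle) (h0 : e.height z < 0)
    (h1 : Edge.height (e * ringTurn ^ 1) z ≤ 0) {n : ℕ} (hn : 1 ≤ n) :
    Edge.height (Snakes.shift e n * ringTurn ^ 1) z < 0 ∧
      Edge.height (Snakes.shift e n * ringTurn ^ 3) z < 0 := by
  have key : ∀ m : ℤ, Edge.height (Snakes.shift e m * ringTurn ^ 1) z ≤ 0 →
      Edge.height (Snakes.shift e (m + 1) * ringTurn ^ 1) z < 0 ∧
      Edge.height (Snakes.shift e (m + 1) * ringTurn ^ 3) z < 0 := by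
    intro m hm
    have h3 := (he.shift m).left_neg_of_shift z hm
    rw [shift_shift] at h3
    refine ⟨?_, h3⟩
    rw [height_ring_one, height_shift]
    have : √2 * e.height z < 0 := mul_neg_of_pos_of_neg (by positivity) h0
    linarith
  induction n, hn using Nat.le_induction with
  | base => simpa using key 0 (by rwa [shift_zero])
  | succ n hn ih => simpa using key n ih.1.le

/-! ### Corners around which a snake can run on both sides -/

/-- The points `f` and `b` lie in the wedge with base `e` and in the opposite wedge. -/
structure Full (f b : Circle) (e : Edge) : Prop where
  frame : IsNetFrame e
  left_f : 0 ≤ e.height f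
  right_f : 0 ≤ Edge.height (e * ringTurn ^ 3) f
  left_b : e.height b ≤ 0
  right_b : Edge.height (e * ringTurn ^ 3) b ≤ 0

theorem Full.symm {f b : Circle} {e : Edge} (h : Full f b e) : Full b f (e * ringTurn ^ 4) := by
  have h0 := fun z => height_ring_add_four e 0 z
  simp only [zero_add, pow_zero, mul_one] at h0
  refine ⟨h.frame.mul_ring 4, ?_, ?_, ?_, ?_⟩
  · rw [h0]; linarith [h.left_b]
  · rw [height_ring_pow_add, height_ring_add_four e 3]; linarith [h.right_b]
  · rw [h0]; linarith [h.left_f]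
  · rw [height_ring_pow_add, height_ring_add_four e 3]; linarith [h.right_f]

theorem Full.interior_f {f b : Circle} {e : Edge} (h : Full f b e) :
    0 < Edge.height (e * ringTurn ^ 1) f ∧ 0 < Edge.height (e * ringTurn ^ 2) f := by
  rw [height_ring_one, height_ring_two]
  have h2 : 0 < √2 := by positivity
  have h0 := h.left_f
  have h3 := h.right_f
  rcases h.frame.interior_pos f h0 h3 with h' | h'
  · have := mul_pos h2 h'
    have := mul_nonneg h2.le h3
    constructor <;> linarith
  · have := mul_pos h2 h'
    have := mul_nonneg h2.le h0
    constructor <;> linarith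

theorem Full.interior_b {f b : Circle} {e : Edge} (h : Full f b e) :
    Edge.height (e * ringTurn ^ 1) b < 0 ∧ Edge.height (e * ringTurn ^ 2) b < 0 := by
  have := h.symm.interior_f
  rw [height_ring_pow_add, height_ring_pow_add, add_comm, height_ring_add_four e 1,
    add_comm, height_ring_add_four e 2] at this
  exact ⟨by linarith [this.1], by linarith [this.2]⟩

theorem height_ring_four (e : Edge) (z : ℂ) :
    Edge.height (e * ringTurn ^ 4) z = -e.height z := by
  simpa using height_ring_add_four e 0 z

/-- At a full corner `f` has non-negative and `b` non-positive height for all four geodesics through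
the vertex. At a vertex further along the geodesic of `x` at least one of these signs fails,
whichever geodesic `k` is shared. -/
theorem Full.false_of_far {f b : Circle} {e x : Edge} (h : Full f b e) (hx : IsNetFrame x)
    (f0 : 0 < x.height f) (f3 : Edge.height (x * ringTurn ^ 3) f ≤ 0) (b0 : x.height b < 0)
    (b1 : Edge.height (x * ringTurn ^ 1) b ≤ 0) {n k : ℕ} (hn : 1 ≤ n) (hk : k ≤ 3)
    (hek : e * ringTurn ^ k = shift x n) : False := by
  have hf := hx.far_pos f f0 f3 hn
  have hb := hx.far_neg b b0 b1 hn
  rw [← hek, height_ring_pow_add, height_ring_pow_add] at hf hb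
  have i1 := h.interior_f
  have l1 := h.left_b
  have r1 := h.right_f
  interval_cases k
  · norm_num at hf; linarith
  · norm_num at hf; linarith
  · norm_num at hf; linarith
  · have := hb.1
    norm_num at this
    rw [height_ring_four] at this
    linarith

/-- Different vertices are excluded by `false_of_far`, in either direction thanks to `Full.symm`. At
the same vertex, adjacent wedges would put `f` and `b` on their common wall, the only place where
genericity is needed; wedges two places apart have incompatible signs. -/
theorem Full.eq_of_shift {f b : Circle} {e e' : Edge} (hG : Generic f b) (h : Full f b e)
    (h' : Full f b e') {n : ℤ} {k : ℕ} (hk : k ≤ 3)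
    (hek : e' * ringTurn ^ k = shift (e * ringTurn ^ 1) n) : e = e' := by
  have far : ∀ {f b : Circle} {e e' : Edge}, Full f b e → Full f b e' →
      ∀ {n : ℕ}, 1 ≤ n → e' * ringTurn ^ k = shift (e * ringTurn ^ 1) n → False := by
    intro f b e e' h h' n hn hek
    refine h'.false_of_far (h.frame.mul_ring 1) h.interior_f.1 ?_ h.interior_b.1 ?_ hn hk hek
    · rw [height_ring_pow_add, height_ring_four]; linarith [h.left_f]
    · rw [height_ring_pow_add]; exact h.interior_b.2.le
  have wall : ∀ {e e' : Edge}, Full f b e → Full f b e' → e' = e * ringTurn ^ 1 → False := by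
    rintro e e' h h' rfl
    have a := h'.right_f
    have c := h'.right_b
    rw [height_ring_pow_add, height_ring_four] at a c
    exact hG e h.frame (le_antisymm (by linarith) h.left_f) (le_antisymm h.left_b (by linarith))
  have cancel : ∀ {x y : Edge} (j : ℕ), x * ringTurn ^ j = y * ringTurn ^ j → j ≤ 8 → x = y := by
    intro x y j hxy hj
    have := congrArg (fun M : Edge => M * ringTurn ^ (8 - j)) hxy
    simpa only [mul_assoc, ← pow_add, Nat.add_sub_cancel' hj, ringTurn_pow_eight, mul_one]
      using this
  rcases lt_trichotomy n 0 with hn | rfl | hn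
  · exfalso
    refine far h.symm h'.symm (n := (-n).toNat) (by omega) ?_
    rw [Int.toNat_of_nonneg (by omega), mul_assoc, ← pow_add, add_comm, pow_add, ← mul_assoc, hek,
      shift_mul_ring_four, mul_assoc, mul_assoc, ← pow_add, ← pow_add]
  · rw [shift_zero] at hek
    interval_cases k
    · exact (wall h h' (by simpa using hek)).elim
    · exact (cancel 1 hek (by norm_num)).symm
    · refine (wall h' h (cancel 1 ?_ (by norm_num))).elim
      rw [← hek, mul_assoc, ← pow_add]
    · exfalso
      have : e = e' * ringTurn ^ 2 := cancel 1 (by rw [← hek, mul_assoc, ← pow_add]) (by norm_num)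
      subst this
      have a := h.right_f
      rw [height_ring_pow_add, height_ring_add_four e' 1] at a
      linarith [h'.interior_f.1]
  · exact (far h h' (n := n.toNat) (by omega) (by rwa [Int.toNat_of_nonneg (by omega)])).elim

/-! ### Sides crossed by steps with a single edge -/

/-- The conditions on the limit points that come from the regions of a snake at a step with the
single edge `e`. -/
structure HalfCrossing (f b : Circle) (e : Edge) : Prop where
  pos : 0 < e.height f
  right : Edge.height (e * rot (-1)) f < 0
  left : Edge.height (e * rot 1) f < 0
  behind_right : 0 ≤ Edge.height (e * rot (-1)) b →
    Edge.height (e * halfTurn * rot 1 * halfTurn * rot 1) f < 0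
  behind_left : 0 ≤ Edge.height (e * rot 1) b →
    Edge.height (e * halfTurn * rot (-1) * halfTurn * rot (-1)) f < 0

/-- The conditions that come from a step with the single edge `e` of a snake and its inverse. -/
structure Crossing (f b : Circle) (e : Edge) : Prop where
  frame : IsNetFrame e
  half : HalfCrossing f b e
  half_rev : HalfCrossing b f (e * halfTurn)

theorem Crossing.symm {f b : Circle} {e : Edge} (h : Crossing f b e) :
    Crossing b f (e * halfTurn) :=
  ⟨h.frame.mul_halfTurn, h.half_rev, by
    rw [mul_assoc, halfTurn_mul_self, mul_one]; exact h.half⟩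

theorem mul_left_left (e : Edge) (k : ℕ) :
    e * ringTurn ^ k * halfTurn * halfTurn * rot (-1) * halfTurn * rot (-1) =
      e * ringTurn ^ (k + 14) * halfTurn := by
  rw [rot_neg_one_eq]
  simp only [mul_assoc, pow_add]
  rw [← mul_assoc halfTurn halfTurn, halfTurn_mul_self, one_mul,
    ← mul_assoc halfTurn halfTurn, halfTurn_mul_self, one_mul, ← mul_assoc (ringTurn ^ 7),
    ← pow_add]

/-- The conditions at the right endpoint of the crossed side. -/
theorem Crossing.right_facts {f b : Circle} {e : Edge} (h : Crossing f b e) :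
    0 < e.height f ∧ Edge.height (e * ringTurn ^ 3) f < 0 ∧ e.height b < 0 ∧
      Edge.height (e * ringTurn ^ 1) b < 0 ∧
      (0 ≤ Edge.height (e * ringTurn ^ 3) b → Edge.height (e * ringTurn ^ 2) f < 0) ∧
      (0 ≤ Edge.height (e * ringTurn ^ 1) f → Edge.height (e * ringTurn ^ 2) b < 0) := by
  have a1 := h.half.pos
  have a2 := h.half.right
  have a3 := h.half.behind_right
  have c1 := h.half_rev.pos
  have c2 := h.half_rev.left
  have c3 := h.half_rev.behind_left
  rw [height_rot_neg_one] at a2 a3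
  rw [height_halfTurn] at c1
  have e1 : e * halfTurn * rot 1 = e * ringTurn ^ 1 := by rw [pow_one, ringTurn, mul_assoc]
  have e2 : e * halfTurn * rot 1 * halfTurn * rot 1 = e * ringTurn ^ 2 := by
    rw [sq, ringTurn]; simp only [mul_assoc]
  have e3 := mul_left_left e 0
  rw [pow_zero, mul_one] at e3
  rw [e1] at c2 c3
  rw [e2] at a3
  rw [e3, height_halfTurn, height_ring_add_four e 10, height_ring_add_four e 6,
    height_ring_add_four e 2] at c3
  exact ⟨a1, a2, by linarith, c2, a3, fun h' => by linarith [c3 h']⟩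

/-- The conditions at the left endpoint of the crossed side, when this is the right endpoint of the
side crossed by `e`. -/
theorem Crossing.left_facts {f b : Circle} {e : Edge} (h : Crossing f b (shift e 1)) :
    0 < Edge.height (e * ringTurn ^ 1) f ∧ 0 < Edge.height (e * ringTurn ^ 3) b ∧
      (Edge.height (e * ringTurn ^ 1) b ≤ 0 → 0 < Edge.height (e * ringTurn ^ 2) f) := by
  have a1 := h.half.left
  have a2 := h.half.behind_left
  have c1 := h.half_rev.right
  have e1 : e * ringTurn ^ 4 * halfTurn * rot 1 = e * ringTurn ^ 5 := by
    rw [pow_succ ringTurn 4, mul_assoc, mul_assoc, ← ringTurn]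
  have e3 : e * ringTurn ^ 4 * halfTurn * halfTurn * rot (-1) = e * ringTurn ^ 11 * halfTurn := by
    rw [rot_neg_one_eq]
    simp only [mul_assoc]
    rw [← mul_assoc halfTurn halfTurn, halfTurn_mul_self, one_mul, ← mul_assoc (ringTurn ^ 4),
      ← pow_add]
  rw [shift_one] at a1 a2 c1
  rw [e1, height_ring_add_four e 1] at a1 a2
  rw [mul_left_left, height_halfTurn, height_ring_add_four e 14, height_ring_add_four e 10,
    height_ring_add_four e 6, height_ring_add_four e 2] at a2
  rw [e3, height_halfTurn, height_ring_add_four e 7, height_ring_add_four e 3] at c1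
  exact ⟨by linarith, by linarith, fun h' => by linarith [a2 (by linarith)]⟩

/-- Neighbouring sides are where the removed wedges matter: at the shared vertex the first side
makes the height of `f` along `ringTurn ^ 2` negative, the second makes it positive. Sides further
apart already contradict `far_pos`. -/
theorem Crossing.eq_zero_of_shift {f b : Circle} {e : Edge} (h : Crossing f b e) {n : ℤ}
    (h' : Crossing f b (shift e n)) : n = 0 := by
  have key : ∀ {e : Edge} {n : ℕ}, Crossing f b e → Crossing f b (shift e (n + 1 : ℕ)) → False := by
    intro e n h h'
    obtain ⟨f0, f3, b0, b1, hb, hf⟩ := h.right_facts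
    rw [show ((n + 1 : ℕ) : ℤ) = n + 1 by push_cast; rfl, ← shift_shift] at h'
    obtain ⟨f1, b3, hbf⟩ := h'.left_facts
    rcases Nat.eq_zero_or_pos n with rfl | hn
    · rw [Nat.cast_zero, shift_zero] at f1 b3 hbf
      linarith [hb b3.le, hbf b1.le]
    · linarith [(h.frame.far_pos f f0 f3.le hn).1]
  rcases lt_trichotomy n 0 with hn | hn | hn
  · refine (key (n := (-n - 1).toNat) h' ?_).elim
    rw [shift_shift]
    convert h
    rw [show n + (((-n - 1).toNat + 1 : ℕ) : ℤ) = 0 by omega, shift_zero]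
  · exact hn
  · refine (key (n := (n - 1).toNat) h ?_).elim
    convert h' using 2
    omega

/-- If the corner is the right end of the crossed side, `k = 0` and `k = 3` contradict the
conditions on the adjacent sides, `k = 1` and `k = 2` those from the removed wedges. Other corners
are too far; those on the left follow by inversion. -/
theorem Crossing.false_of_full {f b : Circle} {e x : Edge} (h : Crossing f b e)
    (hx : Full f b x) {n : ℤ} {k : ℕ} (hk : k ≤ 3) (hek : x * ringTurn ^ k = shift e n) :
    False := by
  have key : ∀ {f b : Circle} {e x : Edge}, Crossing f b e → Full f b x → ∀ {n : ℕ},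
      x * ringTurn ^ k = shift e n → False := by
    intro f b e x h hx n hek
    obtain ⟨f0, f3, b0, b1, hb, hf⟩ := h.right_facts
    rcases Nat.eq_zero_or_pos n with rfl | hn
    · rw [Nat.cast_zero, shift_zero] at hek
      have l1 := hx.left_b
      have l2 := hx.right_f
      rw [← hek] at f3 b1 hb hf
      simp only [height_ring_pow_add] at f3 b1 hb hf
      have g0 := height_ring_four x b
      interval_cases k
      · norm_num at f3; linarith
      · norm_num at hb; linarith [hb (by linarith)]
      · norm_num at hf; linarith [hf (by linarith)]
      · norm_num at b1; linarith
    · exact hx.false_of_far h.frame f0 f3.le b0 b1.le hn hk hek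
  rcases le_or_gt 0 n with hn | hn
  · exact key h hx (n := n.toNat) (by rwa [Int.toNat_of_nonneg hn])
  · refine key h.symm hx.symm (n := (-n - 1).toNat) ?_
    rw [Int.toNat_of_nonneg (by omega), mul_assoc, ← pow_add, add_comm, pow_add, ← mul_assoc, hek,
      mul_ring_four, shift_shift, shift_mul_halfTurn]
    congr 1; ring

/-! ### Relations between right-most turns -/

theorem ringTurn_pow_inj {a b : ℕ} (h : ringTurn ^ a = ringTurn ^ b) : a % 8 = b % 8 := by
  let u : (Matrix (Fin 3) (Fin 3) ℝ)ˣ := ⟨ringTurn, ringTurn ^ 7,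
    by rw [← pow_succ', ringTurn_pow_eight], by rw [← pow_succ, ringTurn_pow_eight]⟩
  have h4 : ringTurn ^ 4 ≠ 1 := by
    intro h
    have := congrFun (congrFun h 2) 2
    rw [ringTurn_pow_four] at this
    simp at this
    have : (0 : ℝ) ≤ √2 := by positivity
    linarith
  have ho : orderOf ringTurn = 2 ^ (2 + 1) :=
    orderOf_eq_prime_pow (by simpa using h4) (by simpa using ringTurn_pow_eight)
  have hu : orderOf u = 8 := by
    rw [← orderOf_units]; simpa using ho
  have := pow_inj_mod.1 (Units.ext (by simpa using h) : u ^ a = u ^ b)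
  rwa [hu] at this

theorem ringTurn_pow_mod {a b : ℕ} (h : a % 8 = b % 8) : ringTurn ^ a = ringTurn ^ b := by
  rw [← Nat.div_add_mod a 8, ← Nat.div_add_mod b 8, h, pow_add, pow_add, pow_mul, pow_mul,
    ringTurn_pow_eight, one_pow, one_pow]

/-- Powers of `ringTurn` fix the right end of side `0`, the vector tested here; the conjugate moves
it. -/
theorem halfTurn_mul_ringTurn_mul_halfTurn_ne (c : ℕ) :
    halfTurn * ringTurn * halfTurn ≠ ringTurn ^ c := by
  intro h
  have h2 := sqrt_two_mul_self
  have hr := sR_mul_self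
  have hq : ringTurn.mulVec ![sR, -(sR * (√2 - 1)), 1 + √2] = ![sR, -(sR * (√2 - 1)), 1 + √2] := by
    rw [ringTurn_eq]
    ext i
    fin_cases i <;> simp [Matrix.mulVec, dotProduct, Fin.sum_univ_three] <;> grind
  have hqc : (ringTurn ^ c).mulVec ![sR, -(sR * (√2 - 1)), 1 + √2] =
      ![sR, -(sR * (√2 - 1)), 1 + √2] := by
    clear h
    induction c with
    | zero => simp
    | succ n ih => rw [pow_succ, ← Matrix.mulVec_mulVec, hq, ih]
  rw [← h, ringTurn, ← mul_assoc, halfTurn_mul_self, one_mul] at hqc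
  have h0 := congrFun hqc 0
  rw [rot_one, halfTurn_eq] at h0
  simp [Matrix.mulVec, dotProduct, Fin.sum_univ_three, Matrix.mul_apply] at h0
  have : sR * (√2 - 2) = 0 := by grind
  rcases mul_eq_zero.1 this with h | h
  · exact sR_pos.ne' h
  · have := sqrt_two_lt
    linarith

theorem ringTurn_pow_ne_conj {a b : ℕ} (ha : a % 2 = 1) :
    ringTurn ^ b ≠ halfTurn * ringTurn ^ a * halfTurn := by
  intro h
  have hconj : ∀ n : ℕ, (halfTurn * ringTurn ^ a * halfTurn) ^ n =
      halfTurn * ringTurn ^ (a * n) * halfTurn := by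
    intro n
    induction n with
    | zero => simp [halfTurn_mul_self]
    | succ n ih =>
      rw [pow_succ, ih, mul_add, mul_one, pow_add]
      simp only [mul_assoc]
      rw [← mul_assoc halfTurn halfTurn, halfTurn_mul_self, one_mul]
  have h1 := hconj a
  -- Odd squares are `1` modulo `8`, so the `a`-th power reduces the claim to the conjugate of
  -- `ringTurn` itself.
  rw [← h, ← pow_mul, ringTurn_pow_mod (a := a * a) (b := 1), pow_one] at h1
  · exact halfTurn_mul_ringTurn_mul_halfTurn_ne _ h1.symm
  · rw [Nat.mul_mod]
    have : a % 8 = 1 ∨ a % 8 = 3 ∨ a % 8 = 5 ∨ a % 8 = 7 := by omega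
    rcases this with h | h | h | h <;> rw [h]

theorem mul_halfTurn_mul_halfTurn (e : Edge) : e * halfTurn * halfTurn = e := by
  rw [mul_assoc, halfTurn_mul_self, mul_one]

theorem mul_halfTurn_inj {e e' : Edge} (h : e * halfTurn = e' * halfTurn) : e = e' := by
  rw [← mul_halfTurn_mul_halfTurn e, h, mul_halfTurn_mul_halfTurn]

theorem mul_ring_eq_iff {e e' : Edge} {a b : ℕ} (h : e * ringTurn ^ a = e' * ringTurn ^ b)
    {c : ℕ} (hc : (a + c) % 8 = 0) : e = e' * ringTurn ^ (b + c) := by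
  have := congrArg (fun M : Edge => M * ringTurn ^ c) h
  simp only [mul_assoc, ← pow_add] at this
  rwa [ringTurn_pow_mod (b := 0) (by omega), pow_zero, mul_one] at this

/-- Equality would make `halfTurn`, hence also its conjugate of `ringTurn`, a power of `ringTurn`.
-/
theorem IsNetFrame.ring_pair_ne {e : Edge} (he : IsNetFrame e) (j k : ℕ) :
    e * ringTurn ^ j ≠ e * ringTurn ^ k * halfTurn := by
  intro h
  rw [mul_assoc] at h
  have h1 := congrArg (fun M : Edge => ringTurn ^ (7 * k) * M) (he.mul_left_cancel h)
  simp only [← mul_assoc, ← pow_add] at h1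
  rw [ringTurn_pow_mod (a := 7 * k + k) (b := 0) (by omega), pow_zero, one_mul] at h1
  refine halfTurn_mul_ringTurn_mul_halfTurn_ne (7 * k + j + 1 + (7 * k + j)) ?_
  rw [← h1, ← pow_succ, ← pow_add]

/-- The edges of a step with two edges determine the step. -/
theorem IsNetFrame.ring_pair_inj {e e' : Edge} (he : IsNetFrame e) {j k : ℕ} (hj : j ≤ 3)
    (hk : k ≤ 3) (h : ∀ x : Edge, x = e * ringTurn ^ j ∨ x = e * ringTurn ^ (7 - j) * halfTurn ↔
      x = e' * ringTurn ^ k ∨ x = e' * ringTurn ^ (7 - k) * halfTurn) : j = k ∧ e = e' := by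
  have h1 := (h _).1 (Or.inl rfl)
  have h2 := (h _).1 (Or.inr rfl)
  -- Matching left with right edges would identify a power of `ringTurn` with the conjugate of the
  -- odd power `2 * k + 1`.
  have cross : ∀ {e e' : Edge} {j k : ℕ}, IsNetFrame e → j ≤ 3 → k ≤ 3 →
      e * ringTurn ^ j = e' * ringTurn ^ (7 - k) * halfTurn →
      e * ringTurn ^ (7 - j) * halfTurn = e' * ringTurn ^ k → False := by
    intro e e' j k he hj hk a b
    have a' : e' * ringTurn ^ (7 - k) = e * ringTurn ^ j * halfTurn := by
      rw [a, mul_halfTurn_mul_halfTurn]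
    have a2 := congrArg (fun M : Edge => M * ringTurn ^ (k + 1)) a'
    simp only [mul_assoc, ← pow_add] at a2
    rw [show 7 - k + (k + 1) = 8 by omega, ringTurn_pow_eight, mul_one] at a2
    rw [a2, mul_assoc, mul_assoc] at b
    have b' := he.mul_left_cancel b
    have b2 := congrArg (fun M : Edge => ringTurn ^ (8 - j) * M * halfTurn) b'
    simp only [mul_assoc, halfTurn_mul_self, mul_one, ← pow_add] at b2
    rw [← mul_assoc (ringTurn ^ (8 - j)), ← pow_add,
      show 8 - j + j = 8 by omega, ringTurn_pow_eight, one_mul, ← mul_assoc] at b2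
    exact ringTurn_pow_ne_conj (by omega) b2
  have ne := he.ring_pair_ne j (7 - j)
  rcases h1 with h1 | h1
  · have h2 := h2.resolve_left fun h => ne (h1.trans h.symm)
    have e1 := mul_ring_eq_iff h1.symm (c := 8 - k) (by omega)
    have e2 := mul_halfTurn_inj h2
    rw [e1, mul_assoc, ← pow_add] at e2
    have e3 := ringTurn_pow_inj (he.mul_left_cancel e2)
    have hjk : j = k := by omega
    refine ⟨hjk, ?_⟩
    rw [e1, ringTurn_pow_mod (b := 0) (by omega), pow_zero, mul_one]
  · have h2 := h2.resolve_right fun h => ne (h1.trans h.symm)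
    exact (cross he hj hk h1 h2).elim

open Edge

/-! ### Edges and regions of steps -/

/-- The kinds of steps with a single edge. -/
def Kind.IsSingle : Kind → Prop
  | .A | .ApL | .ApR | .AppL | .AppR => True
  | _ => False

theorem right_eq (e : Edge) : e.right = e * ringTurn ^ 1 := by
  rw [pow_one, ringTurn, ← mul_assoc]; rfl

theorem right_ring (e : Edge) (k : ℕ) : Edge.right (e * ringTurn ^ k) = e * ringTurn ^ (k + 1) := by
  rw [right_eq, mul_assoc, ← pow_add]

theorem spin_neg_one_eq (e : Edge) : e.spin (-1) = e * ringTurn ^ 7 * halfTurn := by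
  rw [mul_assoc, ← rot_neg_one_eq]; rfl

theorem left_ring (e : Edge) (k : ℕ) :
    Edge.left (e * ringTurn ^ (k + 1) * halfTurn) = e * ringTurn ^ k * halfTurn := by
  change e * ringTurn ^ (k + 1) * halfTurn * halfTurn * rot (-1) = _
  rw [mul_halfTurn_mul_halfTurn, rot_neg_one_eq, ← mul_assoc, mul_assoc e, ← pow_add,
    ringTurn_pow_mod (a := k + 1 + 7) (b := k) (by omega)]

theorem edges_B (e : Edge) : (⟨.B, e⟩ : Step).edges =
    [e * ringTurn ^ 0, e * ringTurn ^ (7 - 0) * halfTurn] := by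
  rw [Step.edges, spin_neg_one_eq, pow_zero, mul_one]

theorem edges_C (e : Edge) : (⟨.C, e⟩ : Step).edges =
    [e * ringTurn ^ 1, e * ringTurn ^ (7 - 1) * halfTurn] := by
  rw [Step.edges, spin_neg_one_eq, right_eq, left_ring e 6]

theorem edges_Cp (e : Edge) : (⟨.Cp, e⟩ : Step).edges =
    [e * ringTurn ^ 2, e * ringTurn ^ (7 - 2) * halfTurn] := by
  rw [Step.edges, spin_neg_one_eq, right_eq e, right_ring, left_ring e 6, left_ring e 5]

theorem edges_D (e : Edge) : (⟨.D, e⟩ : Step).edges =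
    [e * ringTurn ^ 3, e * ringTurn ^ (7 - 3) * halfTurn] := by
  rw [Step.edges, spin_neg_one_eq, right_eq e, right_ring, right_ring, left_ring e 6, left_ring e 5,
    left_ring e 4]

theorem base_EL (e : Edge) : e.right.right.right.spin 1 = e * ringTurn ^ 3 * rot 1 := by
  rw [right_eq e, right_ring, right_ring]; rfl

theorem base_ER (e : Edge) : (e.spin (-1)).left.left.left = e * ringTurn ^ 4 * halfTurn := by
  rw [spin_neg_one_eq, left_ring e 6, left_ring e 5, left_ring e 4]

theorem edges_EL (e : Edge) : (⟨.EL, e⟩ : Step).edges =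
    [e, e * rot (-1), e * (rot (-1) * halfTurn * rot 1 * halfTurn)] := by
  simp only [← mul_assoc]; rfl

theorem edges_ER (e : Edge) : (⟨.ER, e⟩ : Step).edges =
    [e * (halfTurn * rot (-1) * halfTurn), e, e * rot (-1)] := by
  simp only [← mul_assoc]; rfl

theorem edges_of_isSingle {s : Step} (hs : s.kind.IsSingle) : s.edges = [s.base] := by
  obtain ⟨k, e⟩ := s
  cases k <;> first | rfl | exact hs.elim

/-- The last column holds the coordinates of the start of the third edge relative to the base. Its
last entry exceeds `1`, so this edge starts elsewhere than the other two; its middle entry tells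
right from left. -/
theorem third_EL_apply : (rot (-1) * halfTurn * rot 1 * halfTurn) 1 2 < 0 ∧
    1 < (rot (-1) * halfTurn * rot 1 * halfTurn) 2 2 := by
  have h2 := sqrt_two_mul_self
  have hr := sR_mul_self
  have hs := sR_pos
  have h : (0 : ℝ) < √2 := by positivity
  have e1 : (rot (-1) * halfTurn * rot 1 * halfTurn) 1 2 = -(6 * sR + 5 * √2 * sR) := by
    simp [rot_one, rot_neg_one, halfTurn_eq, Matrix.mul_apply, Fin.sum_univ_three]
    grind
  have e2 : (rot (-1) * halfTurn * rot 1 * halfTurn) 2 2 = 17 + 12 * √2 := by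
    simp [rot_one, rot_neg_one, halfTurn_eq, Matrix.mul_apply, Fin.sum_univ_three]
    grind
  rw [e1, e2]
  constructor
  · have : 0 < 6 * sR + 5 * √2 * sR := by positivity
    linarith
  · linarith

theorem third_ER_apply : 0 < (halfTurn * rot (-1) * halfTurn) 1 2 ∧
    1 < (halfTurn * rot (-1) * halfTurn) 2 2 := by
  have h2 := sqrt_two_mul_self
  have hr := sR_mul_self
  have hs := sR_pos
  have h : (0 : ℝ) < √2 := by positivity
  have e1 : (halfTurn * rot (-1) * halfTurn) 1 2 = 2 * sR + √2 * sR := by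
    simp [rot_neg_one, halfTurn_eq, Matrix.mul_apply, Fin.sum_univ_three]
    grind
  have e2 : (halfTurn * rot (-1) * halfTurn) 2 2 = 17 + 12 * √2 := by
    simp [rot_neg_one, halfTurn_eq, Matrix.mul_apply, Fin.sum_univ_three]
    grind
  rw [e1, e2]
  exact ⟨by positivity, by linarith⟩

theorem rot_apply_two_two (k : ℤ) : rot k 2 2 = 1 := by simp [rot]

theorem rot_neg_one_ne_one : rot (-1) ≠ 1 := by
  intro h
  have := congrFun (congrFun h 0) 1
  simp [rot_neg_one] at this

/-- A point lies beyond the side crossed by `e`, but not beyond the two adjacent sides. -/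
structure OnlyBeyond (e : Edge) (z : ℂ) : Prop where
  pos : 0 < e.height z
  right : Edge.height (e * rot (-1)) z < 0
  left : Edge.height (e * rot 1) z < 0

theorem pos_of_sqrt_two_mul {x : ℝ} (h : 0 < √2 * x) : 0 < x :=
  (mul_pos_iff_of_pos_left (by positivity)).1 h

/-- The relations between the heights at the right endpoint of a side. -/
theorem right_relations (e : Edge) (z : ℂ) :
    Edge.height (e * rot (-1)) z = Edge.height (e * ringTurn ^ 3) z ∧
    e.right.height z = Edge.height (e * ringTurn ^ 3) z + √2 * e.height z ∧
    e.right.right.height z = √2 * Edge.height (e * ringTurn ^ 3) z + e.height z := by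
  rw [right_eq, right_ring, height_rot_neg_one, height_ring_one, height_ring_two]
  exact ⟨rfl, rfl, rfl⟩

/-- The relations between the heights at the left endpoint of a side. -/
theorem left_relations (e : Edge) (z : ℂ) :
    e.left.height z = Edge.height (e * rot 1) z + √2 * e.height z ∧
    e.left.left.height z = √2 * Edge.height (e * rot 1) z + e.height z := by
  have h2 := sqrt_two_mul_self
  obtain ⟨y, rfl⟩ : ∃ y : Edge, e = y * ringTurn ^ 4 * halfTurn := ⟨e * halfTurn * ringTurn ^ 4, by
    rw [mul_assoc (e * halfTurn), ← pow_add, ringTurn_pow_eight, mul_one,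
      mul_halfTurn_mul_halfTurn]⟩
  have e1 : y * ringTurn ^ 4 * halfTurn * rot 1 = y * ringTurn ^ 5 := by
    rw [pow_succ ringTurn 4, mul_assoc, mul_assoc, ← ringTurn]
  rw [left_ring y 3, left_ring y 2, e1]
  simp only [height_halfTurn, height_ring_add_four y 1, height_ring_four]
  rw [height_ring_one, height_ring_two]
  constructor <;> grind

/-- Removing wedges only shrinks a region of type `A`: by the relations at the apex, positive height
for `e` and negative height for an inner geodesic force negative height for the adjacent side. -/
theorem onlyBeyond_of_mem_region {s : Step} (hs : s.kind.IsSingle) {z : ℂ} (hz : z ∈ s.region) :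
    OnlyBeyond s.base z := by
  obtain ⟨k, e⟩ := s
  have h2 := sqrt_two_mul_self
  have hpos : 0 < √2 := by positivity
  obtain ⟨r0, r1, r2⟩ := right_relations e z
  obtain ⟨l1, l2⟩ := left_relations e z
  cases k <;> first | exact hs.elim | skip
  · exact ⟨hz.2.1, hz.2.2.2, hz.2.2.1⟩
  · refine ⟨hz.2.1, hz.2.2.2, ?_⟩
    have := hz.2.1
    have := hz.2.2.1
    rw [l2] at this
    change Edge.height (e * rot 1) z < 0
    exact neg_pos.1 (pos_of_sqrt_two_mul (by linarith))
  · refine ⟨hz.2.1, ?_, hz.2.2.1⟩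
    have := hz.2.1
    have := hz.2.2.2
    rw [r2] at this
    change Edge.height (e * rot (-1)) z < 0
    rw [r0]
    exact neg_pos.1 (pos_of_sqrt_two_mul (by linarith))
  · refine ⟨hz.2.1, hz.2.2.2, ?_⟩
    have := mul_pos hpos hz.2.1
    have := hz.2.2.1
    rw [l1] at this
    change Edge.height (e * rot 1) z < 0
    linarith
  · refine ⟨hz.2.1, ?_, hz.2.2.1⟩
    have := mul_pos hpos hz.2.1
    have := hz.2.2.2
    rw [r1] at this
    change Edge.height (e * rot (-1)) z < 0
    rw [r0]
    linarith

theorem right_right_neg_of_mem_region {s : Step} (hs : s.kind = .ApR ∨ s.kind = .AppR) {z : ℂ}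
    (hz : z ∈ s.region) : s.base.right.right.height z < 0 := by
  obtain ⟨k, e⟩ := s
  rcases hs with rfl | rfl
  · exact hz.2.2.2
  · have h2 := sqrt_two_mul_self
    have hpos : 0 < √2 := by positivity
    obtain ⟨r0, r1, r2⟩ := right_relations e z
    have h0 : 0 < e.height z := hz.2.1
    have h1 : e.right.height z < 0 := hz.2.2.2
    change e.right.right.height z < 0
    have : e.right.right.height z = √2 * e.right.height z - e.height z := by grind
    rw [this]
    linarith [mul_neg_of_pos_of_neg hpos h1]

theorem left_left_neg_of_mem_region {s : Step} (hs : s.kind = .ApL ∨ s.kind = .AppL) {z : ℂ}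
    (hz : z ∈ s.region) : s.base.left.left.height z < 0 := by
  obtain ⟨k, e⟩ := s
  rcases hs with rfl | rfl
  · exact hz.2.2.1
  · have h2 := sqrt_two_mul_self
    have hpos : 0 < √2 := by positivity
    obtain ⟨l1, l2⟩ := left_relations e z
    have h0 : 0 < e.height z := hz.2.1
    have h1 : e.left.height z < 0 := hz.2.2.1
    change e.left.left.height z < 0
    have : e.left.left.height z = √2 * e.left.height z - e.height z := by grind
    rw [this]
    linarith [mul_neg_of_pos_of_neg hpos h1]

theorem wedge_nonneg {e : Edge} {z : ℂ} (hz : z ∈ Step.wedge e) :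
    0 ≤ e.height z ∧ 0 ≤ Edge.height (e * ringTurn ^ 3) z ∧
    0 ≤ Edge.height (e * ringTurn ^ 1) z ∧ 0 ≤ Edge.height (e * ringTurn ^ 2) z := by
  have h0 : 0 ≤ e.height z := hz.2.1
  have h3 : 0 ≤ Edge.height (e * rot (-1)) z := hz.2.2
  rw [height_rot_neg_one] at h3
  have hpos : 0 < √2 := by positivity
  have := mul_nonneg hpos.le h0
  have := mul_nonneg hpos.le h3
  rw [height_ring_one, height_ring_two]
  exact ⟨h0, h3, by linarith, by linarith⟩

theorem wedge_of_mem_region {s : Step} (hs : ¬ s.kind.IsSingle) {z : ℂ} (hz : z ∈ s.region) :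
    z ∈ Step.wedge s.base := by
  obtain ⟨k, e⟩ := s
  cases k <;> first | exact hz | exact (hs trivial).elim | skip
  exact ⟨hz.1.1, hz.1.2.1.le, hz.1.2.2.le⟩

/-- Edges around a corner cross the four geodesics through it, all of which have the wedge on their
positive side. The third edge of a step `E` needs `not_far`. -/
theorem height_nonneg_of_mem_region {s : Step} (hs : IsNetFrame s.base) {z : Circle}
    (hz : (z : ℂ) ∈ s.region) {x : Edge} (hx : x ∈ s.edges) : 0 ≤ x.height z := by
  by_cases h : s.kind.IsSingle
  · rw [edges_of_isSingle h, List.mem_singleton] at hx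
    rw [hx]; exact (onlyBeyond_of_mem_region h hz).pos.le
  obtain ⟨h0, h3, h1, h2⟩ := wedge_nonneg (wedge_of_mem_region h hz)
  obtain ⟨k, e⟩ := s
  have h4 := fun j => height_ring_add_four e j z
  have h7 := height_ring_add_four e 3 z
  cases k <;> first | exact (h trivial).elim | skip
  · rw [edges_B] at hx
    simp only [List.mem_cons, List.not_mem_nil, or_false] at hx
    rcases hx with rfl | rfl
    · simpa using h0
    · rw [height_halfTurn, h4 3, neg_neg]; exact h3
  · rw [edges_C] at hx
    simp only [List.mem_cons, List.not_mem_nil, or_false] at hx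
    rcases hx with rfl | rfl
    · exact h1
    · rw [height_halfTurn, h4 2, neg_neg]; exact h2
  · rw [edges_Cp] at hx
    simp only [List.mem_cons, List.not_mem_nil, or_false] at hx
    rcases hx with rfl | rfl
    · exact h2
    · rw [height_halfTurn, h4 1, neg_neg]; exact h1
  · rw [edges_D] at hx
    simp only [List.mem_cons, List.not_mem_nil, or_false] at hx
    rcases hx with rfl | rfl
    · exact h3
    · rw [height_halfTurn, h4 0, neg_neg]; simpa using h0
  · rw [edges_EL] at hx
    simp only [List.mem_cons, List.not_mem_nil, or_false] at hx
    rcases hx with rfl | rfl | rfl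
    · exact h0
    · rw [height_rot_neg_one]; exact h3
    · rw [← mul_assoc, height_halfTurn, ← mul_assoc, ← mul_assoc]
      by_contra! hcon
      refine (hs.mul_rot (-1)).mul_halfTurn.not_far z (j := -1) (k := 1) ?_ (by linarith)
        (by norm_num) (by norm_num)
      change 0 ≤ Edge.height (Edge.left (e.spin (-1))) z
      rw [spin_neg_one_eq, left_ring e 6, height_halfTurn, h4 2, neg_neg]
      exact h2
  · rw [edges_ER] at hx
    simp only [List.mem_cons, List.not_mem_nil, or_false] at hx
    rcases hx with rfl | rfl | rfl
    · rw [← mul_assoc, height_halfTurn, ← mul_assoc]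
      by_contra! hcon
      refine hs.mul_halfTurn.not_far z (j := -1) (k := 1) (by linarith) ?_
        (by norm_num) (by norm_num)
      rw [mul_assoc, ← ringTurn, ← pow_one ringTurn]
      exact h1
    · exact h0
    · rw [height_rot_neg_one]; exact h3

/-! ### Successors -/

/-- The kind of the single edge that follows a single edge with a right-most turn. -/
def Kind.afterRight : Kind → Kind
  | .ApR => .AppR
  | _ => .ApR

/-- The kind of the single edge that follows a single edge with a left-most turn. -/
def Kind.afterLeft : Kind → Kind
  | .ApL => .AppL
  | _ => .ApL

/-- The kind of the single edge that follows a single edge, `k` places from its reverse. -/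
def Kind.turn (K : Kind) (k : ℤ) : Kind :=
  if k = 1 then K.afterRight else if k = 7 then K.afterLeft else .A

/-- The kind of the single edge that follows a step `D`, `k` places from the reverse of its left
edge. -/
def turnD (k : ℤ) : Kind := if k = 2 then .ApR else if k = 7 then .ApL else .A

theorem Kind.isSingle_turn (K : Kind) (k : ℤ) : (K.turn k).IsSingle := by
  unfold Kind.turn
  split_ifs <;> cases K <;> trivial

theorem isSingle_turnD (k : ℤ) : (turnD k).IsSingle := by
  unfold turnD
  split_ifs <;> trivial

theorem mem_pieces {K : ℤ → Kind} {y : Edge} {l l' : List ℤ} {t : Step}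
    (ht : t ∈ l.map (fun k => (⟨K k, y * rot k⟩ : Step)) ++
      l'.map (fun k => (⟨.B, y * rot k⟩ : Step))) :
    (∃ k ∈ l, t = ⟨K k, y * rot k⟩) ∨ ∃ k ∈ l', t = ⟨.B, y * rot k⟩ := by
  rw [List.mem_append, List.mem_map, List.mem_map] at ht
  exact ht.imp (fun ⟨k, h, h'⟩ => ⟨k, h, h'.symm⟩) (fun ⟨k, h, h'⟩ => ⟨k, h, h'.symm⟩)

theorem succ_of_isSingle {s t : Step} (hs : s.kind.IsSingle) (ht : t ∈ s.successors) :
    (∃ k : ℤ, 1 ≤ k ∧ k ≤ 7 ∧ (s.kind = .AppR → k ≠ 1) ∧ (s.kind = .AppL → k ≠ 7) ∧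
      t = ⟨s.kind.turn k, s.base * halfTurn * rot k⟩) ∨
    ∃ k : ℤ, 2 ≤ k ∧ k ≤ 7 ∧ t = ⟨.B, s.base * halfTurn * rot k⟩ := by
  suffices h : ∃ l l' : List ℤ, (∀ k ∈ l, 1 ≤ k ∧ k ≤ 7) ∧ (∀ k ∈ l', 2 ≤ k ∧ k ≤ 7) ∧
      (s.kind = .AppR → 1 ∉ l) ∧ (s.kind = .AppL → 7 ∉ l) ∧
      s.successors = l.map (fun k => (⟨s.kind.turn k, s.base * halfTurn * rot k⟩ : Step)) ++
        l'.map (fun k => (⟨.B, s.base * halfTurn * rot k⟩ : Step)) by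
    obtain ⟨l, l', h1, h2, hR, hL, h3⟩ := h
    rw [h3] at ht
    exact (mem_pieces ht).imp (fun ⟨k, h, h'⟩ => ⟨k, (h1 k h).1, (h1 k h).2,
      fun hs hk => hR hs (hk ▸ h), fun hs hk => hL hs (hk ▸ h), h'⟩)
      (fun ⟨k, h, h'⟩ => ⟨k, (h2 k h).1, (h2 k h).2, h'⟩)
  obtain ⟨K, e⟩ := s
  cases K <;> first | exact hs.elim | skip
  · exact ⟨[1, 2, 3, 4, 5, 6, 7], [2, 3, 4, 5, 6, 7], by decide, by decide, by simp, by simp, rfl⟩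
  · exact ⟨[1, 2, 3, 4, 5, 6, 7], [2, 3, 4, 5, 6, 7], by decide, by decide, by simp, by simp, rfl⟩
  · exact ⟨[1, 2, 3, 4, 5, 6, 7], [2, 3, 4, 5, 6, 7], by decide, by decide, by simp, by simp, rfl⟩
  · exact ⟨[1, 2, 3, 4, 5, 6], [2, 3, 4, 5, 6], by decide, by decide, by simp, by simp, rfl⟩
  · exact ⟨[2, 3, 4, 5, 6, 7], [3, 4, 5, 6, 7], by decide, by decide, by simp, by simp, rfl⟩

theorem left_edge_D (e : Edge) : e.right.right.right = e * ringTurn ^ 3 := by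
  rw [right_eq e, right_ring, right_ring]

theorem succ_of_D {e : Edge} {t : Step} (ht : t ∈ (⟨.D, e⟩ : Step).successors) :
    (∃ k : ℤ, 2 ≤ k ∧ k ≤ 7 ∧ t = ⟨turnD k, e * ringTurn ^ 3 * halfTurn * rot k⟩) ∨
    ∃ k : ℤ, 3 ≤ k ∧ k ≤ 7 ∧ t = ⟨.B, e * ringTurn ^ 3 * halfTurn * rot k⟩ := by
  rw [← left_edge_D]
  have h : (⟨.D, e⟩ : Step).successors =
      [2, 3, 4, 5, 6, 7].map (fun k => ⟨turnD k, e.right.right.right * halfTurn * rot k⟩) ++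
      [3, 4, 5, 6, 7].map (fun k => ⟨.B, e.right.right.right * halfTurn * rot k⟩) := rfl
  rw [h] at ht
  have h1 : ∀ k ∈ ([2, 3, 4, 5, 6, 7] : List ℤ), 2 ≤ k ∧ k ≤ 7 := by decide
  have h2 : ∀ k ∈ ([3, 4, 5, 6, 7] : List ℤ), 3 ≤ k ∧ k ≤ 7 := by decide
  exact (mem_pieces ht).imp (fun ⟨k, h, h'⟩ => ⟨k, (h1 k h).1, (h1 k h).2, h'⟩)
    (fun ⟨k, h, h'⟩ => ⟨k, (h2 k h).1, (h2 k h).2, h'⟩)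

theorem succ_of_Cp {e : Edge} {t : Step} (ht : t ∈ (⟨.Cp, e⟩ : Step).successors) :
    t = ⟨.D, e⟩ ∨ t = ⟨.EL, e * ringTurn ^ 3 * rot 1⟩ ∨
      t = ⟨.ER, e * ringTurn ^ 4 * halfTurn⟩ := by
  simpa only [Step.successors, List.mem_cons, List.not_mem_nil, or_false, base_EL, base_ER] using ht

theorem succ_of_ring {s t : Step} (hs : ¬ s.kind.IsSingle) (ht : t ∈ s.successors) :
    (s.kind = .B ∨ s.kind = .EL ∨ s.kind = .ER) ∧ t = ⟨.C, s.base⟩ ∨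
    s.kind = .C ∧ t = ⟨.Cp, s.base⟩ ∨ s.kind = .Cp ∨ s.kind = .D := by
  obtain ⟨K, e⟩ := s
  cases K <;> first
    | exact (hs trivial).elim
    | (simp [Step.successors] at ht; simp [ht])

/-! ### Similar steps, and disjointness of the pieces of a region. -/

/-- Two steps agree up to the number of removed wedges. -/
def Sim (s t : Step) : Prop :=
  s.base = t.base ∧ (s.kind = t.kind ∨ s.kind.IsSingle ∧ t.kind.IsSingle)

theorem Sim.symm {s t : Step} (h : Sim s t) : Sim t s :=
  ⟨h.1.symm, h.2.imp Eq.symm And.symm⟩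

theorem Sim.of_eq {s t : Step} (h : s = t) : Sim s t := h ▸ ⟨rfl, Or.inl rfl⟩

theorem Sim.isSingle {s t : Step} (h : Sim s t) (hs : s.kind.IsSingle) : t.kind.IsSingle :=
  h.2.elim (fun h => h ▸ hs) And.right

theorem Sim.eq {s t : Step} (h : Sim s t) (hs : ¬ s.kind.IsSingle) : s = t := by
  obtain ⟨K, e⟩ := s
  obtain ⟨K', e'⟩ := t
  obtain ⟨h1, h2⟩ := h
  have h3 := h2.resolve_right fun h => hs h.1
  simp only at h1 h3
  rw [h1, h3]

theorem Sim.edges {s t : Step} (h : Sim s t) : s.edges = t.edges := by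
  by_cases hs : s.kind.IsSingle
  · rw [edges_of_isSingle hs, edges_of_isSingle (h.isSingle hs), h.1]
  · rw [h.eq hs]

/-- The step `t` is a single edge, or a step `B`, that leaves an octagon across its `k`-th side. -/
structure IsPiece (y : Edge) (k : ℤ) (t : Step) : Prop where
  base : t.base = y * rot k
  kind : t.kind.IsSingle ∨ t.kind = .B
  lower : 1 ≤ k
  upper : k ≤ 7
  lower_B : t.kind = .B → 2 ≤ k

/-- A point at infinity is beyond at most two sides of an octagon, and these are adjacent. One side
determines a single edge, two determine a step `B`. -/
theorem IsPiece.sim {y : Edge} (hy : IsNetFrame y) {k k' : ℤ} {t t' : Step} (h : IsPiece y k t)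
    (h' : IsPiece y k' t') {z : Circle} (hz : (z : ℂ) ∈ t.region) (hz' : (z : ℂ) ∈ t'.region) :
    Sim t t' := by
  have single : ∀ {k : ℤ} {t : Step}, IsPiece y k t → t.kind.IsSingle → (z : ℂ) ∈ t.region →
      0 < Edge.height (y * rot k) z ∧ Edge.height (y * rot (k - 1)) z < 0 ∧
        Edge.height (y * rot (k + 1)) z < 0 := by
    intro k t h ht hz
    have := onlyBeyond_of_mem_region ht hz
    rw [h.base] at this
    refine ⟨this.pos, ?_, ?_⟩
    · have := this.right
      rwa [mul_assoc, rot_mul] at this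
    · have := this.left
      rwa [mul_assoc, rot_mul] at this
  have double : ∀ {k : ℤ} {t : Step}, IsPiece y k t → t.kind = .B → (z : ℂ) ∈ t.region →
      0 ≤ Edge.height (y * rot k) z ∧ 0 ≤ Edge.height (y * rot (k - 1)) z := by
    intro k t h ht hz
    have := wedge_of_mem_region (by rw [ht]; exact id) hz
    rw [h.base] at this
    refine ⟨this.2.1, ?_⟩
    have := this.2.2
    change 0 ≤ Edge.height (y * rot k * rot (-1)) z at this
    rwa [mul_assoc, rot_mul] at this
  have far : ∀ {i j : ℤ}, 0 ≤ Edge.height (y * rot i) z → 0 ≤ Edge.height (y * rot j) z →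
      0 ≤ i → i ≤ 7 → 0 ≤ j → j ≤ 7 → i = j ∨ i = j + 1 ∨ j = i + 1 ∨ i = j + 7 ∨ j = i + 7 := by
    intro i j hi hj _ _ _ _
    by_contra hcon
    exact hy.not_far z hi hj (by omega) (by omega)
  have mixed : ∀ {k k' : ℤ} {t t' : Step}, IsPiece y k t → IsPiece y k' t' → t.kind.IsSingle →
      t'.kind = .B → (z : ℂ) ∈ t.region → (z : ℂ) ∈ t'.region → False := by
    intro k k' t t' h h' ht ht' hz hz'
    obtain ⟨a1, a2, a3⟩ := single h ht hz
    obtain ⟨b1, b2⟩ := double h' ht' hz'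
    have := h.lower
    have := h.upper
    have := h'.lower_B ht'
    have := h'.upper
    have c1 := far a1.le b1 (by omega) (by omega) (by omega) (by omega)
    have c2 := far a1.le b2 (by omega) (by omega) (by omega) (by omega)
    have : k' = k ∨ k' = k + 1 := by omega
    rcases this with rfl | rfl <;> linarith
  have hl := h.lower
  have hu := h.upper
  have hl' := h'.lower
  have hu' := h'.upper
  rcases h.kind with ht | ht <;> rcases h'.kind with ht' | ht'
  · obtain ⟨a1, a2, a3⟩ := single h ht hz
    obtain ⟨b1, b2, b3⟩ := single h' ht' hz'
    have c1 := far a1.le b1.le (by omega) (by omega) (by omega) (by omega)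
    have : k' = k := by
      by_contra hne
      have : k' = k + 1 ∨ k' = k - 1 := by omega
      rcases this with rfl | rfl <;> linarith
    exact ⟨by rw [h.base, h'.base, this], Or.inr ⟨ht, ht'⟩⟩
  · exact (mixed h h' ht ht' hz hz').elim
  · exact (mixed h' h ht' ht hz' hz).elim
  · obtain ⟨a1, a2⟩ := double h ht hz
    obtain ⟨b1, b2⟩ := double h' ht' hz'
    have := h.lower_B ht
    have := h'.lower_B ht'
    have c1 := far a1 b1 (by omega) (by omega) (by omega) (by omega)
    have c2 := far a1 b2 (by omega) (by omega) (by omega) (by omega)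
    have c3 := far a2 b1 (by omega) (by omega) (by omega) (by omega)
    have : k' = k := by omega
    exact ⟨by rw [h.base, h'.base, this], Or.inl (by rw [ht, ht'])⟩

theorem isPiece_of_isSingle {s t : Step} (hs : s.kind.IsSingle) (ht : t ∈ s.successors) :
    ∃ k, IsPiece (s.base * halfTurn) k t := by
  rcases succ_of_isSingle hs ht with ⟨k, h1, h2, -, -, rfl⟩ | ⟨k, h1, h2, rfl⟩
  · have := Kind.isSingle_turn s.kind k
    exact ⟨k, rfl, Or.inl this, h1, h2, fun h => by
      change s.kind.turn k = .B at h
      rw [h] at this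
      exact this.elim⟩
  · exact ⟨k, rfl, Or.inr rfl, by omega, h2, fun _ => h1⟩

theorem isPiece_of_D {e : Edge} {t : Step} (ht : t ∈ (⟨.D, e⟩ : Step).successors) :
    ∃ k, IsPiece (e * ringTurn ^ 3 * halfTurn) k t := by
  rcases succ_of_D ht with ⟨k, h1, h2, rfl⟩ | ⟨k, h1, h2, rfl⟩
  · exact ⟨k, rfl, Or.inl (isSingle_turnD k), by omega, h2, fun _ => h1⟩
  · exact ⟨k, rfl, Or.inr rfl, by omega, h2, fun _ => by omega⟩

/-- The wedges lie beyond sides `-1` and `2`, counted from the reverse of the left edge of `D`, of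
the octagon entered by `D`; these are three places apart. -/
theorem wedge_EL_disjoint_wedge_ER {e : Edge} (he : IsNetFrame e) {z : Circle}
    (h : (z : ℂ) ∈ Step.wedge (e * ringTurn ^ 3 * rot 1))
    (h' : (z : ℂ) ∈ Step.wedge (e * ringTurn ^ 4 * halfTurn)) : False := by
  obtain ⟨-, -, -, h2⟩ := wedge_nonneg h
  obtain ⟨-, -, h1, -⟩ := wedge_nonneg h'
  refine (he.mul_ring 3).mul_halfTurn.not_far z (j := -1) (k := 2) ?_ ?_ (by norm_num)
    (by norm_num)
  · have e1 : e * ringTurn ^ 3 * halfTurn * rot (-1) =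
        e * ringTurn ^ 3 * rot 1 * ringTurn ^ 6 * halfTurn := by
      have := left_ring (e * ringTurn ^ 3 * rot 1) 6
      rw [← this, mul_assoc (e * ringTurn ^ 3 * rot 1), ← rot_neg_one_eq, mul_assoc _ (rot 1),
        rot_mul, add_neg_cancel, rot_zero, mul_one]
      rfl
    rw [e1, height_halfTurn, height_ring_add_four _ 2, neg_neg]
    exact h2
  · have e2 : e * ringTurn ^ 4 * halfTurn * ringTurn ^ 1 =
        e * ringTurn ^ 3 * halfTurn * rot 2 := by
      rw [← right_eq]
      change e * ringTurn ^ 4 * halfTurn * halfTurn * rot 1 = _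
      rw [mul_halfTurn_mul_halfTurn, pow_succ ringTurn 3, show (2 : ℤ) = 1 + 1 by norm_num,
        ← rot_mul, ← mul_assoc, ← mul_assoc]
      nth_rewrite 2 [ringTurn]
      rw [← mul_assoc]
    rwa [e2] at h1

/-- The step that follows a given one is determined by a point at infinity of its region. -/
theorem Sim.succ {s s' t t' : Step} (h : Sim s s') (hs : IsNetFrame s.base)
    (ht : t ∈ s.successors) (ht' : t' ∈ s'.successors) {z : Circle} (hz : (z : ℂ) ∈ t.region)
    (hz' : (z : ℂ) ∈ t'.region) : Sim t t' := by
  by_cases h1 : s.kind.IsSingle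
  · obtain ⟨k, hk⟩ := isPiece_of_isSingle h1 ht
    obtain ⟨k', hk'⟩ := isPiece_of_isSingle (h.isSingle h1) ht'
    rw [← h.1] at hk'
    exact hk.sim hs.mul_halfTurn hk' hz hz'
  obtain rfl := h.eq h1
  rcases succ_of_ring h1 ht with ⟨h2, rfl⟩ | ⟨h2, rfl⟩ | h2 | h2
  · rcases succ_of_ring h1 ht' with ⟨-, rfl⟩ | ⟨h3, -⟩ | h3 | h3
    · exact Sim.of_eq rfl
    all_goals rw [h3] at h2; simp at h2
  · rcases succ_of_ring h1 ht' with ⟨h3, -⟩ | ⟨h3, rfl⟩ | h3 | h3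
    · rw [h2] at h3; simp at h3
    · exact Sim.of_eq rfl
    all_goals rw [h3] at h2; simp at h2
  · obtain ⟨K, e⟩ := s
    simp only at h2
    subst h2
    have hEL : ∀ {e' : Edge}, (z : ℂ) ∈ (⟨.EL, e'⟩ : Step).region → (z : ℂ) ∈ Step.wedge e' :=
      fun h => h
    have hER : ∀ {e' : Edge}, (z : ℂ) ∈ (⟨.ER, e'⟩ : Step).region → (z : ℂ) ∈ Step.wedge e' :=
      fun h => h
    have hD : (z : ℂ) ∈ (⟨.D, e⟩ : Step).region →
        (z : ℂ) ∉ Step.wedge (e * ringTurn ^ 3 * rot 1) ∧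
        (z : ℂ) ∉ Step.wedge (e * ringTurn ^ 4 * halfTurn) := by
      intro h
      rw [← base_EL, ← base_ER]
      exact ⟨fun h' => h.2 (Or.inl h'), fun h' => h.2 (Or.inr h')⟩
    rcases succ_of_Cp ht with rfl | rfl | rfl <;> rcases succ_of_Cp ht' with rfl | rfl | rfl
    · exact Sim.of_eq rfl
    · exact ((hD hz).1 (hEL hz')).elim
    · exact ((hD hz).2 (hER hz')).elim
    · exact ((hD hz').1 (hEL hz)).elim
    · exact Sim.of_eq rfl
    · exact (wedge_EL_disjoint_wedge_ER hs (hEL hz) (hER hz')).elim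
    · exact ((hD hz').2 (hER hz)).elim
    · exact (wedge_EL_disjoint_wedge_ER hs (hEL hz') (hER hz)).elim
    · exact Sim.of_eq rfl
  · obtain ⟨K, e⟩ := s
    simp only at h2
    subst h2
    obtain ⟨k, hk⟩ := isPiece_of_D ht
    obtain ⟨k', hk'⟩ := isPiece_of_D ht'
    exact hk.sim (hs.mul_ring 3).mul_halfTurn hk' hz hz'

/-! ### Steps and their sets of edges -/

/-- Two steps have the same edges. -/
def SameEdges (s t : Step) : Prop := ∀ x, x ∈ s.edges ↔ x ∈ t.edges

theorem SameEdges.symm {s t : Step} (h : SameEdges s t) : SameEdges t s := fun x => (h x).symm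

/-- The kinds of steps with two edges. -/
def pairKind : ℕ → Kind
  | 0 => .B
  | 1 => .C
  | 2 => .Cp
  | _ => .D

theorem edges_pair {j : ℕ} (hj : j ≤ 3) (e : Edge) : (⟨pairKind j, e⟩ : Step).edges =
    [e * ringTurn ^ j, e * ringTurn ^ (7 - j) * halfTurn] := by
  interval_cases j
  exacts [edges_B e, edges_C e, edges_Cp e, edges_D e]

theorem Step.classification (s : Step) : s.kind.IsSingle ∨ (∃ j ≤ 3, s = ⟨pairKind j, s.base⟩) ∨
    s.kind = .EL ∨ s.kind = .ER := by
  obtain ⟨K, e⟩ := s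
  cases K
  · exact Or.inl trivial
  · exact Or.inl trivial
  · exact Or.inl trivial
  · exact Or.inl trivial
  · exact Or.inl trivial
  · exact Or.inr (Or.inl ⟨0, by norm_num, rfl⟩)
  · exact Or.inr (Or.inl ⟨1, by norm_num, rfl⟩)
  · exact Or.inr (Or.inl ⟨2, by norm_num, rfl⟩)
  · exact Or.inr (Or.inl ⟨3, by norm_num, rfl⟩)
  · exact Or.inr (Or.inr (Or.inl rfl))
  · exact Or.inr (Or.inr (Or.inr rfl))

theorem ne_rot_of_apply {M : Edge} (h : 1 < M 2 2) (k : ℤ) : M ≠ rot k := by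
  rintro rfl
  rw [rot_apply_two_two] at h
  exact lt_irrefl _ h

theorem triple_edges {s : Step} (hs : IsNetFrame s.base) (h : s.kind = .EL ∨ s.kind = .ER) :
    ∃ x ∈ s.edges, s.base ∈ s.edges ∧ s.base * rot (-1) ∈ s.edges ∧
      x ≠ s.base ∧ x ≠ s.base * rot (-1) ∧ s.base ≠ s.base * rot (-1) := by
  obtain ⟨K, e⟩ := s
  have h1 : e ≠ e * rot (-1) := fun h =>
    rot_neg_one_ne_one (hs.mul_left_cancel (by rwa [mul_one])).symm
  have h2 : ∀ {M : Edge}, 1 < M 2 2 → e * M ≠ e := fun hM h =>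
    ne_rot_of_apply hM 0 (by rw [rot_zero]; exact hs.mul_left_cancel (by rwa [mul_one]))
  have h3 : ∀ {M : Edge}, 1 < M 2 2 → e * M ≠ e * rot (-1) := fun hM h =>
    ne_rot_of_apply hM (-1) (hs.mul_left_cancel h)
  rcases h with h | h <;> simp only at h <;> subst h
  · exact ⟨_, by rw [edges_EL]; simp, by rw [edges_EL]; simp, by rw [edges_EL]; simp,
      h2 third_EL_apply.2, h3 third_EL_apply.2, h1⟩
  · exact ⟨_, by rw [edges_ER]; simp, by rw [edges_ER]; simp, by rw [edges_ER]; simp,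
      h2 third_ER_apply.2, h3 third_ER_apply.2, h1⟩

theorem SameEdges.of_single {s t : Step} (h : SameEdges s t) (hs : IsNetFrame s.base)
    (ht : t.kind.IsSingle) : s.kind.IsSingle ∧ s.base = t.base := by
  have h1 : ∀ x ∈ s.edges, x = t.base := fun x hx => by
    have := (h x).1 hx
    rwa [edges_of_isSingle ht, List.mem_singleton] at this
  rcases s.classification with h2 | ⟨j, hj, h2⟩ | h2
  · exact ⟨h2, h1 _ (by rw [edges_of_isSingle h2]; simp)⟩
  · exfalso
    rw [h2, edges_pair hj] at h1
    exact hs.ring_pair_ne j (7 - j) ((h1 _ (by simp)).trans (h1 _ (by simp)).symm)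
  · exfalso
    obtain ⟨x, hx, hb, -, hne, -⟩ := triple_edges hs h2
    exact hne ((h1 x hx).trans (h1 _ hb).symm)

theorem SameEdges.of_pair {s t : Step} (h : SameEdges s t) (hs : IsNetFrame s.base)
    (ht' : IsNetFrame t.base) {j : ℕ} (hj : j ≤ 3) (ht : t = ⟨pairKind j, t.base⟩) : s = t := by
  rcases s.classification with h2 | ⟨k, hk, h2⟩ | h2
  · obtain ⟨h3, -⟩ := h.symm.of_single ht' h2
    rw [ht] at h3
    interval_cases j <;> exact h3.elim
  · have h' := h
    rw [h2, ht] at h'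
    have := hs.ring_pair_inj hk hj (e' := t.base) fun x => by
      have := h' x
      rw [edges_pair hk, edges_pair hj] at this
      simpa using this
    rw [h2, ht, this.1, this.2]
  · exfalso
    obtain ⟨x, hx, hy, hz, n1, n2, n3⟩ := triple_edges hs h2
    have h' := h
    rw [ht] at h'
    rw [h', edges_pair hj] at hx hy hz
    simp only [List.mem_cons, List.not_mem_nil, or_false] at hx hy hz
    rcases hx with hx | hx <;> rcases hy with hy | hy
    · exact n1 (hx.trans hy.symm)
    · rcases hz with hz | hz
      · exact n2 (hx.trans hz.symm)
      · exact n3 (hy.trans hz.symm)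
    · rcases hz with hz | hz
      · exact n3 (hy.trans hz.symm)
      · exact n2 (hx.trans hz.symm)
    · exact n1 (hx.trans hy.symm)

theorem SameEdges.not_EL_ER {e : Edge} (he : IsNetFrame e) :
    ¬ SameEdges ⟨.EL, e⟩ ⟨.ER, e⟩ := by
  intro h
  have h1 := (h (e * (rot (-1) * halfTurn * rot 1 * halfTurn))).1 (by rw [edges_EL]; simp)
  rw [edges_ER] at h1
  simp only [List.mem_cons, List.not_mem_nil, or_false] at h1
  rcases h1 with h1 | h1 | h1
  · have h2 := he.mul_left_cancel h1
    have h3 := third_EL_apply.1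
    rw [h2] at h3
    exact lt_asymm h3 third_ER_apply.1
  · exact ne_rot_of_apply third_EL_apply.2 0 (by
      rw [rot_zero]; exact he.mul_left_cancel (by rwa [mul_one]))
  · exact ne_rot_of_apply third_EL_apply.2 (-1) (he.mul_left_cancel h1)

theorem pred_cases {s t : Step} (ht : t ∈ s.successors) :
    ((s.kind.IsSingle ∨ s.kind = .D) ∧ (t.kind.IsSingle ∨ t.kind = .B)) ∨
    ((s.kind = .B ∨ s.kind = .EL ∨ s.kind = .ER) ∧ t = ⟨.C, s.base⟩) ∨
    (s.kind = .C ∧ t = ⟨.Cp, s.base⟩) ∨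
    (s.kind = .Cp ∧ (t = ⟨.D, s.base⟩ ∨ t = ⟨.EL, s.base * ringTurn ^ 3 * rot 1⟩ ∨
      t = ⟨.ER, s.base * ringTurn ^ 4 * halfTurn⟩)) := by
  by_cases h1 : s.kind.IsSingle
  · obtain ⟨k, hk⟩ := isPiece_of_isSingle h1 ht
    exact Or.inl ⟨Or.inl h1, hk.kind⟩
  rcases succ_of_ring h1 ht with h | h | h | h
  · exact Or.inr (Or.inl h)
  · exact Or.inr (Or.inr (Or.inl h))
  · obtain ⟨K, e⟩ := s
    simp only at h
    subst h
    exact Or.inr (Or.inr (Or.inr ⟨rfl, succ_of_Cp ht⟩))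
  · obtain ⟨K, e⟩ := s
    simp only at h
    subst h
    obtain ⟨k, hk⟩ := isPiece_of_D ht
    exact Or.inl ⟨Or.inr rfl, hk.kind⟩

theorem mul_right_cancel_of_mul_eq_one {e e' M N : Edge} (hMN : M * N = 1) (h : e * M = e' * M) :
    e = e' := by
  have := congrArg (fun X : Edge => X * N) h
  simpa only [mul_assoc, hMN, mul_one] using this

/-- The step that precedes a given one is determined by its edges. -/
theorem Sim.pred {s s' t t' : Step} (h : Sim t t') (hs : IsNetFrame s.base)
    (hs' : IsNetFrame s'.base) (ht : t ∈ s.successors) (ht' : t' ∈ s'.successors)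
    (hse : SameEdges s s') : Sim s s' := by
  have hD : ∀ {s : Step}, s.kind = .D → s = ⟨pairKind 3, s.base⟩ := by
    rintro ⟨K, e⟩ h; simp only at h; rw [h]; rfl
  have hB : ∀ {s : Step}, s.kind = .B → s = ⟨pairKind 0, s.base⟩ := by
    rintro ⟨K, e⟩ h; simp only at h; rw [h]; rfl
  have hCp : ∀ {s s' : Step}, s.kind = .Cp → s'.kind = .Cp → s.base = s'.base → Sim s s' :=
    fun h h' hb => ⟨hb, Or.inl (by rw [h, h'])⟩
  by_cases hts : t.kind.IsSingle ∨ t.kind = .B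
  · have hts' : t'.kind.IsSingle ∨ t'.kind = .B := by
      rcases hts with h1 | h1
      · exact Or.inl (h.isSingle h1)
      · right
        rw [← h.eq (by rw [h1]; exact id), h1]
    have key : ∀ {s t : Step}, (t.kind.IsSingle ∨ t.kind = .B) → t ∈ s.successors →
        s.kind.IsSingle ∨ s.kind = .D := by
      intro s t hts ht
      rcases pred_cases ht with h | ⟨-, rfl⟩ | ⟨-, rfl⟩ | ⟨-, rfl | rfl | rfl⟩
      · exact h.1
      all_goals simp [Kind.IsSingle] at hts
    rcases key hts' ht' with h2 | h2
    · have := hse.of_single hs h2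
      exact ⟨this.2, Or.inr ⟨this.1, h2⟩⟩
    · exact Sim.of_eq (hse.of_pair hs hs' (j := 3) le_rfl (hD h2))
  · obtain rfl := h.eq fun h => hts (Or.inl h)
    have not_single : ∀ {s : Step}, t ∈ s.successors →
        ((s.kind = .B ∨ s.kind = .EL ∨ s.kind = .ER) ∧ t = ⟨.C, s.base⟩) ∨
        (s.kind = .C ∧ t = ⟨.Cp, s.base⟩) ∨
        (s.kind = .Cp ∧ (t = ⟨.D, s.base⟩ ∨ t = ⟨.EL, s.base * ringTurn ^ 3 * rot 1⟩ ∨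
          t = ⟨.ER, s.base * ringTurn ^ 4 * halfTurn⟩)) := fun ht =>
      (pred_cases ht).resolve_left fun h => hts h.2
    rcases not_single ht with ⟨h1, h2⟩ | ⟨h1, h2⟩ | ⟨h1, h2⟩ <;>
      rcases not_single ht' with ⟨h3, h4⟩ | ⟨h3, h4⟩ | ⟨h3, h4⟩
    -- A step `C` may follow `B`, `E^L` or `E^R` with the same base; only the set of edges tells
    -- these apart.
    · have hb : s.base = s'.base := by
        rw [h2] at h4; exact (Step.mk.inj h4).2
      obtain ⟨K, e⟩ := s
      obtain ⟨K', e'⟩ := s'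
      simp only at h1 h3 hb
      subst hb
      rcases h3 with rfl | h3
      · exact Sim.of_eq (hse.of_pair hs hs (j := 0) (by norm_num) (hB rfl))
      rcases h1 with rfl | h1
      · exact Sim.of_eq (hse.symm.of_pair hs hs (j := 0) (by norm_num) (hB rfl)).symm
      rcases h1 with rfl | rfl <;> rcases h3 with rfl | rfl
      · exact Sim.of_eq rfl
      · exact (SameEdges.not_EL_ER hs hse).elim
      · exact (SameEdges.not_EL_ER hs hse.symm).elim
      · exact Sim.of_eq rfl
    · rw [h2] at h4; simp at h4
    · rw [h2] at h4; simp at h4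
    · rw [h2] at h4; simp at h4
    · rw [h2] at h4
      exact ⟨(Step.mk.inj h4).2, Or.inl (by rw [h1, h3])⟩
    · rw [h2] at h4; simp at h4
    · rcases h2 with h2 | h2 | h2 <;> rw [h2] at h4 <;> simp at h4
    · rcases h2 with h2 | h2 | h2 <;> rw [h2] at h4 <;> simp at h4
    · refine hCp h1 h3 ?_
      have r3 : ringTurn ^ 3 * ringTurn ^ 5 = 1 := by rw [← pow_add, ringTurn_pow_eight]
      have r4 : ringTurn ^ 4 * ringTurn ^ 4 = 1 := by rw [← pow_add, ringTurn_pow_eight]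
      have r1 : rot 1 * rot (-1) = 1 := by rw [rot_mul, add_neg_cancel, rot_zero]
      have absurd_kind : ∀ {K K' : Kind} {e e' : Edge}, K ≠ K' → (⟨K, e⟩ : Step) = ⟨K', e'⟩ →
          s.base = s'.base := fun hK h => (hK (Step.mk.inj h).1).elim
      rcases h2 with h2 | h2 | h2 <;> rcases h4 with h4 | h4 | h4 <;> rw [h2] at h4
      · exact (Step.mk.inj h4).2
      · exact absurd_kind (by simp) h4
      · exact absurd_kind (by simp) h4
      · exact absurd_kind (by simp) h4
      · exact mul_right_cancel_of_mul_eq_one r3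
          (mul_right_cancel_of_mul_eq_one r1 (Step.mk.inj h4).2)
      · exact absurd_kind (by simp) h4
      · exact absurd_kind (by simp) h4
      · exact absurd_kind (by simp) h4
      · exact mul_right_cancel_of_mul_eq_one r4
          (mul_right_cancel_of_mul_eq_one halfTurn_mul_self (Step.mk.inj h4).2)

/-! ### The left-most branch of a snake -/

/-- The left-most edge of a step. -/
def Step.leftEdge : Step → Edge
  | ⟨.C, e⟩ => e * ringTurn ^ 1
  | ⟨.Cp, e⟩ => e * ringTurn ^ 2
  | ⟨.D, e⟩ => e * ringTurn ^ 3
  | ⟨.ER, e⟩ => e * (halfTurn * rot (-1) * halfTurn)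
  | ⟨_, e⟩ => e

theorem head_edges (s : Step) : s.edges.head? = some s.leftEdge := by
  obtain ⟨K, e⟩ := s
  cases K
  case C => rw [edges_C]; rfl
  case Cp => rw [edges_Cp]; rfl
  case D => rw [edges_D]; rfl
  case ER => rw [edges_ER]; rfl
  all_goals rfl

theorem leftEdge_mem (s : Step) : s.leftEdge ∈ s.edges :=
  List.mem_of_mem_head? (by rw [head_edges]; rfl)

theorem leftEdge_of_isSingle {s : Step} (hs : s.kind.IsSingle) : s.leftEdge = s.base := by
  have := leftEdge_mem s
  rwa [edges_of_isSingle hs, List.mem_singleton] at this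

theorem isNetFrame_leftEdge {s : Step} (hs : IsNetFrame s.base) : IsNetFrame s.leftEdge := by
  obtain ⟨K, e⟩ := s
  cases K
  case C => exact hs.mul_ring 1
  case Cp => exact hs.mul_ring 2
  case D => exact hs.mul_ring 3
  case ER =>
    change IsNetFrame (e * (halfTurn * rot (-1) * halfTurn))
    rw [← mul_assoc, ← mul_assoc]
    exact (hs.mul_halfTurn.mul_rot (-1)).mul_halfTurn
  all_goals exact hs

theorem isNetFrame_base_of_leftEdge {s : Step} (hs : IsNetFrame s.leftEdge) :
    IsNetFrame s.base := by
  have ring : ∀ {e : Edge} {k : ℕ}, IsNetFrame (e * ringTurn ^ k) → IsNetFrame e := by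
    intro e k h
    have := h.mul_ring (7 * k)
    rwa [mul_assoc, ← pow_add, ringTurn_pow_mod (b := 0) (by omega), pow_zero, mul_one] at this
  obtain ⟨K, e⟩ := s
  cases K
  case C => exact ring hs
  case Cp => exact ring hs
  case D => exact ring hs
  case ER =>
    have := (hs.mul_halfTurn.mul_rot 1).mul_halfTurn
    change IsNetFrame (e * (halfTurn * rot (-1) * halfTurn) * halfTurn * rot 1 * halfTurn) at this
    rwa [← mul_assoc, mul_halfTurn_mul_halfTurn, ← mul_assoc, mul_assoc _ (rot (-1)), rot_mul,
      neg_add_cancel, rot_zero, mul_one, mul_halfTurn_mul_halfTurn] at this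
  all_goals exact hs

theorem IsImage.isNetFrame {J : State} {s : Step} (h : IsImage J s) : IsNetFrame s.base := by
  obtain ⟨-, g, hg, h⟩ := h
  refine isNetFrame_base_of_leftEdge ?_
  rw [head_edges, Option.some_inj] at h
  rw [h]
  exact isNetFrame_edgeAt hg _

/-- The left-most edges form a connected path. At `E^R` the left-most edge is the fourth edge of the
left branch around the previous octagon, so the path is not interrupted. -/
theorem leftEdge_succ {s t : Step} (ht : t ∈ s.successors) :
    ∃ k : ℤ, t.leftEdge = s.leftEdge * halfTurn * rot k := by
  have piece : ∀ {y : Edge} {k : ℤ}, IsPiece y k t → t.leftEdge = y * rot k := by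
    intro y k h
    rw [← h.base]
    rcases h.kind with h | h
    · exact leftEdge_of_isSingle h
    · obtain ⟨K, e⟩ := t
      simp only at h
      subst h
      rfl
  by_cases hs : s.kind.IsSingle
  · obtain ⟨k, hk⟩ := isPiece_of_isSingle hs ht
    exact ⟨k, by rw [leftEdge_of_isSingle hs]; exact piece hk⟩
  have ring : ∀ (e : Edge) (k : ℕ), e * ringTurn ^ (k + 1) = e * ringTurn ^ k * halfTurn * rot 1 :=
    fun e k => by rw [pow_succ, mul_assoc, mul_assoc, ← ringTurn]
  rcases succ_of_ring hs ht with ⟨h, rfl⟩ | ⟨h, rfl⟩ | h | h <;> obtain ⟨K, e⟩ := s <;>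
    simp only at h
  · rcases h with rfl | rfl | rfl
    · refine ⟨1, ?_⟩
      change e * ringTurn ^ 1 = e * halfTurn * rot 1
      rw [ring e 0, pow_zero, mul_one]
    · refine ⟨1, ?_⟩
      change e * ringTurn ^ 1 = e * halfTurn * rot 1
      rw [ring e 0, pow_zero, mul_one]
    · refine ⟨2, ?_⟩
      change e * ringTurn ^ 1 = e * (halfTurn * rot (-1) * halfTurn) * halfTurn * rot 2
      rw [ring e 0, pow_zero, mul_one, ← mul_assoc, mul_halfTurn_mul_halfTurn, ← mul_assoc,
        mul_assoc _ (rot (-1)), rot_mul]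
      norm_num
  · subst h
    exact ⟨1, ring e 1⟩
  · subst h
    rcases succ_of_Cp ht with rfl | rfl | rfl
    · exact ⟨1, ring e 2⟩
    · refine ⟨2, ?_⟩
      change e * ringTurn ^ 3 * rot 1 = e * ringTurn ^ 2 * halfTurn * rot 2
      rw [ring e 2, mul_assoc _ (rot 1), rot_mul]
      norm_num
    · refine ⟨1, ?_⟩
      change e * ringTurn ^ 4 * halfTurn * (halfTurn * rot (-1) * halfTurn) = _
      rw [← mul_assoc, ← mul_assoc, mul_halfTurn_mul_halfTurn, rot_neg_one_eq, ← mul_assoc,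
        mul_halfTurn_mul_halfTurn, mul_assoc, ← pow_add, ringTurn_pow_mod (a := 4 + 7) (b := 3) rfl]
      exact ring e 2
  · subst h
    obtain ⟨k, hk⟩ := isPiece_of_D ht
    exact ⟨k, piece hk⟩

theorem source_mul_rot (e : Edge) (k : ℤ) : Edge.source (e * rot k) = e.source := by
  have : (rot k).mulVec ![0, 0, 1] = ![0, 0, 1] := by
    ext i
    fin_cases i <;> simp [rot, Matrix.mulVec, dotProduct, Fin.sum_univ_three]
  rw [source, ← Matrix.mulVec_mulVec, this]; rfl

theorem source_leftEdge_succ {s t : Step} (ht : t ∈ s.successors) :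
    t.leftEdge.source = s.leftEdge.target := by
  obtain ⟨k, hk⟩ := leftEdge_succ ht
  rw [hk, source_mul_rot]
  rfl

theorem source_leftEdge_mem_support (s : Step) : s.leftEdge.source ∈ s.support :=
  Set.mem_biUnion (leftEdge_mem s) (left_mem_segment ℝ _ _)

/-! ### Limit points and the geodesics that a snake must cross. -/

theorem exists_sign_change {u : ℤ → ℝ} {m M : ℤ} (hmM : m ≤ M) (hm : u m ≤ 0) (hM : 0 < u M) :
    ∃ i, u i ≤ 0 ∧ 0 < u (i + 1) := by
  induction M, hmM using Int.leInduction with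
  | base => exact (hm.not_gt hM).elim
  | succ n hn ih =>
    rcases le_or_gt (u n) 0 with h | h
    · exact ⟨n, h, hM⟩
    · exact ih h

/-- A sequence of steps, each following the previous one. -/
structure IsStepSequence (S : ℤ → Step) : Prop where
  frame : ∀ i, IsNetFrame (S i).base
  succ : ∀ i, S (i + 1) ∈ (S i).successors

theorem IsInfiniteSnake.isStepSequence {S : ℤ → Step} (h : IsInfiniteSnake S) :
    IsStepSequence S := by
  obtain ⟨J, -, h1, h2⟩ := h
  exact ⟨fun i => (h1 i).isNetFrame, h2⟩

theorem IsStepSequence.exists_cross {S : ℤ → Step} (hS : IsStepSequence S) {x : Edge}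
    (hx : IsNetFrame x) {m M : ℤ} (hmM : m ≤ M) (hm : x.height (S m).leftEdge.source ≤ 0)
    (hM : 0 < x.height (S M).leftEdge.source) :
    ∃ i, x.mulVec normal = (S i).leftEdge.mulVec normal := by
  obtain ⟨i, h1, h2⟩ := exists_sign_change (u := fun i => x.height (S i).leftEdge.source) hmM hm hM
  simp only [source_leftEdge_succ (hS.succ i)] at h2
  exact ⟨i, hx.mulVec_normal_eq (isNetFrame_leftEdge (hS.frame i)) h1 h2⟩

theorem eventually_pos_of_isForwardLimit {S : ℤ → Step} {f : Circle} (h : IsForwardLimit S f)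
    {x : Edge} (hx : 0 < x.height f) : ∀ᶠ i in atTop, 0 < x.height (S i).leftEdge.source := by
  have := h {z | 0 < x.height z} ((isOpen_lt continuous_const (continuous_height x)).mem_nhds hx)
  filter_upwards [this] with i hi using hi (source_leftEdge_mem_support _)

theorem eventually_neg_of_isBackwardLimit {S : ℤ → Step} {b : Circle} (h : IsBackwardLimit S b)
    {x : Edge} (hx : x.height b < 0) : ∀ᶠ i in atBot, x.height (S i).leftEdge.source < 0 := by
  have := h {z | x.height z < 0} ((isOpen_lt (continuous_height x) continuous_const).mem_nhds hx)
  filter_upwards [this] with i hi using hi (source_leftEdge_mem_support _)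

/-- A snake crosses every geodesic that separates its limit points. -/
theorem IsStepSequence.exists_cross_of_separates {S : ℤ → Step} (hS : IsStepSequence S)
    {f b : Circle} (hf : IsForwardLimit S f) (hb : IsBackwardLimit S b) {x : Edge}
    (hx : IsNetFrame x) (hxf : 0 < x.height f) (hxb : x.height b < 0) :
    ∃ i, x.mulVec normal = (S i).leftEdge.mulVec normal := by
  obtain ⟨m, hm, hm'⟩ := ((eventually_neg_of_isBackwardLimit hb hxb).and
    (eventually_le_atBot 0)).exists
  obtain ⟨M, hM, hM'⟩ := ((eventually_pos_of_isForwardLimit hf hxf).and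
    (eventually_ge_atTop 0)).exists
  exact hS.exists_cross hx (hm'.trans hM') hm.le hM

theorem eq_of_isForwardLimit {S : ℤ → Step} {f p : Circle} (hf : IsForwardLimit S f)
    (hp : IsForwardLimit S p) : p = f := by
  by_contra hne
  have hne' : (p : ℂ) ≠ f := fun h => hne (Circle.ext h)
  obtain ⟨U, V, hU, hV, h1, h2, h3⟩ := t2_separation hne'
  obtain ⟨i, h4, h5⟩ := ((hp U (hU.mem_nhds h1)).and (hf V (hV.mem_nhds h2))).exists
  have := source_leftEdge_mem_support (S i)
  exact Set.disjoint_left.1 h3 (h4 this) (h5 this)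

theorem eq_of_isBackwardLimit {S : ℤ → Step} {b p : Circle} (hb : IsBackwardLimit S b)
    (hp : IsBackwardLimit S p) : p = b := by
  by_contra hne
  have hne' : (p : ℂ) ≠ b := fun h => hne (Circle.ext h)
  obtain ⟨U, V, hU, hV, h1, h2, h3⟩ := t2_separation hne'
  obtain ⟨i, h4, h5⟩ := ((hp U (hU.mem_nhds h1)).and (hb V (hV.mem_nhds h2))).exists
  have := source_leftEdge_mem_support (S i)
  exact Set.disjoint_left.1 h3 (h4 this) (h5 this)

/-! ### Snakes with their inverses -/

/-- A snake and its inverse, such that the regions of the snake contain `f` and those of the inverse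
contain `b`. -/
structure IsDuo (f b : Circle) (S T : ℤ → Step) : Prop where
  left : IsStepSequence S
  right : IsStepSequence T
  inverse : IsInverse T S
  mem_left : ∀ i, (f : ℂ) ∈ (S i).region
  mem_right : ∀ i, (b : ℂ) ∈ (T i).region

theorem rev_rev (e : Edge) : e.rev.rev = e := mul_halfTurn_mul_halfTurn e

theorem IsInverse.symm {S T : ℤ → Step} (h : IsInverse T S) : IsInverse S T := by
  intro i e
  constructor
  · intro he
    exact ⟨e.rev, (h _ _).2 ⟨e, by rwa [neg_neg], rfl⟩, (rev_rev e).symm⟩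
  · rintro ⟨e', he', rfl⟩
    obtain ⟨e'', h1, rfl⟩ := (h _ _).1 he'
    rwa [rev_rev, ← neg_neg i]

theorem IsDuo.symm {f b : Circle} {S T : ℤ → Step} (h : IsDuo f b S T) : IsDuo b f T S :=
  ⟨h.right, h.left, h.inverse.symm, h.mem_right, h.mem_left⟩

theorem IsDuo.height_nonneg {f b : Circle} {S T : ℤ → Step} (h : IsDuo f b S T) {i : ℤ} {x : Edge}
    (hx : x ∈ (S i).edges) : 0 ≤ x.height f :=
  height_nonneg_of_mem_region (h.left.frame i) (h.mem_left i) hx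

theorem IsDuo.height_rev_nonneg {f b : Circle} {S T : ℤ → Step} (h : IsDuo f b S T) {i : ℤ}
    {x : Edge} (hx : x ∈ (S i).edges) : 0 ≤ x.rev.height b :=
  h.symm.height_nonneg (i := -i) ((h.inverse _ _).2 ⟨x, by rwa [neg_neg], rfl⟩)

/-- The regions of a proper snake contain its forward limit point, and those of its inverse the
backward limit point. -/
theorem IsProperInfiniteSnake.exists_isDuo {S : ℤ → Step} (h : IsProperInfiniteSnake S)
    {f b : Circle} (hfb : Generic f b) (hf : IsForwardLimit S f) (hb : IsBackwardLimit S b) :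
    ∃ T, IsDuo f b S T := by
  obtain ⟨hS, p, q, hpq, hp, hq, hpS, T, hT, hTS, hqT⟩ := h
  have hp' : p = f ∨ p = b := hp.imp (eq_of_isForwardLimit hf) (eq_of_isBackwardLimit hb)
  have hq' : q = f ∨ q = b := hq.imp (eq_of_isForwardLimit hf) (eq_of_isBackwardLimit hb)
  have duo : IsDuo p q S T := ⟨hS.isStepSequence, hT.isStepSequence, hTS, hpS, hqT⟩
  rcases hp' with rfl | rfl
  · rcases hq' with rfl | rfl
    · exact (hpq rfl).elim
    · exact ⟨T, duo⟩
  rcases hq' with rfl | rfl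
  swap
  · exact (hpq rfl).elim
  -- With the roles of the limit points exchanged, every left-most edge would cross towards the
  -- backward limit `p`. The path would have to recross the geodesic of edge `0` in the opposite
  -- direction, which puts both `p` and `q` on that geodesic.
  exfalso
  have h1 : ∀ i, 0 ≤ (S i).leftEdge.height p := fun i => duo.height_nonneg (leftEdge_mem _)
  have h2 : ∀ i, (S i).leftEdge.height q ≤ 0 := fun i => by
    have := duo.height_rev_nonneg (leftEdge_mem (S i))
    rw [rev, height_halfTurn] at this
    linarith
  set x := (S 0).leftEdge with hx
  have hxf : IsNetFrame x := isNetFrame_leftEdge (duo.left.frame 0)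
  have no_return : ∀ {m M : ℤ}, m ≤ M → 0 ≤ x.height (S m).leftEdge.source →
      x.height (S M).leftEdge.source < 0 → False := by
    intro m M hmM hm hM
    obtain ⟨i, hi⟩ := duo.left.exists_cross hxf.mul_halfTurn hmM
      (by rw [height_halfTurn]; linarith) (by rw [height_halfTurn]; linarith)
    have e := fun z => height_eq_of_mulVec_eq hi z
    simp only [height_halfTurn] at e
    have a1 := h1 i
    have a2 := h2 i
    have a3 := h1 0
    have a4 := h2 0
    rw [← e] at a1 a2
    exact hfb x hxf (by linarith) (by linarith)
  rcases (h2 0).lt_or_eq with h3 | h3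
  · have h4 := hf {z | x.height z < 0}
      ((isOpen_lt (continuous_height x) continuous_const).mem_nhds h3)
    obtain ⟨M, hM, hM'⟩ := (h4.and (eventually_ge_atTop 1)).exists
    refine no_return hM' ?_ (hM (source_leftEdge_mem_support _))
    have e1 := source_leftEdge_succ (duo.left.succ 0)
    rw [zero_add] at e1
    rw [e1]
    exact (height_target_self_pos hxf).le
  · have h5 : 0 < x.height p := (h1 0).lt_of_ne fun h => hfb x hxf h3 h.symm
    have h4 := hb {z | 0 < x.height z}
      ((isOpen_lt continuous_const (continuous_height x)).mem_nhds h5)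
    obtain ⟨m, hm, hm'⟩ := (h4.and (eventually_le_atBot 0)).exists
    exact no_return hm' (le_of_lt (hm (source_leftEdge_mem_support _)))
      (height_source_self_neg hxf)

/-! ### Single edges of a snake -/

theorem pred_of_isSingle {s t : Step} (ht : t ∈ s.successors) (h : t.kind.IsSingle) :
    (s.kind.IsSingle ∧ ∃ k : ℤ, 1 ≤ k ∧ k ≤ 7 ∧ (s.kind = .AppR → k ≠ 1) ∧
      (s.kind = .AppL → k ≠ 7) ∧ t = ⟨s.kind.turn k, s.base * halfTurn * rot k⟩) ∨
    (s.kind = .D ∧ ∃ k : ℤ, 2 ≤ k ∧ k ≤ 7 ∧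
      t = ⟨turnD k, s.base * ringTurn ^ 3 * halfTurn * rot k⟩) := by
  rcases pred_cases ht with ⟨h1 | h1, -⟩ | ⟨-, rfl⟩ | ⟨-, rfl⟩ | ⟨-, rfl | rfl | rfl⟩
  · rcases succ_of_isSingle h1 ht with h2 | ⟨k, -, -, rfl⟩
    · exact Or.inl ⟨h1, h2⟩
    · exact h.elim
  · obtain ⟨K, e⟩ := s
    simp only at h1
    subst h1
    rcases succ_of_D ht with h2 | ⟨k, -, -, rfl⟩
    · exact Or.inr ⟨rfl, h2⟩
    · exact h.elim
  all_goals exact h.elim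

/-- Here `y` is the reversed incoming edge. Since `b` is beyond side `0` of this octagon, it can be
beyond a neighbour of side `k` only for extreme turns: `k ≤ 2` on the right, `k ≥ 6` on the left.
There a wedge has been removed or a hypothesis excludes the case. -/
theorem halfCrossing_of_turn {f b : Circle} {t : Step} {y : Edge} {k : ℤ} (hy : IsNetFrame y)
    (ht : t.kind.IsSingle) (hf : (f : ℂ) ∈ t.region) (hb : t.base = y * rot k) (h1 : 1 ≤ k)
    (h7 : k ≤ 7) (h0 : 0 ≤ y.height b) (hr1 : k = 1 → t.kind = .ApR ∨ t.kind = .AppR)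
    (hr2 : k = 2 → Edge.height (y * rot 1) b < 0 ∨ t.kind = .ApR ∨ t.kind = .AppR)
    (hl7 : k = 7 → t.kind = .ApL ∨ t.kind = .AppL)
    (hl6 : k = 6 → Edge.height (y * rot 7) b < 0) : HalfCrossing f b t.base := by
  have only := onlyBeyond_of_mem_region ht hf
  have h0' : 0 ≤ Edge.height (y * rot 0) b := by rwa [rot_zero, mul_one]
  refine ⟨only.pos, only.right, only.left, fun h => ?_, fun h => ?_⟩
  · by_cases hk : t.kind = .ApR ∨ t.kind = .AppR
    · exact right_right_neg_of_mem_region hk hf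
    exfalso
    rw [hb, mul_assoc, rot_mul] at h
    by_cases hk2 : k = 2
    · subst hk2
      exact h.not_gt ((hr2 rfl).resolve_right hk)
    · have : k ≠ 1 := fun h => hk (hr1 h)
      exact hy.not_far b h0' h (by omega) (by omega)
  · by_cases hk : t.kind = .ApL ∨ t.kind = .AppL
    · exact left_left_neg_of_mem_region hk hf
    exfalso
    rw [hb, mul_assoc, rot_mul] at h
    by_cases hk2 : k = 6
    · subst hk2
      exact h.not_gt (hl6 rfl)
    · have : k ≠ 7 := fun h => hk (hl7 h)
      exact hy.not_far b h0' h (by omega) (by omega)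

theorem Kind.turn_one (K : Kind) : K.turn 1 = .ApR ∨ K.turn 1 = .AppR := by
  cases K <;> simp [Kind.turn, Kind.afterRight]

theorem Kind.turn_seven (K : Kind) : K.turn 7 = .ApL ∨ K.turn 7 = .AppL := by
  cases K <;> simp [Kind.turn, Kind.afterLeft]

theorem IsDuo.sameEdges_of_isSingle {f b : Circle} {S T : ℤ → Step} (h : IsDuo f b S T) {i : ℤ}
    (hi : (S i).kind.IsSingle) : (T (-i)).kind.IsSingle ∧ (T (-i)).base = (S i).base * halfTurn := by
  have : SameEdges (T (-i)) ⟨.A, (S i).base * halfTurn⟩ := by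
    intro x
    rw [h.inverse, neg_neg, edges_of_isSingle hi]
    simp [Step.edges, rev]
  exact this.of_single (h.right.frame _) trivial

theorem IsDuo.succ_pred {f b : Circle} {S T : ℤ → Step} (h : IsDuo f b S T) (i : ℤ) :
    S i ∈ (S (i - 1)).successors := by
  have := h.left.succ (i - 1)
  rwa [sub_add_cancel] at this

theorem IsDuo.halfCrossing {f b : Circle} {S T : ℤ → Step} (h : IsDuo f b S T) {i : ℤ}
    (hi : (S i).kind.IsSingle) : HalfCrossing f b (S i).base := by
  have hf := h.left.frame (i - 1)
  rcases pred_of_isSingle (h.succ_pred i) hi with ⟨hs, k, h1, h7, -, -, hk⟩ | ⟨hs, k, h2, h7, hk⟩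
  · obtain ⟨h3, h4⟩ := h.sameEdges_of_isSingle hs
    have only := onlyBeyond_of_mem_region h3 (h.mem_right _)
    rw [h4] at only
    refine halfCrossing_of_turn hf.mul_halfTurn hi (h.mem_left i) (by rw [hk]) h1 h7 only.pos.le
      ?_ ?_ ?_ ?_
    · rintro rfl; rw [hk]; exact Kind.turn_one _
    · rintro rfl; exact Or.inl only.left
    · rintro rfl; rw [hk]; exact Kind.turn_seven _
    · rintro rfl; rw [← rot_emod]; have := only.right; rwa [← rot_emod] at this
  -- After `D`, the point `b` is beyond sides `0` and `1` of the octagon just entered. This is why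
  -- `k = 2` already has a wedge removed, and why `b` cannot be beyond side `7`.
  · have hs' : S (i - 1) = ⟨.D, (S (i - 1)).base⟩ := by rw [← hs]
    have e1 := h.height_rev_nonneg (i := i - 1) (x := (S (i - 1)).base * ringTurn ^ 3)
      (by rw [hs', edges_D]; simp)
    have e2 := h.height_rev_nonneg (i := i - 1)
      (x := (S (i - 1)).base * ringTurn ^ (7 - 3) * halfTurn) (by rw [hs', edges_D]; simp)
    rw [rev, mul_halfTurn_mul_halfTurn] at e2
    refine halfCrossing_of_turn (hf.mul_ring 3).mul_halfTurn hi (h.mem_left i) (by rw [hk])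
      (by omega) h7 e1 (by omega) ?_ ?_ ?_
    · rintro rfl; rw [hk]; exact Or.inr (Or.inl rfl)
    · rintro rfl; rw [hk]; exact Or.inl rfl
    · rintro rfl
      by_contra! hcon
      refine (hf.mul_ring 3).mul_halfTurn.not_far b (j := 1) ?_ hcon (by norm_num) (by norm_num)
      rwa [mul_assoc _ halfTurn, ← ringTurn, mul_assoc, ← pow_succ]

theorem IsDuo.crossing {f b : Circle} {S T : ℤ → Step} (h : IsDuo f b S T) {i : ℤ}
    (hi : (S i).kind.IsSingle) : Crossing f b (S i).base := by
  obtain ⟨h1, h2⟩ := h.sameEdges_of_isSingle hi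
  refine ⟨h.left.frame i, h.halfCrossing hi, ?_⟩
  rw [← h2]
  exact h.symm.halfCrossing h1

/-! ### Corners of a snake -/

/-- Read backwards from the opposite octagon, the second of four edges becomes the third. -/
theorem IsDuo.inverse_C {f b : Circle} {S T : ℤ → Step} (h : IsDuo f b S T) {i : ℤ} {e : Edge}
    (hi : S i = ⟨.C, e⟩) : T (-i) = ⟨.Cp, e * ringTurn ^ 4⟩ := by
  have he : IsNetFrame e := by simpa [hi] using h.left.frame i
  have : SameEdges (T (-i)) ⟨.Cp, e * ringTurn ^ 4⟩ := by
    intro x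
    rw [h.inverse, neg_neg, hi, edges_C, edges_Cp]
    simp only [List.mem_cons, List.not_mem_nil, or_false, exists_eq_or_imp, exists_eq_left, rev,
      mul_halfTurn_mul_halfTurn]
    rw [mul_assoc e (ringTurn ^ 4) (ringTurn ^ 2),
      mul_assoc e (ringTurn ^ 4) (ringTurn ^ (7 - 2)), ← pow_add, ← pow_add,
      ringTurn_pow_mod (a := 4 + (7 - 2)) (b := 1) rfl]
    exact or_comm
  exact this.of_pair (h.right.frame _) (he.mul_ring 4) (j := 2) (by norm_num) rfl

theorem IsDuo.full {f b : Circle} {S T : ℤ → Step} (h : IsDuo f b S T) {i : ℤ} {e : Edge}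
    (hi : S i = ⟨.C, e⟩) : Full f b e := by
  have he : IsNetFrame e := by simpa [hi] using h.left.frame i
  have h1 := h.mem_left i
  have h2 := h.mem_right (-i)
  rw [hi] at h1
  rw [h.inverse_C hi] at h2
  obtain ⟨f0, f3, -, -⟩ := wedge_nonneg (show (f : ℂ) ∈ Step.wedge e from h1)
  obtain ⟨b0, b3, -, -⟩ := wedge_nonneg (show (b : ℂ) ∈ Step.wedge (e * ringTurn ^ 4) from h2)
  rw [height_ring_four] at b0
  rw [height_ring_pow_add, height_ring_add_four e 3] at b3
  exact ⟨he, f0, f3, by linarith, by linarith⟩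

/-- A step with several edges belongs to a passage around an octagon. Each passage contains a `C`,
whose base and the index `k ≤ 3` locate the left-most edge. -/
theorem IsDuo.exists_C {f b : Circle} {S T : ℤ → Step} (h : IsDuo f b S T) {i : ℤ}
    (hi : ¬ (S i).kind.IsSingle) :
    ∃ j e, ∃ k : ℕ, k ≤ 3 ∧ S j = ⟨.C, e⟩ ∧ (S i).leftEdge = e * ringTurn ^ k := by
  have hC : ∀ {i : ℤ}, (S i).kind = .C → S i = ⟨.C, (S i).base⟩ := fun h => by rw [← h]
  have hCp : ∀ {i : ℤ}, (S i).kind = .Cp → S (i - 1) = ⟨.C, (S i).base⟩ := by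
    intro i hi
    rcases pred_cases (h.succ_pred i) with ⟨-, h2⟩ | ⟨-, h2⟩ | ⟨h1, h2⟩ | ⟨-, h2 | h2 | h2⟩
    · rw [hi] at h2; simp [Kind.IsSingle] at h2
    · rw [h2] at hi; simp at hi
    · rw [h2]; exact hC h1
    all_goals rw [h2] at hi; simp at hi
  have next : (S i).kind = .B ∨ (S i).kind = .EL → S (i + 1) = ⟨.C, (S i).base⟩ := by
    intro hi'
    rcases succ_of_ring hi (h.left.succ i) with ⟨-, h2⟩ | ⟨h1, -⟩ | h1 | h1
    · exact h2
    all_goals rw [h1] at hi'; simp at hi'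
  have pred : (S i).kind = .D ∨ (S i).kind = .ER → (S (i - 1)).kind = .Cp ∧
      (S i).leftEdge = (S (i - 1)).base * ringTurn ^ 3 := by
    intro hi'
    rcases pred_cases (h.succ_pred i) with ⟨-, h2⟩ | ⟨-, h2⟩ | ⟨-, h2⟩ | ⟨h1, h2 | h2 | h2⟩
    · rcases hi' with h3 | h3 <;> rw [h3] at h2 <;> simp [Kind.IsSingle] at h2
    · rw [h2] at hi'; simp at hi'
    · rw [h2] at hi'; simp at hi'
    · exact ⟨h1, by rw [h2]; rfl⟩
    · rw [h2] at hi'; simp at hi'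
    · refine ⟨h1, ?_⟩
      rw [h2]
      change (S (i - 1)).base * ringTurn ^ 4 * halfTurn * (halfTurn * rot (-1) * halfTurn) = _
      rw [← mul_assoc, ← mul_assoc, mul_halfTurn_mul_halfTurn, rot_neg_one_eq, ← mul_assoc,
        mul_halfTurn_mul_halfTurn, mul_assoc, ← pow_add,
        ringTurn_pow_mod (a := 4 + 7) (b := 3) rfl]
  have hD : (S i).kind = .D ∨ (S i).kind = .ER →
      ∃ j e, ∃ k : ℕ, k ≤ 3 ∧ S j = ⟨.C, e⟩ ∧ (S i).leftEdge = e * ringTurn ^ k := fun hi' =>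
    ⟨i - 1 - 1, _, 3, le_rfl, hCp (pred hi').1, (pred hi').2⟩
  have hB : (S i).kind = .B ∨ (S i).kind = .EL → (S i).leftEdge = (S i).base * ringTurn ^ 0 := by
    intro hi'
    rw [pow_zero, mul_one]
    generalize S i = s at hi' ⊢
    obtain ⟨K, e⟩ := s
    rcases hi' with h1 | h1 <;> simp only at h1 <;> subst h1 <;> rfl
  rcases (S i).classification with h1 | ⟨j, hj, h1⟩ | h1 | h1
  · exact (hi h1).elim
  · interval_cases j
    · have h2 : (S i).kind = .B ∨ (S i).kind = .EL := Or.inl (by rw [h1]; rfl)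
      exact ⟨i + 1, _, 0, by norm_num, next h2, hB h2⟩
    · exact ⟨i, _, 1, by norm_num, hC (by rw [h1]; rfl), by rw [h1]; rfl⟩
    · exact ⟨i - 1, _, 2, by norm_num, hCp (by rw [h1]; rfl), by rw [h1]; rfl⟩
    · exact hD (Or.inl (by rw [h1]; rfl))
  · exact ⟨i + 1, _, 0, by norm_num, next (Or.inr h1), hB (Or.inr h1)⟩
  · exact hD (Or.inr h1)

/-! ### Two snakes with the same limit points -/

/-- The second snake crosses the same separating geodesic: not around a corner, by
`Crossing.false_of_full`, hence with a single edge, at the same side by `Crossing.eq_zero_of_shift`.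
-/
theorem IsDuo.exists_isSingle {f b : Circle} {S T S' T' : ℤ → Step} (h : IsDuo f b S T)
    (h' : IsDuo f b S' T') (hf : IsForwardLimit S' f) (hb : IsBackwardLimit S' b) {i : ℤ}
    (hi : (S i).kind.IsSingle) : ∃ j, (S' j).kind.IsSingle ∧ (S' j).base = (S i).base := by
  have hc := h.crossing hi
  obtain ⟨f0, -, b0, -⟩ := hc.right_facts
  obtain ⟨j, hj⟩ := h'.left.exists_cross_of_separates hf hb hc.frame f0 b0
  obtain ⟨n, hn⟩ := hc.frame.exists_shift (isNetFrame_leftEdge (h'.left.frame j)) hj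
  by_cases hs : (S' j).kind.IsSingle
  · rw [leftEdge_of_isSingle hs] at hn
    have := h'.crossing hs
    rw [hn] at this
    rw [hc.eq_zero_of_shift this, shift_zero] at hn
    exact ⟨j, hs, hn⟩
  · obtain ⟨m, e, k, hk, hm, he⟩ := h'.exists_C hs
    exact (hc.false_of_full (h'.full hm) hk (he.symm.trans hn)).elim

theorem IsDuo.exists_eq_C {f b : Circle} {S T S' T' : ℤ → Step} (hfb : Generic f b)
    (h : IsDuo f b S T) (h' : IsDuo f b S' T') (hf : IsForwardLimit S' f)
    (hb : IsBackwardLimit S' b) (hS' : ∀ j, ¬ (S' j).kind.IsSingle) {i : ℤ} {e : Edge}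
    (hi : S i = ⟨.C, e⟩) : ∃ j, S' j = ⟨.C, e⟩ := by
  have hF := h.full hi
  -- This geodesic passes through the interior of the wedge, so it separates `f` and `b` strictly
  -- even if one of them lies on the boundary of its wedge.
  have hx := hF.frame.mul_ring 1
  obtain ⟨j, hj⟩ := h'.left.exists_cross_of_separates hf hb hx hF.interior_f.1 hF.interior_b.1
  obtain ⟨n, hn⟩ := hx.exists_shift (isNetFrame_leftEdge (h'.left.frame j)) hj
  obtain ⟨m, e', k, hk, hm, he⟩ := h'.exists_C (hS' j)
  exact ⟨m, by rw [hm, hF.eq_of_shift hfb (h'.full hm) hk (he.symm.trans hn)]⟩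

theorem IsDuo.exists_sim {f b : Circle} {S T S' T' : ℤ → Step} (hfb : Generic f b)
    (h : IsDuo f b S T) (h' : IsDuo f b S' T') (hf : IsForwardLimit S f)
    (hb : IsBackwardLimit S b) (hf' : IsForwardLimit S' f) (hb' : IsBackwardLimit S' b) :
    ∃ i j, Sim (S i) (S' j) ∧ Sim (T (-i)) (T' (-j)) := by
  have single : ∀ {i j : ℤ}, (S i).kind.IsSingle → (S' j).kind.IsSingle →
      (S i).base = (S' j).base → Sim (S i) (S' j) ∧ Sim (T (-i)) (T' (-j)) := by
    intro i j hi hj hij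
    obtain ⟨h1, h2⟩ := h.sameEdges_of_isSingle hi
    obtain ⟨h3, h4⟩ := h'.sameEdges_of_isSingle hj
    exact ⟨⟨hij, Or.inr ⟨hi, hj⟩⟩, by rw [h2, h4, hij], Or.inr ⟨h1, h3⟩⟩
  by_cases hS : ∃ i, (S i).kind.IsSingle
  · obtain ⟨i, hi⟩ := hS
    obtain ⟨j, hj, hij⟩ := h.exists_isSingle h' hf' hb' hi
    exact ⟨i, j, single hi hj hij.symm⟩
  by_cases hS' : ∃ j, (S' j).kind.IsSingle
  · obtain ⟨j, hj⟩ := hS'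
    obtain ⟨i, hi, hij⟩ := h'.exists_isSingle h hf hb hj
    exact ⟨i, j, single hi hj hij⟩
  push Not at hS hS'
  obtain ⟨i, e, -, -, hi, -⟩ := h.exists_C (hS 0)
  obtain ⟨j, hj⟩ := h.exists_eq_C hfb h' hf' hb' hS' hi
  exact ⟨i, j, Sim.of_eq (hi.trans hj.symm),
    Sim.of_eq ((h.inverse_C hi).trans (h'.inverse_C hj).symm)⟩

theorem IsDuo.sim_add {f b : Circle} {S T S' T' : ℤ → Step} (h : IsDuo f b S T)
    (h' : IsDuo f b S' T') {i j : ℤ} (hij : Sim (S i) (S' j)) (n : ℕ) :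
    Sim (S (i + n)) (S' (j + n)) := by
  induction n with
  | zero => simpa using hij
  | succ n ih =>
    rw [Nat.cast_succ, ← add_assoc, ← add_assoc]
    exact ih.succ (h.left.frame _) (h.left.succ _) (h'.left.succ _) (h.mem_left _) (h'.mem_left _)

theorem IsInverse.sameEdges {S T S' T' : ℤ → Step} (h : IsInverse T S) (h' : IsInverse T' S')
    {i j : ℤ} (hij : Sim (T (-i)) (T' (-j))) : SameEdges (S i) (S' j) := by
  intro x
  rw [h.symm, h'.symm, hij.edges]

/-- Going backward along `S` is going forward along `T`: similarity of the inverses gives the edges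
one step earlier, and `Sim.pred` recovers the step from them. -/
theorem IsDuo.sim_sub {f b : Circle} {S T S' T' : ℤ → Step} (h : IsDuo f b S T)
    (h' : IsDuo f b S' T') {i j : ℤ} (hij : Sim (S i) (S' j)) (hij' : Sim (T (-i)) (T' (-j)))
    (n : ℕ) : Sim (S (i - n)) (S' (j - n)) := by
  induction n with
  | zero => simpa using hij
  | succ n ih =>
    have hT := h.symm.sim_add h'.symm hij' (n + 1)
    rw [← sub_eq_neg_add, ← sub_eq_neg_add, ← neg_sub, ← neg_sub j] at hT
    refine ih.pred (h.left.frame _) (h'.left.frame _) ?_ ?_ (h.inverse.sameEdges h'.inverse hT)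
    · have := h.succ_pred (i - n)
      rwa [sub_sub, ← Nat.cast_succ] at this
    · have := h'.succ_pred (j - n)
      rwa [sub_sub, ← Nat.cast_succ] at this

/-! ### Recovering the number of removed wedges. -/

theorem rot_inj {k l : ℤ} (h : rot k = rot l) (h1 : -8 < k - l) (h2 : k - l < 8) : k = l := by
  have h3 : rot (k - l) = 1 := by
    rw [sub_eq_add_neg, ← rot_mul, h, rot_mul, add_neg_cancel, rot_zero]
  have h4 := congrFun (congrFun h3 0) 0
  simp only [rot, Matrix.cons_val', Matrix.of_apply, Matrix.cons_val_zero,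
    Matrix.one_apply_eq] at h4
  have hpi := Real.pi_pos
  have h1' : (-8 : ℝ) < (k - l : ℤ) := by exact_mod_cast h1
  have h2' : ((k - l : ℤ) : ℝ) < 8 := by exact_mod_cast h2
  rw [Real.cos_eq_one_iff_of_lt_of_lt (by nlinarith) (by nlinarith)] at h4
  have h5 : ((k - l : ℤ) : ℝ) = 0 := by
    rcases mul_eq_zero.1 h4 with h | h
    · exact h
    · linarith
  have : k - l = 0 := by exact_mod_cast h5
  omega

/-- The kind of a single edge that follows another step, in terms of that step. -/
theorem Sim.eq_or_turn {s s' t t' : Step} (h : Sim s s') (hs : IsNetFrame s.base)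
    (ht : t ∈ s.successors) (ht' : t' ∈ s'.successors) (htt : Sim t t') (h1 : t.kind.IsSingle) :
    t = t' ∨ ∃ k : ℤ, (s.kind = .AppR → k ≠ 1) ∧ (s.kind = .AppL → k ≠ 7) ∧
      (s'.kind = .AppR → k ≠ 1) ∧ (s'.kind = .AppL → k ≠ 7) ∧
      t.kind = s.kind.turn k ∧ t'.kind = s'.kind.turn k := by
  have hb := htt.1
  rcases pred_of_isSingle ht h1 with ⟨h2, k, k1, k2, k3, k4, hk⟩ | ⟨h2, k, k1, k2, hk⟩ <;>
    rcases pred_of_isSingle ht' (htt.isSingle h1) with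
      ⟨h3, l, l1, l2, l3, l4, hl⟩ | ⟨h3, l, l1, l2, hl⟩
  · rw [hk, hl, ← h.1] at hb
    obtain rfl := rot_inj (hs.mul_halfTurn.mul_left_cancel hb) (by omega) (by omega)
    exact Or.inr ⟨k, k3, k4, l3, l4, by rw [hk], by rw [hl]⟩
  · have := h.isSingle h2
    rw [h3] at this
    exact this.elim
  · have := h.symm.isSingle h3
    rw [h2] at this
    exact this.elim
  · rw [hk, hl, ← h.1] at hb
    obtain rfl := rot_inj ((hs.mul_ring 3).mul_halfTurn.mul_left_cancel hb) (by omega) (by omega)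
    exact Or.inl (by rw [hk, hl, h.1])

/-- The side that has lost wedges depends only on the turn, not on the preceding kind. -/
theorem Kind.turn_eq_iff {K L : Kind} (k : ℤ) :
    ((K.turn k = .ApR ∨ K.turn k = .AppR) ↔ (L.turn k = .ApR ∨ L.turn k = .AppR)) ∧
    ((K.turn k = .ApL ∨ K.turn k = .AppL) ↔ (L.turn k = .ApL ∨ L.turn k = .AppL)) := by
  unfold Kind.turn
  split_ifs <;> cases K <;> cases L <;> simp [Kind.afterRight, Kind.afterLeft]

/-- `A'` and `A''` on the same side give different kinds only after a further extreme turn to that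
side, and after `A''` this turn is not available. -/
theorem Kind.turn_congr {K L : Kind} {k : ℤ} (h1 : K = .AppR → k ≠ 1) (h2 : K = .AppL → k ≠ 7)
    (h3 : L = .AppR → k ≠ 1) (h4 : L = .AppL → k ≠ 7)
    (h : ((K = .ApR ∨ K = .AppR) ↔ (L = .ApR ∨ L = .AppR)) ∧
      ((K = .ApL ∨ K = .AppL) ↔ (L = .ApL ∨ L = .AppL))) : K.turn k = L.turn k := by
  unfold Kind.turn
  split_ifs with hk hk'
  · subst hk
    cases K <;> cases L <;> simp_all [Kind.afterRight]
  · subst hk'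
    cases K <;> cases L <;> simp_all [Kind.afterLeft]
  · rfl

/-- The number of removed wedges is determined by the two preceding steps. -/
theorem Sim.eq_of_pred {r r' s s' t t' : Step} (hr : Sim r r') (hs : Sim s s') (ht : Sim t t')
    (hrf : IsNetFrame r.base) (hsf : IsNetFrame s.base) (hrs : s ∈ r.successors)
    (hrs' : s' ∈ r'.successors) (hst : t ∈ s.successors) (hst' : t' ∈ s'.successors) : t = t' := by
  by_cases h1 : t.kind.IsSingle
  swap
  · exact ht.eq h1
  rcases hs.eq_or_turn hsf hst hst' ht h1 with h | ⟨k, k1, k2, k3, k4, h2, h3⟩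
  · exact h
  have hk : t.kind = t'.kind := by
    rw [h2, h3]
    by_cases hs1 : s.kind.IsSingle
    · rcases hr.eq_or_turn hrf hrs hrs' hs hs1 with rfl | ⟨l, -, -, -, -, h4, h5⟩
      · rfl
      · refine Kind.turn_congr k1 k2 k3 k4 ?_
        rw [h4, h5]
        exact Kind.turn_eq_iff l
    · rw [hs.eq hs1]
  obtain ⟨K, e⟩ := t
  obtain ⟨K', e'⟩ := t'
  obtain rfl : K = K' := hk
  obtain rfl : e = e' := ht.1
  rfl

theorem IsDuo.eq_shift {f b : Circle} {S T S' T' : ℤ → Step} (hfb : Generic f b)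
    (h : IsDuo f b S T) (h' : IsDuo f b S' T') (hf : IsForwardLimit S f)
    (hb : IsBackwardLimit S b) (hf' : IsForwardLimit S' f) (hb' : IsBackwardLimit S' b) :
    ∃ k : ℤ, ∀ i : ℤ, S' i = S (i + k) := by
  obtain ⟨i, j, hS, hT⟩ := h.exists_sim hfb h' hf hb hf' hb'
  have sim : ∀ m : ℤ, Sim (S (m + (i - j))) (S' m) := by
    intro m
    rcases le_total j m with hm | hm
    · have := h.sim_add h' hS (m - j).toNat
      rwa [Int.toNat_of_nonneg (by omega), add_sub_cancel, ← add_sub_assoc, add_comm,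
        add_sub_assoc, add_comm, add_comm (i - j)] at this
    · have := h.sim_sub h' hS hT (j - m).toNat
      rw [Int.toNat_of_nonneg (by omega), sub_sub_cancel] at this
      convert this using 2
      ring
  refine ⟨i - j, fun m => ?_⟩
  have e : ∀ n : ℤ, m - n + (i - j) = m + (i - j) - n := fun n => by ring
  have s1 := sim (m - 1)
  have s2 := sim (m - 1 - 1)
  rw [e] at s1
  rw [sub_sub, e, ← sub_sub, ← sub_sub] at s2
  exact (s2.eq_of_pred s1 (sim m) (h.left.frame _) (h.left.frame _) (h.succ_pred _)
    (h'.succ_pred _) (h.succ_pred _) (h'.succ_pred _)).symm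

end Snakes

end

theorem mainTheorem6 (f b : Circle) (hfb : f ≠ b)
    (hN : ¬ ∃ ℓ ∈ Snakes.netGeodesics, (f : ℂ) ∈ ℓ ∧ (b : ℂ) ∈ ℓ)
    (S S' : ℤ → Snakes.Step)
    (hS : Snakes.IsProperInfiniteSnake S) (hS' : Snakes.IsProperInfiniteSnake S')
    (hSf : Snakes.IsForwardLimit S f) (hSb : Snakes.IsBackwardLimit S b)
    (hSf' : Snakes.IsForwardLimit S' f) (hSb' : Snakes.IsBackwardLimit S' b) :
    ∃ k : ℤ, ∀ i : ℤ, S' i = S (i + k) := by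
  have hG := Snakes.generic_of_not_mem hN
  obtain ⟨T, h⟩ := hS.exists_isDuo hG hSf hSb
  obtain ⟨T', h'⟩ := hS'.exists_isDuo hG hSf' hSb'
  exact h.eq_shift hG h' hSf hSb hSf' hSb'
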